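/- Let $n\ge 2$ be an even integer, $m=n/2$, $\varepsilon=e^{2\pi i/n}$, and let $\mathbb D_n$ be the dicyclic group of order $2n$ with generators $g,h$ satisfying $g^n=h^4=ghgh^{-1}=1$, $g^m=h^2$. It acts on the free algebra $\mathbb C\langle x,y\rangle$ by $g\cdot x=\varepsilon x$, $g\cdot y=\varepsilon^{-1}y$, $h\cdot x=y$, $h\cdot y=-x$. Let $c=\sum_{i\in\mathbb Z/n}c_ig^i\in\mathbb C[\mathbb D_n]$ with $c_0\ne0$ and $c_i=c_{-i}$ for all $i$, and let $$H_c=(\mathbb C\langle x,y\rangle\#\mathbb D_n)/(xy-yx-c).$$ A trace on $H_c$ is a linear map $T\colon H_c\to\mathbb C$ with $T(ab)=T(ba)$ for all $a,b$. For $q\in\mathbb Z$ put $$k=\frac1{c_0}\Big(xy+\sum_{i=1}^{n-1}\frac{c_ig^i}{\varepsilon^i-1}\Big)-\frac12,\qquad e_q=\frac1n\sum_{i=0}^{n-1}\varepsilon^{iq}g^i,\qquad \alpha_q=\frac1{c_0}\sum_{i=1}^{n-1}\frac{c_i\varepsilon^{-iq}}{\varepsilon^i-1},$$ $$\mathbf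 P(X)=\prod_{q=0}^{n-1}\Big(X-e^{\frac{2\pi i}n(\alpha_q-q-\frac12)}\Big).$$ A good contour is a piecewise $C^1$ curve $C\subset\mathbb C$ without self-intersections, oriented upwards, which meets every horizontal line in exactly one point and is such that: (i) for some real $r>0$ and $a$, outside the disk of radius $r$ centered at $0$ it coincides with $(a+i\mathbb R_{>0})\cup(-a+i\mathbb R_{<0})$; (ii) for all integers $q$ the set $\alpha_q-\mathbb Z_{>0}+\frac12$ lies to the left of $C$ and the set $\alpha_q+\mathbb Z_{\ge0}+\frac12$ lies to the right of $C$; (iii) $C=-C$. Let $C$ be a good contour. For a polynomial $G\in\mathbb C[X]$ of degree at most $n-2$ with $G(X)=X^{n-2}G(X^{-1})$ put $$w_0(z)=e^{\frac{2\pi i}nz}\,\frac{G\big(e^{\frac{2\pi i}nz}\big)}{\mathbf P\big(e^{\frac{2\pi i}nz}\big)},\qquad w_q(z)=w_0(z-q).$$ Then all integrals $\int_CR(z)w_q(z)\,dz$ with $R\in\mathbb C[X]$, $q\in\mathbb Z$, converge absolutely, and the following hold. (1) For every trace $T$ on $H_c$ there are a unique such $G$ and unique $s,t\in\mathbb C$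 with $$T(R(k)e_q)=\int_CR(z)w_q(z)\,dz\ \ (R\in\mathbb C[X],\ q\in\mathbb Z),\qquad T(g^{2i}h)=s,\quad T(g^{2i+1}h)=t\ \ (i\in\mathbb Z).\qquad(*)$$ (2) For every such $G$ and all $s,t\in\mathbb C$ there is exactly one trace $T$ on $H_c$ satisfying $(*)$. (3) Given such $G$ and $s,t$, a linear map $T\colon H_c\to\mathbb C$ satisfying $(*)$ is a trace if and only if it obeys the following rules for all $q\in\mathbb Z$ and $R\in\mathbb C[X]$: $T$ is invariant under conjugation by $\mathbb D_n$; $T(x^iR(k)e_q)=T(y^iR(k)e_q)=0$ for $i\ge1$; $T(x^iR(k)e_qh)=T(y^iR(k)e_qh)=0$ for odd $i\ge 1$; for $i\ge0$, $T(x^{2i}R(k)e_qh)=T(S(k)R(k+i)e_{q-i}h)$, where $S$ is the polynomial with $x^iy^ie_{q-i}=S(k)e_{q-i}$, and $T(y^{2i}R(k)e_qh)=(-1)^iT(S(k)R(k-i)e_{q+i}h)$, where $S$ is the polynomial with $y^ix^ie_{q+i}=S(k)e_{q+i}$; $T(k^ie_qh)=0$ for $i\ge1$. -/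

import Mathlib

open Complex Polynomial MeasureTheory Set

noncomputable section

namespace DicyclicTrace

/-! Throughout, `n = 2 * m` is a positive even integer.  `QuaternionGroup m` is the dicyclic group
of order `2 * n`, with elements `a i = g ^ i` and `xa i = h * g ^ i` for `i : ZMod (2 * m)`. -/

/-- The root of unity `ε = exp (2 π i / n)`. -/
def eps (m : ℕ) : ℂ := Complex.exp (2 * Real.pi * I / ((2 * m : ℕ) : ℂ))

/-- The dicyclic group `𝔻_n`. -/
abbrev Dic (m : ℕ) : Type := QuaternionGroup m

/-- The generator `g`, of order `n`. -/
def gGen (m : ℕ) : Dic m := QuaternionGroup.a 1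

/-- The generator `h`, with `h ^ 2 = g ^ m` and `g * h * g * h⁻¹ = 1`. -/
def hGen (m : ℕ) : Dic m := QuaternionGroup.xa 0

/-- The algebra `ℂ⟨x, y⟩` of noncommutative polynomials. -/
abbrev FreeXY : Type := FreeAlgebra ℂ (Fin 2)

/-- The free generator `x`. -/
def freeX : FreeXY := FreeAlgebra.ι ℂ 0

/-- The free generator `y`. -/
def freeY : FreeXY := FreeAlgebra.ι ℂ 1

/-- The images of `x` and `y` under a group element: `g ^ i` sends `x` to `ε ^ i x` and `y` to
`ε ^ (-i) y`, and `h * g ^ i` sends `x` to `ε ^ i y` and `y` to `- ε ^ (-i) x`.  Here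
`ZMod.stdAddChar i = exp (2 π i / n) ^ i`. -/
def genImage {m : ℕ} [NeZero m] : Dic m → Fin 2 → FreeXY
  | QuaternionGroup.a i => ![ZMod.stdAddChar i • freeX, ZMod.stdAddChar (-i) • freeY]
  | QuaternionGroup.xa i => ![ZMod.stdAddChar i • freeY, -(ZMod.stdAddChar (-i) • freeX)]

/-- The algebra endomorphism of `ℂ⟨x, y⟩` by which a group element acts. -/
def actHom {m : ℕ} [NeZero m] (w : Dic m) : FreeXY →ₐ[ℂ] FreeXY :=
  FreeAlgebra.lift ℂ (genImage w)

theorem actHom_one {m : ℕ} [NeZero m] : actHom (1 : Dic m) = AlgHom.id ℂ FreeXY := by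
  apply FreeAlgebra.hom_ext
  funext i
  rw [← QuaternionGroup.a_zero]
  fin_cases i <;>
    simp [actHom, genImage, freeX, freeY, -QuaternionGroup.a_zero]

theorem stdAddChar_natCast_half {m : ℕ} [NeZero m] :
    (ZMod.stdAddChar ((m : ℕ) : ZMod (2 * m)) : ℂ) = -1 := by
  have h := ZMod.stdAddChar_coe (N := 2 * m) (m : ℤ)
  have hm : (m : ℂ) ≠ 0 := Nat.cast_ne_zero.mpr (NeZero.ne m)
  rw [Int.cast_natCast] at h
  rw [h, ← Complex.exp_pi_mul_I]
  congr 1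
  push_cast
  field_simp

theorem actHom_mul {m : ℕ} [NeZero m] (v w : Dic m) :
    actHom (v * w) = (actHom v).comp (actHom w) := by
  apply FreeAlgebra.hom_ext
  funext j
  have hneg : ZMod.stdAddChar (-((m : ℕ) : ZMod (2 * m))) = (-1 : ℂ) := by
    rw [AddChar.map_neg_eq_inv, stdAddChar_natCast_half]; norm_num
  rcases v with i | i <;> rcases w with k | k <;> fin_cases j <;>
    simp [actHom, genImage, freeX, freeY, smul_smul, sub_eq_add_neg, AddChar.map_add_eq_mul,
      stdAddChar_natCast_half, hneg, mul_comm, AddChar.map_neg_eq_inv]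

/-- The action of `𝔻_n` on `ℂ⟨x, y⟩` by algebra automorphisms. -/
instance instAct (m : ℕ) [NeZero m] : MulSemiringAction (Dic m) FreeXY where
  smul w P := actHom w P
  one_smul P := by change actHom 1 P = P; rw [actHom_one]; rfl
  mul_smul v w P := by change actHom (v * w) P = actHom v (actHom w P); rw [actHom_mul]; rfl
  smul_zero w := map_zero (actHom w)
  smul_add w := map_add (actHom w)
  smul_one w := map_one (actHom w)
  smul_mul w := map_mul (actHom w)

instance instActComm (m : ℕ) [NeZero m] : SMulCommClass (Dic m) ℂ FreeXY where
  smul_comm w t P := by change actHom w (t • P) = t • actHom w P; exact map_smul _ _ _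

/-- The skew group algebra `ℂ⟨x, y⟩ # 𝔻_n`, with multiplication
`(P ⊗ v) * (Q ⊗ w) = P v(Q) ⊗ v w`. -/
abbrev Skew (m : ℕ) [NeZero m] : Type := SkewMonoidAlgebra FreeXY (Dic m)

/-- The element `c = ∑ c_i g ^ i` of the group algebra, inside the skew group algebra. -/
def cElt {m : ℕ} [NeZero m] (c : ZMod (2 * m) → ℂ) : Skew m :=
  ∑ i : ZMod (2 * m), c i • SkewMonoidAlgebra.of FreeXY (Dic m) (QuaternionGroup.a i)

/-- The defining relation `x y - y x = c`. -/
inductive Rel {m : ℕ} [NeZero m] (c : ZMod (2 * m) → ℂ) : Skew m → Skew m → Prop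
  | comm : Rel c (SkewMonoidAlgebra.single 1 (freeX * freeY - freeY * freeX)) (cElt c)

/-- The algebra `H_c = (ℂ⟨x, y⟩ # 𝔻_n) / (x y - y x - c)`. -/
abbrev H {m : ℕ} [NeZero m] (c : ZMod (2 * m) → ℂ) : Type := RingQuot (Rel c)

section Elements

variable {m : ℕ} [NeZero m] (c : ZMod (2 * m) → ℂ)

/-- The quotient map onto `H_c`. -/
def toH : Skew m →ₐ[ℂ] H c := RingQuot.mkAlgHom ℂ (Rel c)

/-- The element `x` of `H_c`. -/
def xH : H c := toH c (SkewMonoidAlgebra.single 1 freeX)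

/-- The element `y` of `H_c`. -/
def yH : H c := toH c (SkewMonoidAlgebra.single 1 freeY)

/-- The group elements in `H_c`. -/
def grp : Dic m →* H c := (toH c : Skew m →* H c).comp (SkewMonoidAlgebra.of FreeXY (Dic m))

/-- `k = (1 / c₀) (x y + ∑_{i = 1}^{n - 1} c_i g ^ i / (ε ^ i - 1)) - 1 / 2`. -/
def kH : H c :=
  (1 / c 0) • (xH c * yH c
    + ∑ i ∈ Finset.Ico 1 (2 * m), (c (i : ZMod (2 * m)) / (eps m ^ i - 1)) • grp c (gGen m ^ i))
  - algebraMap ℂ (H c) (1 / 2)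

/-- `e_q = (1 / n) ∑_{i = 0}^{n - 1} ε ^ (i q) g ^ i`. -/
def eH (q : ℤ) : H c :=
  (1 / ((2 * m : ℕ) : ℂ)) •
    ∑ i ∈ Finset.range (2 * m), (eps m ^ ((i : ℤ) * q)) • grp c (gGen m ^ i)

/-- `α_q = (1 / c₀) ∑_{i = 1}^{n - 1} c_i ε ^ (- i q) / (ε ^ i - 1)`. -/
def alpha (q : ℤ) : ℂ :=
  (1 / c 0) * ∑ i ∈ Finset.Ico 1 (2 * m),
    c (i : ZMod (2 * m)) * eps m ^ (-((i : ℤ) * q)) / (eps m ^ i - 1)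

/-- A trace on `H_c`: a linear functional with `T (a b) = T (b a)`. -/
def IsTrace (T : H c →ₗ[ℂ] ℂ) : Prop := ∀ a b : H c, T (a * b) = T (b * a)

/-- `𝐏(X) = ∏_{q = 0}^{n - 1} (X - exp ((2 π i / n) (α_q - q - 1 / 2)))`. -/
def bP : ℂ[X] :=
  ∏ q ∈ Finset.range (2 * m),
    (X - C (Complex.exp (2 * Real.pi * I / ((2 * m : ℕ) : ℂ)
      * (alpha c (q : ℤ) - (q : ℂ) - 1 / 2))))

/-- `w₀(z) = exp (2 π i z / n) G(exp (2 π i z / n)) / 𝐏(exp (2 π i z / n))`. -/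
def w0 (G : ℂ[X]) (z : ℂ) : ℂ :=
  Complex.exp (2 * Real.pi * I / ((2 * m : ℕ) : ℂ) * z) *
    (G.eval (Complex.exp (2 * Real.pi * I / ((2 * m : ℕ) : ℂ) * z)) /
      (bP c).eval (Complex.exp (2 * Real.pi * I / ((2 * m : ℕ) : ℂ) * z)))

/-- `w_q(z) = w₀(z - q)`. -/
def wq (G : ℂ[X]) (q : ℤ) (z : ℂ) : ℂ := w0 c G (z - (q : ℂ))

end Elements

/-- `G` has degree at most `n - 2` and `G(X) = X ^ (n - 2) G(1 / X)`. -/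
def IsPalindromic (m : ℕ) (G : ℂ[X]) : Prop :=
  G.natDegree ≤ 2 * m - 2 ∧ ∀ z : ℂ, z ≠ 0 → G.eval z = z ^ (2 * m - 2) * G.eval z⁻¹

/-- `γ` is continuous and, apart from finitely many break points, continuously differentiable, with
one-sided derivatives at the break points. -/
def PiecewiseC1 (γ : ℝ → ℂ) : Prop :=
  Continuous γ ∧ ∃ S : Finset ℝ, ∀ s t : ℝ, s < t → Disjoint (Ioo s t) (S : Set ℝ) →
    ContDiffOn ℝ 1 γ (Icc s t)

/-- `z` is to the left of the upward curve `γ`: it has smaller real part than the points of the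
curve on the horizontal line through `z`. -/
def LeftOf (γ : ℝ → ℂ) (z : ℂ) : Prop := ∀ t : ℝ, (γ t).im = z.im → z.re < (γ t).re

/-- `z` is to the right of the upward curve `γ`. -/
def RightOf (γ : ℝ → ℂ) (z : ℂ) : Prop := ∀ t : ℝ, (γ t).im = z.im → (γ t).re < z.re

/-- `γ` is a (piecewise `C¹`, upward oriented) parametrization of a good contour `C = range γ` for
the numbers `α q`.  The condition `upward` makes `γ` injective, and for a continuous `γ` with
`one_point` it says nothing more than that `γ` is injective and runs upwards. -/
structure IsGoodContour (α : ℤ → ℂ) (γ : ℝ → ℂ) : Prop where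
  piecewiseC1 : PiecewiseC1 γ
  upward : StrictMono fun t => (γ t).im
  one_point : ∀ r : ℝ, ∃! z : ℂ, z ∈ range γ ∧ z.im = r
  straight : ∃ r a : ℝ, 0 < r ∧
    range γ \ Metric.ball 0 r =
      ({z : ℂ | z.re = a ∧ 0 < z.im} ∪ {z : ℂ | z.re = -a ∧ z.im < 0}) \ Metric.ball 0 r
  left : ∀ (q : ℤ) (j : ℕ), 0 < j → LeftOf γ (α q - (j : ℂ) + 1 / 2)
  right : ∀ (q : ℤ) (j : ℕ), RightOf γ (α q + (j : ℂ) + 1 / 2)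
  symm : ∀ z ∈ range γ, -z ∈ range γ

/-- The integrand of `∫_C f(z) dz`, pulled back along the parametrization `γ` of `C`. -/
def pullback (γ : ℝ → ℂ) (f : ℂ → ℂ) (t : ℝ) : ℂ := f (γ t) * deriv γ t

/-- The contour integral `∫_C f(z) dz` along the parametrized curve `γ`. -/
def contourIntegral (γ : ℝ → ℂ) (f : ℂ → ℂ) : ℂ := ∫ t : ℝ, pullback γ f t

section Traces

variable {m : ℕ} [NeZero m] (c : ZMod (2 * m) → ℂ)

/-- `T (R(k) e_q) = ∫_C R(z) w_q(z) dz` for all `R` and `q`. -/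
def HasIntegralFormula (γ : ℝ → ℂ) (G : ℂ[X]) (T : H c →ₗ[ℂ] ℂ) : Prop :=
  ∀ (q : ℤ) (R : ℂ[X]),
    T (aeval (kH c) R * eH c q) = contourIntegral γ fun z => R.eval z * wq c G q z

/-- `T` has the values `s` and `t` on the conjugacy classes `{g ^ (2 i) h}` and
`{g ^ (2 i + 1) h}`. -/
def HasClassValues (s t : ℂ) (T : H c →ₗ[ℂ] ℂ) : Prop :=
  (∀ i : ℤ, T (grp c (gGen m ^ (2 * i) * hGen m)) = s) ∧
    ∀ i : ℤ, T (grp c (gGen m ^ (2 * i + 1) * hGen m)) = t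

/-- The rules by which a functional is extended to `H_c` from its values on the elements `R(k) e_q`
and on the conjugacy classes of `h` and `g h`. -/
structure IsExtended (T : H c →ₗ[ℂ] ℂ) : Prop where
  inv : ∀ (w : Dic m) (b : H c), T (grp c w * b * grp c w⁻¹) = T b
  off_diagonal : ∀ (i : ℕ) (R : ℂ[X]) (q : ℤ), i ≠ 0 →
    T (xH c ^ i * aeval (kH c) R * eH c q) = 0 ∧ T (yH c ^ i * aeval (kH c) R * eH c q) = 0
  odd : ∀ (i : ℕ) (R : ℂ[X]) (q : ℤ), ¬ 2 ∣ i →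
    T (xH c ^ i * aeval (kH c) R * eH c q * grp c (hGen m)) = 0 ∧
      T (yH c ^ i * aeval (kH c) R * eH c q * grp c (hGen m)) = 0
  even_x : ∀ (i : ℕ) (R S : ℂ[X]) (q : ℤ),
    xH c ^ i * yH c ^ i * eH c (q - i) = aeval (kH c) S * eH c (q - i) →
    T (xH c ^ (2 * i) * aeval (kH c) R * eH c q * grp c (hGen m)) =
      T (aeval (kH c) S * aeval (kH c + (i : H c)) R * eH c (q - i) * grp c (hGen m))
  even_y : ∀ (i : ℕ) (R S : ℂ[X]) (q : ℤ),
    yH c ^ i * xH c ^ i * eH c (q + i) = aeval (kH c) S * eH c (q + i) →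
    T (yH c ^ (2 * i) * aeval (kH c) R * eH c q * grp c (hGen m)) =
      (-1) ^ i * T (aeval (kH c) S * aeval (kH c - (i : H c)) R * eH c (q + i) * grp c (hGen m))
  k_pow : ∀ (i : ℕ) (q : ℤ), 0 < i → T (kH c ^ i * eH c q * grp c (hGen m)) = 0

end Traces

end DicyclicTrace

end

/-! In `H_c` one has `x k = (k + 1) x`, `y k = (k - 1) y`, `h k = -k h`, while `g` commutes with
`k`; also `x y e_q = L_q(k) e_q` with `L_q` linear of root `α_q - 1/2`. Hence the elements `x^i R(k)
e_q` and `y^i R(k) e_q`, together with their products with `h`, span `H_c` (`mem_of_normal`).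
Cyclicity then determines a trace from two pieces of data: the functionals `J_q(R) = T(R(k) e_q)`
and the numbers `T(e_q h)`.

Diagonal part. Commuting `x` with `y R(k) e_q` gives `J_q(L_q R) = J_{q+1}((L_q R)(X - 1))`, which
says that `J_q(f(X + 1)) - J_{q+1}(f) = κ_q f(α_q + 1/2)` for some numbers `κ_q`
(`shift_of_lin_shift`). An `n`-periodic family is determined by its `κ_q` (`family_ext`), because a
functional on polynomials that is invariant under a nonzero translation vanishes. The contour
integrals satisfy the same relation with `κ_q = n G(ρ_q) / 𝐏'(ρ_q)`: passing from `C` to `C + 1`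
crosses exactly one pole of `w_{q+1}`, the simple pole `α_q + 1/2`
(`IsGoodContour.contourIntegral_shift`). By Lagrange interpolation at the roots `ρ_q`, polynomials
of degree at most `n - 2` correspond to periodic `κ` with sum zero over a period, and palindromic
ones to those with `κ_q = -κ_{-q-1}`. A trace has `κ_q = J_q(1) - J_{q+1}(1)`, so the sum telescopes
to zero, and invariance under `h` gives the antisymmetry. This matches traces with polynomials `G`.

Part with `h`. Since `k` anticommutes with `h`, only the values `T(e_q h)` survive; they are the
finite Fourier transform of the class values `s, t`, supported on `2 q = 0`.

Existence needs the values on normal forms to be freely assignable. A representation by two-by-two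
matrices over operators on `Model` provides this (`buildTrace`), and `Rules.isTrace` reduces the
trace property to the extension rules and the shift identity. -/

noncomputable section

namespace DicyclicTrace

/-! ### Generators and relations of `H_c`. -/

section Algebra

set_option maxSynthPendingDepth 4
set_option linter.unusedSectionVars false

variable {m : ℕ} [NeZero m] {c : ZMod (2 * m) → ℂ}

/-! ### The character `j ↦ ε ^ j` -/

theorem eps_eq : eps m = (ZMod.stdAddChar (1 : ZMod (2 * m)) : ℂ) := by
  have h := ZMod.stdAddChar_coe (N := 2 * m) (1 : ℤ)
  rw [Int.cast_one] at h
  rw [h, eps]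
  congr 1
  push_cast
  ring

theorem eps_zpow (j : ℤ) : eps m ^ j = (ZMod.stdAddChar (j : ZMod (2 * m)) : ℂ) := by
  rw [eps_eq, ← AddChar.map_zsmul_eq_zpow, zsmul_eq_mul, mul_one]

theorem eps_pow (j : ℕ) : eps m ^ j = (ZMod.stdAddChar (j : ZMod (2 * m)) : ℂ) := by
  have := eps_zpow (m := m) (j : ℤ)
  rwa [zpow_natCast, Int.cast_natCast] at this

theorem gGen_pow (j : ℕ) : gGen m ^ j = QuaternionGroup.a (j : ZMod (2 * m)) :=
  QuaternionGroup.a_one_pow j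

theorem gGen_zpow (j : ℤ) : gGen m ^ j = QuaternionGroup.a (j : ZMod (2 * m)) := by
  cases j with
  | ofNat k => simp [gGen_pow]
  | negSucc k =>
    rw [zpow_negSucc, gGen_pow, inv_eq_iff_mul_eq_one]
    simp

theorem sum_range_zmod {A : Type*} [AddCommMonoid A] (n : ℕ) [NeZero n] (f : ZMod n → A) :
    ∑ i ∈ Finset.range n, f (i : ZMod n) = ∑ j : ZMod n, f j := by
  refine Finset.sum_bij (fun i _ => (i : ZMod n)) (fun _ _ => Finset.mem_univ _) ?_ ?_ ?_
  · intro a ha b hb h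
    have := (ZMod.natCast_eq_natCast_iff' a b n).1 h
    rwa [Nat.mod_eq_of_lt (Finset.mem_range.1 ha), Nat.mod_eq_of_lt (Finset.mem_range.1 hb)] at this
  · intro b _
    exact ⟨b.val, Finset.mem_range.2 (ZMod.val_lt b), ZMod.natCast_zmod_val b⟩
  · intros; rfl

theorem sum_Ico_zmod {A : Type*} [AddCommMonoid A] (n : ℕ) [NeZero n] (f : ZMod n → A)
    (h : f 0 = 0) : ∑ i ∈ Finset.Ico 1 n, f (i : ZMod n) = ∑ j : ZMod n, f j := by
  rw [← sum_range_zmod, Finset.range_eq_Ico, Finset.sum_eq_sum_Ico_succ_bot (NeZero.pos n)]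
  simp [h]

theorem stdAddChar_ne_one {n : ℕ} [NeZero n] {j : ZMod n} (hj : j ≠ 0) :
    (ZMod.stdAddChar j : ℂ) ≠ 1 := by
  intro h
  apply hj
  apply ZMod.injective_stdAddChar
  rw [h, AddChar.map_zero_eq_one]

theorem stdAddChar_ne_zero {n : ℕ} [NeZero n] (j : ZMod n) : (ZMod.stdAddChar j : ℂ) ≠ 0 :=
  (AddChar.val_isUnit _ j).ne_zero

theorem sum_stdAddChar_mul {n : ℕ} [NeZero n] (b : ZMod n) :
    ∑ j : ZMod n, (ZMod.stdAddChar (j * b) : ℂ) = if b = 0 then (n : ℂ) else 0 := by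
  rw [AddChar.sum_mulShift b (ZMod.isPrimitive_stdAddChar n), ZMod.card]
  split_ifs <;> simp

/-! ### Relations between the generators -/

theorem grp_mul_toH (w : Dic m) (P : FreeXY) :
    grp c w * toH c (SkewMonoidAlgebra.single 1 P) =
      toH c (SkewMonoidAlgebra.single 1 (w • P)) * grp c w := by
  change toH c (SkewMonoidAlgebra.of FreeXY (Dic m) w) * _ =
    _ * toH c (SkewMonoidAlgebra.of FreeXY (Dic m) w)
  rw [← map_mul, ← map_mul]
  simp [SkewMonoidAlgebra.of_apply, SkewMonoidAlgebra.single_mul_single]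

theorem toH_single_smul (t : ℂ) (P : FreeXY) :
    toH c (SkewMonoidAlgebra.single 1 (t • P)) = t • toH c (SkewMonoidAlgebra.single 1 P) := by
  rw [← map_smul, SkewMonoidAlgebra.smul_single]

theorem smul_freeX (w : Dic m) : w • freeX = genImage w 0 := by
  change actHom w freeX = _
  simp [actHom, freeX]

theorem smul_freeY (w : Dic m) : w • freeY = genImage w 1 := by
  change actHom w freeY = _
  simp [actHom, freeY]

theorem a_mul_x (j : ZMod (2 * m)) :
    grp c (.a j) * xH c = (ZMod.stdAddChar j : ℂ) • (xH c * grp c (.a j)) := by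
  rw [xH, grp_mul_toH, smul_freeX]
  simp [genImage, toH_single_smul]

theorem a_mul_y (j : ZMod (2 * m)) :
    grp c (.a j) * yH c = (ZMod.stdAddChar (-j) : ℂ) • (yH c * grp c (.a j)) := by
  rw [yH, grp_mul_toH, smul_freeY]
  simp [genImage, toH_single_smul]

theorem h_mul_x : grp c (hGen m) * xH c = yH c * grp c (hGen m) := by
  rw [xH, grp_mul_toH, smul_freeX]
  simp [genImage, hGen, yH]

theorem h_mul_y : grp c (hGen m) * yH c = -(xH c * grp c (hGen m)) := by
  rw [yH, grp_mul_toH, smul_freeY]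
  simp only [genImage, hGen, xH, neg_zero, AddChar.map_zero_eq_one, one_smul,
    Matrix.cons_val_one, Matrix.cons_val_fin_one, SkewMonoidAlgebra.single_neg, map_neg, neg_mul]

/-- The element `∑ f j g ^ j` of `H_c`. -/
def cyc (c : ZMod (2 * m) → ℂ) (f : ZMod (2 * m) → ℂ) : H c :=
  ∑ j, f j • grp c (.a j)

theorem x_mul_y_sub : xH c * yH c - yH c * xH c = cyc c c := by
  have h := RingQuot.mkAlgHom_rel ℂ (Rel.comm (c := c))
  have e : toH c (SkewMonoidAlgebra.single 1 (freeX * freeY - freeY * freeX)) =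
      xH c * yH c - yH c * xH c := by
    rw [xH, yH, ← map_mul, ← map_mul, ← map_sub]
    simp [SkewMonoidAlgebra.single_mul_single, sub_eq_add_neg, SkewMonoidAlgebra.single_add, SkewMonoidAlgebra.single_neg]
  rw [← e]
  refine h.trans ?_
  rw [cElt, map_sum, cyc]
  simp only [map_smul]
  rfl

/-- Induction on `H_c`, which is generated by `x`, `y` and the group. -/
theorem H_induction {p : H c → Prop} (hx : p (xH c)) (hy : p (yH c)) (hg : ∀ w, p (grp c w))
    (hadd : ∀ a b, p a → p b → p (a + b)) (hmul : ∀ a b, p a → p b → p (a * b))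
    (hsmul : ∀ (t : ℂ) a, p a → p (t • a)) (a : H c) : p a := by
  obtain ⟨a, rfl⟩ := RingQuot.mkAlgHom_surjective ℂ (Rel c) a
  change p (toH c a)
  have h1 : p 1 := by simpa using hg 1
  have h0 : p 0 := by simpa using hsmul 0 _ h1
  induction a using SkewMonoidAlgebra.induction_on with
  | zero => simpa using h0
  | single w P =>
    have e : (SkewMonoidAlgebra.single w P : Skew m) =
        SkewMonoidAlgebra.single 1 P * SkewMonoidAlgebra.of FreeXY (Dic m) w := by
      simp [SkewMonoidAlgebra.of_apply, SkewMonoidAlgebra.single_mul_single]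
    rw [e, map_mul]
    refine hmul _ _ ?_ (hg w)
    induction P using FreeAlgebra.induction with
    | grade0 r =>
      rw [Algebra.algebraMap_eq_smul_one, toH_single_smul, SkewMonoidAlgebra.single_one_one,
        map_one]
      exact hsmul _ _ h1
    | grade1 i => fin_cases i; exacts [hx, hy]
    | mul a b ha hb =>
      have : (SkewMonoidAlgebra.single 1 (a * b) : Skew m) =
          SkewMonoidAlgebra.single 1 a * SkewMonoidAlgebra.single 1 b := by
        simp [SkewMonoidAlgebra.single_mul_single]
      rw [this, map_mul]
      exact hmul _ _ (ha (by simp [SkewMonoidAlgebra.of_apply, SkewMonoidAlgebra.single_mul_single]))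
        (hb (by simp [SkewMonoidAlgebra.of_apply, SkewMonoidAlgebra.single_mul_single]))
    | add a b ha hb =>
      rw [SkewMonoidAlgebra.single_add, map_add]
      exact hadd _ _ (ha (by simp [SkewMonoidAlgebra.of_apply, SkewMonoidAlgebra.single_mul_single]))
        (hb (by simp [SkewMonoidAlgebra.of_apply, SkewMonoidAlgebra.single_mul_single]))
  | add f g hf hg => rw [map_add]; exact hadd _ _ hf hg

end Algebra

end DicyclicTrace

namespace DicyclicTrace

/-! ### The idempotents `e_q`, the element `k` and their commutation relations. -/

section Cyclic

set_option maxSynthPendingDepth 4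
set_option linter.unusedSectionVars false

variable {m : ℕ} [NeZero m] {c : ZMod (2 * m) → ℂ}

/-- The coefficients `c j / (ε ^ j - 1)`, with value `0` at `j = 0`. -/
def phi (c : ZMod (2 * m) → ℂ) (j : ZMod (2 * m)) : ℂ := c j / (ZMod.stdAddChar j - 1)

theorem phi_zero : phi c 0 = 0 := by simp [phi]

theorem kH_eq : kH c = (1 / c 0) • (xH c * yH c + cyc c (phi c)) - algebraMap ℂ (H c) (1 / 2) := by
  rw [kH, cyc, ← sum_Ico_zmod (2 * m) (fun j => phi c j • grp c (.a j)) (by simp [phi_zero])]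
  simp only [eps_pow, gGen_pow, phi]

theorem eH_eq (q : ℤ) :
    eH c q = cyc c fun j => 1 / ((2 * m : ℕ) : ℂ) * (ZMod.stdAddChar (j * (q : ZMod (2 * m))) : ℂ) := by
  rw [eH, cyc, Finset.smul_sum,
    ← sum_range_zmod (2 * m)
      (fun j => (1 / ((2 * m : ℕ) : ℂ) * (ZMod.stdAddChar (j * (q : ZMod (2 * m))) : ℂ)) • grp c (.a j))]
  refine Finset.sum_congr rfl fun i _ => ?_
  rw [eps_zpow, gGen_pow, smul_smul]
  push_cast
  rfl

theorem alpha_eq (q : ℤ) :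
    alpha c q = 1 / c 0 * ∑ j, phi c j * (ZMod.stdAddChar (-(j * (q : ZMod (2 * m)))) : ℂ) := by
  rw [alpha, ← sum_Ico_zmod (2 * m) (fun j => phi c j * (ZMod.stdAddChar (-(j * (q : ZMod (2 * m)))) : ℂ))
    (by simp [phi_zero])]
  congr 1
  refine Finset.sum_congr rfl fun i _ => ?_
  rw [eps_zpow, eps_pow, phi]
  push_cast
  ring

theorem alpha_congr {p q : ℤ} (h : (p : ZMod (2 * m)) = q) : alpha c p = alpha c q := by
  rw [alpha_eq, alpha_eq, h]

theorem eH_congr {p q : ℤ} (h : (p : ZMod (2 * m)) = q) : eH c p = eH c q := by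
  rw [eH_eq, eH_eq, h]

/-- Off `j = 0` this is `ε^j / (ε^j - 1) = 1 + 1 / (ε^j - 1)`. The correction at `j = 0`, where
`phi` is zero, produces the term `c_0` responsible for the unit shift of `k` under `x`. -/
theorem phi_mul_stdAddChar (j : ZMod (2 * m)) :
    ZMod.stdAddChar j * phi c j = phi c j + c j - if j = 0 then c 0 else 0 := by
  by_cases hj : j = 0
  · subst hj; simp [phi_zero]
  · have := sub_ne_zero.2 (stdAddChar_ne_one hj)
    rw [phi, if_neg hj]
    field_simp
    ring

theorem phi_mul_stdAddChar_neg (j : ZMod (2 * m)) :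
    ZMod.stdAddChar (-j) * phi c j =
      phi c j - ZMod.stdAddChar (-j) * c j + if j = 0 then c 0 else 0 := by
  by_cases hj : j = 0
  · subst hj; simp [phi_zero]
  · have := sub_ne_zero.2 (stdAddChar_ne_one hj)
    have h0 := stdAddChar_ne_zero j
    rw [phi, if_neg hj, AddChar.map_neg_eq_inv]
    field_simp
    ring

/-- From `1 / (ε^{-j} - 1) = -1 - 1 / (ε^j - 1)` and the evenness of `c`. It is the source of every
sign change under `h`. -/
theorem phi_neg (hc : ∀ i, c (-i) = c i) (j : ZMod (2 * m)) :
    phi c (-j) = -phi c j - c j + if j = 0 then c 0 else 0 := by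
  by_cases hj : j = 0
  · subst hj; simp [phi_zero]
  · have h1 := sub_ne_zero.2 (stdAddChar_ne_one hj)
    have h2 := sub_ne_zero.2 (stdAddChar_ne_one (neg_ne_zero.2 hj))
    have h0 := stdAddChar_ne_zero j
    rw [phi, phi, if_neg hj, hc]
    rw [AddChar.map_neg_eq_inv] at h2 ⊢
    have h3 : (ZMod.stdAddChar j : ℂ)⁻¹ - 1 = -(ZMod.stdAddChar j - 1) / ZMod.stdAddChar j := by
      field_simp; ring
    rw [h3]
    field_simp
    ring

theorem alpha_sub_one (hc0 : c 0 ≠ 0) (q : ℤ) :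
    alpha c (q - 1) = alpha c q + 1 / c 0 * ∑ j, c j * (ZMod.stdAddChar (-(j * (q : ZMod (2 * m)))) : ℂ) - 1 := by
  have h : ∀ j : ZMod (2 * m), phi c j * (ZMod.stdAddChar (-(j * ((q - 1 : ℤ) : ZMod (2 * m)))) : ℂ)
      = phi c j * ZMod.stdAddChar (-(j * (q : ZMod (2 * m)))) + c j * ZMod.stdAddChar (-(j * (q : ZMod (2 * m))))
        - if j = 0 then c 0 else 0 := by
    intro j
    have e : -(j * ((q - 1 : ℤ) : ZMod (2 * m))) = j + -(j * (q : ZMod (2 * m))) := by push_cast; ring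
    rw [e, AddChar.map_add_eq_mul, ← mul_assoc, mul_comm (phi c j), phi_mul_stdAddChar]
    split_ifs with hj
    · subst hj; simp
    · ring
  rw [alpha_eq, alpha_eq, Finset.sum_congr rfl fun j _ => h j, Finset.sum_sub_distrib,
    Finset.sum_add_distrib, Finset.sum_ite_eq' Finset.univ (0 : ZMod (2 * m))]
  simp only [Finset.mem_univ, if_true]
  field_simp

/-- The reflection `q ↦ -q - 1` of the indices negates the `α`; later this makes the roots of `𝐏`
closed under inversion. -/
theorem alpha_neg (hc0 : c 0 ≠ 0) (hc : ∀ i, c (-i) = c i) (q : ℤ) :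
    alpha c (-q) = -alpha c (q - 1) := by
  rw [alpha_sub_one hc0, alpha_eq, alpha_eq, ← Equiv.sum_comp (Equiv.neg (ZMod (2 * m)))]
  have h : ∀ j : ZMod (2 * m), phi c (Equiv.neg _ j) *
      (ZMod.stdAddChar (-(Equiv.neg _ j * ((-q : ℤ) : ZMod (2 * m)))) : ℂ)
      = (if j = 0 then c 0 else 0) - (phi c j * ZMod.stdAddChar (-(j * (q : ZMod (2 * m))))
        + c j * ZMod.stdAddChar (-(j * (q : ZMod (2 * m))))) := by
    intro j
    have e : -((Equiv.neg _ j) * ((-q : ℤ) : ZMod (2 * m))) = -(j * (q : ZMod (2 * m))) := by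
      rw [Equiv.neg_apply]; push_cast; ring
    rw [e, Equiv.neg_apply, phi_neg hc]
    split_ifs with hj
    · subst hj; simp
    · ring
  rw [Finset.sum_congr rfl fun j _ => h j, Finset.sum_sub_distrib,
    Finset.sum_add_distrib, Finset.sum_ite_eq' Finset.univ (0 : ZMod (2 * m))]
  simp only [Finset.mem_univ, if_true]
  field_simp
  ring

/-! ### The group algebra of the cyclic group inside `H_c` -/

theorem cyc_add (f f' : ZMod (2 * m) → ℂ) : cyc c (fun j => f j + f' j) = cyc c f + cyc c f' := by
  simp only [cyc, add_smul, Finset.sum_add_distrib]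

theorem cyc_sub (f f' : ZMod (2 * m) → ℂ) : cyc c (fun j => f j - f' j) = cyc c f - cyc c f' := by
  simp only [cyc, sub_smul, Finset.sum_sub_distrib]

theorem cyc_neg (f : ZMod (2 * m) → ℂ) : cyc c (fun j => -f j) = -cyc c f := by
  simp only [cyc, neg_smul, Finset.sum_neg_distrib]

theorem cyc_delta (t : ℂ) : cyc c (fun j => if j = 0 then t else 0) = t • 1 := by
  simp only [cyc, ite_smul, zero_smul, Finset.sum_ite_eq', Finset.mem_univ, if_true]
  rw [QuaternionGroup.a_zero, map_one]

theorem cyc_mul_x (f : ZMod (2 * m) → ℂ) :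
    cyc c f * xH c = xH c * cyc c fun j => ZMod.stdAddChar j * f j := by
  simp only [cyc, Finset.sum_mul, Finset.mul_sum]
  refine Finset.sum_congr rfl fun j _ => ?_
  rw [smul_mul_assoc, a_mul_x, mul_smul_comm, smul_smul, mul_comm (f j)]

theorem cyc_mul_y (f : ZMod (2 * m) → ℂ) :
    cyc c f * yH c = yH c * cyc c fun j => ZMod.stdAddChar (-j) * f j := by
  simp only [cyc, Finset.sum_mul, Finset.mul_sum]
  refine Finset.sum_congr rfl fun j _ => ?_
  rw [smul_mul_assoc, a_mul_y, mul_smul_comm, smul_smul, mul_comm (f j)]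

theorem h_mul_a (j : ZMod (2 * m)) :
    grp c (hGen m) * grp c (.a j) = grp c (.a (-j)) * grp c (hGen m) := by
  rw [← map_mul, ← map_mul]
  simp [hGen]

theorem h_mul_cyc (f : ZMod (2 * m) → ℂ) :
    grp c (hGen m) * cyc c f = cyc c (fun j => f (-j)) * grp c (hGen m) := by
  simp only [cyc, Finset.sum_mul, Finset.mul_sum]
  rw [← Equiv.sum_comp (Equiv.neg (ZMod (2 * m)))]
  refine Finset.sum_congr rfl fun j _ => ?_
  rw [mul_smul_comm, smul_mul_assoc, h_mul_a, Equiv.neg_apply, neg_neg]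

theorem a_mul_cyc (i : ZMod (2 * m)) (f : ZMod (2 * m) → ℂ) :
    grp c (.a i) * cyc c f = cyc c fun j => f (j - i) := by
  simp only [cyc, Finset.mul_sum]
  rw [← Equiv.sum_comp (Equiv.addLeft i) fun j => f (j - i) • grp c (.a j)]
  refine Finset.sum_congr rfl fun j _ => ?_
  rw [mul_smul_comm, ← map_mul, QuaternionGroup.a_mul_a, Equiv.coe_addLeft, add_sub_cancel_left]

theorem a_mul_cyc_comm (i : ZMod (2 * m)) (f : ZMod (2 * m) → ℂ) :
    grp c (.a i) * cyc c f = cyc c f * grp c (.a i) := by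
  simp only [cyc, Finset.mul_sum, Finset.sum_mul]
  refine Finset.sum_congr rfl fun j _ => ?_
  rw [mul_smul_comm, smul_mul_assoc, ← map_mul, ← map_mul, QuaternionGroup.a_mul_a,
    QuaternionGroup.a_mul_a, add_comm]

theorem a_mul_e (i : ZMod (2 * m)) (q : ℤ) :
    grp c (.a i) * eH c q = (ZMod.stdAddChar (-(i * (q : ZMod (2 * m)))) : ℂ) • eH c q := by
  rw [eH_eq, a_mul_cyc]
  simp only [cyc, Finset.smul_sum, smul_smul]
  refine Finset.sum_congr rfl fun j _ => ?_
  rw [show (j - i) * (q : ZMod (2 * m)) = -(i * (q : ZMod (2 * m))) + j * q by ring, AddChar.map_add_eq_mul]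
  congr 1
  ring

theorem cyc_mul_e (f : ZMod (2 * m) → ℂ) (q : ℤ) :
    cyc c f * eH c q = (∑ j, f j * (ZMod.stdAddChar (-(j * (q : ZMod (2 * m)))) : ℂ)) • eH c q := by
  rw [cyc, Finset.sum_mul, Finset.sum_smul]
  refine Finset.sum_congr rfl fun j _ => ?_
  rw [smul_mul_assoc, a_mul_e, smul_smul]

theorem e_mul_x (q : ℤ) : eH c q * xH c = xH c * eH c (q + 1) := by
  rw [eH_eq, eH_eq, cyc_mul_x]
  congr 2
  funext j
  rw [Int.cast_add, Int.cast_one, mul_add, mul_one, AddChar.map_add_eq_mul]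
  ring

theorem e_mul_y (q : ℤ) : eH c q * yH c = yH c * eH c (q - 1) := by
  rw [eH_eq, eH_eq, cyc_mul_y]
  congr 2
  funext j
  rw [Int.cast_sub, Int.cast_one, mul_sub, mul_one, sub_eq_add_neg, AddChar.map_add_eq_mul]
  ring

theorem h_mul_e (q : ℤ) : grp c (hGen m) * eH c q = eH c (-q) * grp c (hGen m) := by
  rw [eH_eq, eH_eq, h_mul_cyc]
  congr 3
  funext j
  rw [Int.cast_neg, mul_neg, neg_mul]

theorem sum_e : ∑ q : ZMod (2 * m), eH c (q.val : ℤ) = 1 := by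
  simp only [eH_eq, cyc]
  rw [Finset.sum_comm]
  have h : ∀ j : ZMod (2 * m), ∑ q : ZMod (2 * m), (1 / ((2 * m : ℕ) : ℂ) *
      (ZMod.stdAddChar (j * ((q.val : ℤ) : ZMod (2 * m))) : ℂ)) • grp c (.a j) =
      (if j = 0 then (1 : ℂ) else 0) • grp c (.a j) := by
    intro j
    rw [← Finset.sum_smul, ← Finset.mul_sum]
    have := sum_stdAddChar_mul j
    simp only [mul_comm _ j] at this
    simp only [Int.cast_natCast, ZMod.natCast_zmod_val, this]
    have hm : (m : ℂ) ≠ 0 := Nat.cast_ne_zero.mpr (NeZero.ne m)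
    split_ifs
    · congr 1
      push_cast
      field_simp
    · simp
  rw [Finset.sum_congr rfl fun j _ => h j]
  exact (cyc_delta (c := c) 1).trans (one_smul _ _)

/-! ### The element `k` -/

theorem xy_eq (hc0 : c 0 ≠ 0) :
    xH c * yH c = c 0 • kH c + (c 0 / 2) • 1 - cyc c (phi c) := by
  rw [kH_eq, Algebra.algebraMap_eq_smul_one]
  match_scalars <;> field_simp <;> ring

/-- Moving `x` past `x y` costs `x (x y - y x)`, and moving it past the group part of `k` costs the
same up to sign, plus `c_0 x`. Only `c_0 x` is left, and `k` carries the factor `1 / c_0`. -/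
theorem x_mul_k (hc0 : c 0 ≠ 0) : xH c * kH c = (kH c + 1) * xH c := by
  have h1 : cyc c (phi c) * xH c =
      xH c * cyc c (phi c) + xH c * (xH c * yH c - yH c * xH c) - c 0 • xH c := by
    rw [cyc_mul_x]
    simp only [phi_mul_stdAddChar]
    rw [cyc_sub, cyc_add, cyc_delta, x_mul_y_sub, mul_sub, mul_add, mul_smul_comm, mul_one]
  rw [kH_eq, Algebra.algebraMap_eq_smul_one]
  simp only [mul_sub, sub_mul, add_mul, mul_add, smul_mul_assoc, mul_smul_comm, mul_one,
    one_mul] at h1 ⊢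
  rw [h1]
  simp only [mul_assoc]
  match_scalars <;> field_simp <;> ring

theorem y_mul_k (hc0 : c 0 ≠ 0) : yH c * kH c = (kH c - 1) * yH c := by
  have h1 : cyc c (phi c) * yH c =
      yH c * cyc c (phi c) - (xH c * yH c - yH c * xH c) * yH c + c 0 • yH c := by
    rw [cyc_mul_y]
    simp only [phi_mul_stdAddChar_neg]
    rw [cyc_add, cyc_sub, cyc_delta, x_mul_y_sub, mul_add, mul_sub, mul_smul_comm, mul_one,
      ← cyc_mul_y]
  rw [kH_eq, Algebra.algebraMap_eq_smul_one]
  simp only [mul_sub, sub_mul, add_mul, mul_add, smul_mul_assoc, mul_smul_comm, mul_one,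
    one_mul] at h1 ⊢
  rw [h1]
  simp only [mul_assoc]
  match_scalars <;> field_simp <;> ring

/-- Conjugation by `h` sends `x y` to `-y x` and the group part to minus itself minus `[x, y]` plus
`c_0`. The total is `-x y` minus the group part plus `c_0`; the constant `-1/2` in `k` is what makes
`k` exactly odd. -/
theorem h_mul_k (hc0 : c 0 ≠ 0) (hc : ∀ i, c (-i) = c i) :
    grp c (hGen m) * kH c = -kH c * grp c (hGen m) := by
  have h1 : grp c (hGen m) * cyc c (phi c) = -(cyc c (phi c) * grp c (hGen m))
      - (xH c * yH c - yH c * xH c) * grp c (hGen m) + c 0 • grp c (hGen m) := by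
    rw [h_mul_cyc]
    simp only [phi_neg hc]
    rw [cyc_add, cyc_sub, cyc_delta, x_mul_y_sub, cyc_neg, add_mul, sub_mul, smul_mul_assoc,
      one_mul, neg_mul]
  have h2 : grp c (hGen m) * (xH c * yH c) = -(yH c * xH c * grp c (hGen m)) := by
    rw [← mul_assoc, h_mul_x, mul_assoc, h_mul_y, mul_neg, mul_assoc]
  rw [kH_eq, Algebra.algebraMap_eq_smul_one]
  simp only [mul_sub, sub_mul, add_mul, mul_add, smul_mul_assoc, mul_smul_comm, mul_one,
    one_mul, neg_mul, h2] at h1 ⊢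
  rw [h1]
  simp only [mul_assoc]
  match_scalars <;> field_simp <;> ring

theorem a_mul_k (j : ZMod (2 * m)) : grp c (.a j) * kH c = kH c * grp c (.a j) := by
  have h : grp c (.a j) * (xH c * yH c) = xH c * yH c * grp c (.a j) := by
    rw [← mul_assoc, a_mul_x, smul_mul_assoc, mul_assoc, a_mul_y, mul_smul_comm, smul_smul,
      ← AddChar.map_add_eq_mul, add_neg_cancel, AddChar.map_zero_eq_one, one_smul, mul_assoc]
  rw [kH_eq, Algebra.algebraMap_eq_smul_one]
  simp only [mul_sub, sub_mul, add_mul, mul_add, smul_mul_assoc, mul_smul_comm, mul_one,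
    one_mul, h, a_mul_cyc_comm]

theorem semiconj_aeval {A : Type*} [Semiring A] [Algebra ℂ A] {a b b' : A}
    (h : a * b = b' * a) (R : ℂ[X]) : a * aeval b R = aeval b' R * a := by
  induction R using Polynomial.induction_on' with
  | add p q hp hq => rw [map_add, map_add, mul_add, add_mul, hp, hq]
  | monomial n t =>
    rw [aeval_monomial, aeval_monomial, ← mul_assoc, ← Algebra.commutes, mul_assoc, mul_assoc]
    congr 1
    induction n with
    | zero => simp
    | succ n ih => rw [pow_succ, ← mul_assoc, ih, mul_assoc, h, ← mul_assoc, ← pow_succ]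

/-- The value `R(k)` of a polynomial at `k`. -/
def kp (c : ZMod (2 * m) → ℂ) (R : ℂ[X]) : H c := aeval (kH c) R

theorem kp_mul (R S : ℂ[X]) : kp c (R * S) = kp c R * kp c S := map_mul _ _ _

theorem kp_add (R S : ℂ[X]) : kp c (R + S) = kp c R + kp c S := map_add _ _ _

theorem kp_one : kp c 1 = 1 := map_one _

theorem kp_smul (t : ℂ) (R : ℂ[X]) : kp c (t • R) = t • kp c R := map_smul (aeval (kH c)) t R

theorem kp_comm (R S : ℂ[X]) : kp c R * kp c S = kp c S * kp c R := by
  rw [← kp_mul, mul_comm, kp_mul]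

/-- `taylor a R` is `R(X + a)`; it serves as the translation operator on polynomials from here on.
-/
theorem aeval_add_eq (a : ℂ) (R : ℂ[X]) :
    aeval (kH c + algebraMap ℂ _ a) R = kp c (taylor a R) := by
  rw [kp, taylor_apply, aeval_comp]
  simp

theorem x_mul_kp (hc0 : c 0 ≠ 0) (R : ℂ[X]) : xH c * kp c R = kp c (taylor 1 R) * xH c := by
  rw [← aeval_add_eq, map_one]
  exact semiconj_aeval (x_mul_k hc0) R

theorem y_mul_kp (hc0 : c 0 ≠ 0) (R : ℂ[X]) : yH c * kp c R = kp c (taylor (-1) R) * yH c := by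
  rw [← aeval_add_eq, map_neg, map_one, ← sub_eq_add_neg]
  exact semiconj_aeval (y_mul_k hc0) R

theorem kp_mul_x (hc0 : c 0 ≠ 0) (R : ℂ[X]) : kp c R * xH c = xH c * kp c (taylor (-1) R) := by
  rw [x_mul_kp hc0, taylor_taylor]; simp

theorem kp_mul_y (hc0 : c 0 ≠ 0) (R : ℂ[X]) : kp c R * yH c = yH c * kp c (taylor 1 R) := by
  rw [y_mul_kp hc0, taylor_taylor]; simp

theorem xpow_mul_kp (hc0 : c 0 ≠ 0) (i : ℕ) (R : ℂ[X]) :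
    xH c ^ i * kp c R = kp c (taylor (i : ℂ) R) * xH c ^ i := by
  induction i generalizing R with
  | zero => simp
  | succ i ih =>
    rw [pow_succ, mul_assoc, x_mul_kp hc0, ← mul_assoc, ih, taylor_taylor, mul_assoc]
    push_cast
    rfl

theorem ypow_mul_kp (hc0 : c 0 ≠ 0) (i : ℕ) (R : ℂ[X]) :
    yH c ^ i * kp c R = kp c (taylor (-i : ℂ) R) * yH c ^ i := by
  induction i generalizing R with
  | zero => simp
  | succ i ih =>
    rw [pow_succ, mul_assoc, y_mul_kp hc0, ← mul_assoc, ih, taylor_taylor, mul_assoc]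
    push_cast
    rw [neg_add]

theorem h_mul_kp (hc0 : c 0 ≠ 0) (hc : ∀ i, c (-i) = c i) (R : ℂ[X]) :
    grp c (hGen m) * kp c R = kp c (R.comp (-X)) * grp c (hGen m) := by
  rw [kp, semiconj_aeval (h_mul_k hc0 hc), kp, aeval_comp]
  simp

theorem a_mul_kp (j : ZMod (2 * m)) (R : ℂ[X]) :
    grp c (.a j) * kp c R = kp c R * grp c (.a j) :=
  semiconj_aeval (a_mul_k j) R

theorem cyc_mul_kp (f : ZMod (2 * m) → ℂ) (R : ℂ[X]) : cyc c f * kp c R = kp c R * cyc c f := by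
  simp only [cyc, Finset.mul_sum, Finset.sum_mul]
  refine Finset.sum_congr rfl fun j _ => ?_
  rw [mul_smul_comm, smul_mul_assoc, a_mul_kp]

theorem e_mul_kp (q : ℤ) (R : ℂ[X]) : eH c q * kp c R = kp c R * eH c q := by
  rw [eH_eq, cyc_mul_kp]

theorem e_mul_xpow (i : ℕ) (q : ℤ) : eH c q * xH c ^ i = xH c ^ i * eH c (q + i) := by
  induction i generalizing q with
  | zero => simp
  | succ i ih =>
    rw [pow_succ, ← mul_assoc, ih, mul_assoc, e_mul_x, ← mul_assoc]
    push_cast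
    rw [add_assoc]

theorem e_mul_ypow (i : ℕ) (q : ℤ) : eH c q * yH c ^ i = yH c ^ i * eH c (q - i) := by
  induction i generalizing q with
  | zero => simp
  | succ i ih =>
    rw [pow_succ, ← mul_assoc, ih, mul_assoc, e_mul_y, ← mul_assoc]
    push_cast
    rw [sub_sub]

/-- The polynomial with `x y e_q = L(k) e_q`. -/
def lin (c : ZMod (2 * m) → ℂ) (q : ℤ) : ℂ[X] := C (c 0) * (X + C (1 / 2 - alpha c q))

theorem xy_mul_e (hc0 : c 0 ≠ 0) (q : ℤ) :
    xH c * yH c * eH c q = kp c (lin c q) * eH c q := by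
  have h : kp c (lin c q) = c 0 • kH c + (c 0 * (1 / 2 - alpha c q)) • 1 := by
    simp only [kp, lin, map_mul, map_add, aeval_C, aeval_X, Algebra.algebraMap_eq_smul_one,
      smul_mul_assoc, one_mul, smul_add, smul_smul]
  rw [h, xy_eq hc0, sub_mul, cyc_mul_e, alpha_eq, add_mul, add_mul]
  simp only [smul_mul_assoc, one_mul]
  match_scalars <;> field_simp

/-- Since `y x = x y - c` and `c` acts on `e_q` by a scalar, `alpha_sub_one` absorbs that scalar
into the passage from `α_q` to `α_{q-1}` and the unit shift. -/
theorem yx_mul_e (hc0 : c 0 ≠ 0) (q : ℤ) :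
    yH c * xH c * eH c q = kp c (taylor (-1) (lin c (q - 1))) * eH c q := by
  have h : taylor (-1) (lin c (q - 1)) =
      lin c q - C (∑ j, c j * (ZMod.stdAddChar (-(j * (q : ZMod (2 * m)))) : ℂ)) := by
    have e : c 0 * (1 / 2 - alpha c (q - 1) - 1) = c 0 * (1 / 2 - alpha c q) -
        ∑ j, c j * (ZMod.stdAddChar (-(j * (q : ZMod (2 * m)))) : ℂ) := by
      rw [alpha_sub_one hc0]
      field_simp
      ring
    have e' := congrArg (C : ℂ → ℂ[X]) e
    simp only [C_mul, C_sub, C_1] at e'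
    simp only [lin, taylor_mul, map_add, taylor_C, taylor_X, map_neg, C_1, map_sub]
    linear_combination e'
  have h2 : yH c * xH c = xH c * yH c - cyc c c := by rw [← x_mul_y_sub, sub_sub_cancel]
  rw [h, h2, sub_mul, xy_mul_e hc0, cyc_mul_e, kp, kp, map_sub, aeval_C, sub_mul,
    Algebra.algebraMap_eq_smul_one, smul_mul_assoc, one_mul]

end Cyclic

end DicyclicTrace

namespace DicyclicTrace

/-! ### Normal forms spanning `H_c`. -/

section Normal

set_option maxSynthPendingDepth 4
set_option linter.unusedSectionVars false

variable {m : ℕ} [NeZero m] {c : ZMod (2 * m) → ℂ}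

/-! ### Normal forms -/

/-- The polynomial with `x ^ i y ^ i e_p = S(k) e_p`. -/
def polyXY (c : ZMod (2 * m) → ℂ) (i : ℕ) (p : ℤ) : ℂ[X] :=
  ∏ j ∈ Finset.range i, taylor (j : ℂ) (lin c (p + j))

/-- The polynomial with `y ^ i x ^ i e_p = S(k) e_p`. -/
def polyYX (c : ZMod (2 * m) → ℂ) (i : ℕ) (p : ℤ) : ℂ[X] :=
  ∏ j ∈ Finset.range i, taylor (-(j + 1) : ℂ) (lin c (p - (j + 1)))

theorem x_mul_ypow_succ (hc0 : c 0 ≠ 0) (i : ℕ) (R : ℂ[X]) (q : ℤ) :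
    xH c * (yH c ^ (i + 1) * kp c R * eH c q) =
      yH c ^ i * kp c (taylor (i : ℂ) (lin c (q + i)) * R) * eH c q := by
  -- Bringing the idempotent to the left turns `e_q` into `e_{q+i}`, the one on which `x y` is then
  -- evaluated.
  have h1 : yH c ^ i * kp c R * eH c q = eH c (q + i) * (yH c ^ i * kp c R) := by
    rw [← mul_assoc, e_mul_ypow, add_sub_cancel_right, mul_assoc, mul_assoc, e_mul_kp]
  calc xH c * (yH c ^ (i + 1) * kp c R * eH c q)
      = xH c * yH c * (yH c ^ i * kp c R * eH c q) := by rw [pow_succ']; simp only [mul_assoc]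
    _ = kp c (lin c (q + i)) * eH c (q + i) * (yH c ^ i * kp c R) := by
        rw [h1, ← mul_assoc, xy_mul_e hc0]
    _ = kp c (lin c (q + i)) * (yH c ^ i * kp c R * eH c q) := by rw [h1, mul_assoc]
    _ = yH c ^ i * kp c (taylor (i : ℂ) (lin c (q + i)) * R) * eH c q := by
        rw [kp_mul, ← mul_assoc (yH c ^ i) (kp c (taylor _ _)),
          ypow_mul_kp hc0 i (taylor _ _), taylor_taylor]
        simp [mul_assoc]

theorem y_mul_xpow_succ (hc0 : c 0 ≠ 0) (i : ℕ) (R : ℂ[X]) (q : ℤ) :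
    yH c * (xH c ^ (i + 1) * kp c R * eH c q) =
      xH c ^ i * kp c (taylor (-(i + 1) : ℂ) (lin c (q - (i + 1))) * R) * eH c q := by
  have h1 : xH c ^ i * kp c R * eH c q = eH c (q - i) * (xH c ^ i * kp c R) := by
    rw [← mul_assoc, e_mul_xpow, sub_add_cancel, mul_assoc, mul_assoc, e_mul_kp]
  calc yH c * (xH c ^ (i + 1) * kp c R * eH c q)
      = yH c * xH c * (xH c ^ i * kp c R * eH c q) := by rw [pow_succ']; simp only [mul_assoc]
    _ = kp c (taylor (-1) (lin c (q - (i + 1)))) * eH c (q - i) * (xH c ^ i * kp c R) := by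
        rw [h1, ← mul_assoc, yx_mul_e hc0, sub_sub]
    _ = kp c (taylor (-1) (lin c (q - (i + 1)))) * (xH c ^ i * kp c R * eH c q) := by
        rw [h1, mul_assoc]
    _ = _ := by
        rw [kp_mul, ← mul_assoc (xH c ^ i) (kp c (taylor _ _)),
          xpow_mul_kp hc0 i (taylor _ _), taylor_taylor]
        simp [mul_assoc]

theorem polyXY_spec (hc0 : c 0 ≠ 0) (i : ℕ) (p : ℤ) :
    xH c ^ i * yH c ^ i * eH c p = kp c (polyXY c i p) * eH c p := by
  induction i with
  | zero => simp [polyXY, kp_one]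
  | succ i ih =>
    have h := x_mul_ypow_succ hc0 i 1 p
    rw [kp_one, mul_one, mul_one] at h
    rw [pow_succ, mul_assoc, mul_assoc, h, ← mul_assoc, ← mul_assoc, mul_assoc, ← e_mul_kp,
      ← mul_assoc, ih, mul_assoc, e_mul_kp, ← mul_assoc, ← kp_mul, polyXY,
      polyXY, Finset.prod_range_succ]

theorem polyYX_spec (hc0 : c 0 ≠ 0) (i : ℕ) (p : ℤ) :
    yH c ^ i * xH c ^ i * eH c p = kp c (polyYX c i p) * eH c p := by
  induction i with
  | zero => simp [polyYX, kp_one]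
  | succ i ih =>
    have h := y_mul_xpow_succ hc0 i 1 p
    rw [kp_one, mul_one, mul_one] at h
    rw [pow_succ, mul_assoc, mul_assoc, h, ← mul_assoc, ← mul_assoc, mul_assoc, ← e_mul_kp,
      ← mul_assoc, ih, mul_assoc, e_mul_kp, ← mul_assoc, ← kp_mul, polyYX,
      polyYX, Finset.prod_range_succ]

theorem polyXY_succ (i : ℕ) (p : ℤ) :
    polyXY c (i + 1) p = polyXY c i p * taylor (i : ℂ) (lin c (p + i)) :=
  Finset.prod_range_succ _ _

theorem polyYX_succ (i : ℕ) (p : ℤ) :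
    polyYX c (i + 1) p = polyYX c i p * taylor (-(i + 1) : ℂ) (lin c (p - (i + 1))) :=
  Finset.prod_range_succ _ _

theorem lin_eval_neg (hc0 : c 0 ≠ 0) (hc : ∀ i, c (-i) = c i) (q : ℤ) (z : ℂ) :
    (lin c (-q)).eval z = -(lin c (q - 1)).eval (-1 - z) := by
  simp only [lin, eval_mul, eval_add, eval_C, eval_X, alpha_neg hc0 hc]
  ring

/-- Conjugation by `h` exchanges the two products up to the sign `(-1)^i` and sends `k` to `-k`,
which fixes the point `0`; the proof compares linear factors by `lin_eval_neg`. It makes the even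
rules for `x` and for `y` compatible under `h`. -/
theorem polyYX_neg_eval_zero (hc0 : c 0 ≠ 0) (hc : ∀ i, c (-i) = c i) (i : ℕ) (p : ℤ) :
    (polyYX c i (-p)).eval 0 = (-1) ^ i * (polyXY c i p).eval 0 := by
  induction i with
  | zero => simp [polyXY, polyYX]
  | succ i ih =>
    rw [polyXY_succ, polyYX_succ, eval_mul, eval_mul, ih, taylor_eval, taylor_eval, pow_succ,
      show -p - ((i : ℤ) + 1) = -(p + i + 1) by ring, lin_eval_neg hc0 hc]
    rw [show p + (i : ℤ) + 1 - 1 = p + i by ring,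
      show (-1 : ℂ) - (0 + -((i : ℂ) + 1)) = 0 + i by ring]
    ring

theorem h_mul_xpow (i : ℕ) : grp c (hGen m) * xH c ^ i = yH c ^ i * grp c (hGen m) := by
  induction i with
  | zero => simp
  | succ i ih => rw [pow_succ, ← mul_assoc, ih, mul_assoc, h_mul_x, ← mul_assoc, ← pow_succ]

theorem h_mul_ypow (i : ℕ) :
    grp c (hGen m) * yH c ^ i = (-1 : ℂ) ^ i • (xH c ^ i * grp c (hGen m)) := by
  induction i with
  | zero => simp
  | succ i ih =>
    rw [pow_succ, ← mul_assoc, ih, smul_mul_assoc, mul_assoc, h_mul_y, mul_neg, ← mul_assoc,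
      ← pow_succ, pow_succ (-1 : ℂ), mul_smul, neg_one_smul]

theorem a_mul_xpow (j : ZMod (2 * m)) (i : ℕ) :
    grp c (.a j) * xH c ^ i = (ZMod.stdAddChar (j * (i : ZMod (2 * m))) : ℂ) • (xH c ^ i * grp c (.a j)) := by
  induction i with
  | zero => simp
  | succ i ih =>
    rw [pow_succ, ← mul_assoc, ih, smul_mul_assoc, mul_assoc, a_mul_x, mul_smul_comm, smul_smul,
      ← AddChar.map_add_eq_mul, ← mul_assoc]
    push_cast
    rw [mul_add, mul_one]

theorem a_mul_ypow (j : ZMod (2 * m)) (i : ℕ) :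
    grp c (.a j) * yH c ^ i = (ZMod.stdAddChar (-(j * (i : ZMod (2 * m)))) : ℂ) • (yH c ^ i * grp c (.a j)) := by
  induction i with
  | zero => simp
  | succ i ih =>
    rw [pow_succ, ← mul_assoc, ih, smul_mul_assoc, mul_assoc, a_mul_y, mul_smul_comm, smul_smul,
      ← AddChar.map_add_eq_mul, ← mul_assoc]
    push_cast
    rw [mul_add, mul_one, neg_add]

theorem e_mul_a (i : ZMod (2 * m)) (q : ℤ) :
    eH c q * grp c (.a i) = (ZMod.stdAddChar (-(i * (q : ZMod (2 * m)))) : ℂ) • eH c q := by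
  rw [← a_mul_e, eH_eq, a_mul_cyc_comm]

theorem a_mul_xnf (j : ZMod (2 * m)) (i : ℕ) (R : ℂ[X]) (q : ℤ) :
    grp c (.a j) * (xH c ^ i * kp c R * eH c q) =
      (ZMod.stdAddChar (j * ((i : ZMod (2 * m)) - (q : ZMod (2 * m)))) : ℂ) • (xH c ^ i * kp c R * eH c q) := by
  rw [← mul_assoc, ← mul_assoc, a_mul_xpow, smul_mul_assoc, smul_mul_assoc, mul_assoc (xH c ^ i),
    a_mul_kp, mul_assoc, mul_assoc, a_mul_e, mul_smul_comm, mul_smul_comm, smul_smul,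
    ← AddChar.map_add_eq_mul, mul_sub, sub_eq_add_neg, mul_assoc]

theorem a_mul_ynf (j : ZMod (2 * m)) (i : ℕ) (R : ℂ[X]) (q : ℤ) :
    grp c (.a j) * (yH c ^ i * kp c R * eH c q) =
      (ZMod.stdAddChar (j * (-(i : ZMod (2 * m)) - (q : ZMod (2 * m)))) : ℂ) • (yH c ^ i * kp c R * eH c q) := by
  rw [← mul_assoc, ← mul_assoc, a_mul_ypow, smul_mul_assoc, smul_mul_assoc, mul_assoc (yH c ^ i),
    a_mul_kp, mul_assoc, mul_assoc, a_mul_e, mul_smul_comm, mul_smul_comm, smul_smul,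
    ← AddChar.map_add_eq_mul, mul_sub, sub_eq_add_neg, mul_assoc, mul_neg]

theorem h_mul_xnf (hc0 : c 0 ≠ 0) (hc : ∀ i, c (-i) = c i) (i : ℕ) (R : ℂ[X]) (q : ℤ) :
    grp c (hGen m) * (xH c ^ i * kp c R * eH c q) =
      yH c ^ i * kp c (R.comp (-X)) * eH c (-q) * grp c (hGen m) := by
  rw [← mul_assoc, ← mul_assoc, h_mul_xpow, mul_assoc (yH c ^ i), h_mul_kp hc0 hc, mul_assoc,
    mul_assoc, h_mul_e]
  simp only [mul_assoc]

theorem h_mul_ynf (hc0 : c 0 ≠ 0) (hc : ∀ i, c (-i) = c i) (i : ℕ) (R : ℂ[X]) (q : ℤ) :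
    grp c (hGen m) * (yH c ^ i * kp c R * eH c q) =
      (-1 : ℂ) ^ i • (xH c ^ i * kp c (R.comp (-X)) * eH c (-q) * grp c (hGen m)) := by
  rw [← mul_assoc, ← mul_assoc, h_mul_ypow, smul_mul_assoc, smul_mul_assoc, mul_assoc (xH c ^ i),
    h_mul_kp hc0 hc, mul_assoc, mul_assoc, h_mul_e]
  simp only [mul_assoc]

/-- The elements `x ^ i R(k) e_q` and `y ^ i R(k) e_q`. -/
def normalSet (c : ZMod (2 * m) → ℂ) : Set (H c) :=
  {b | ∃ (i : ℕ) (R : ℂ[X]) (q : ℤ),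
    b = xH c ^ i * kp c R * eH c q ∨ b = yH c ^ i * kp c R * eH c q}

theorem smul_mem_normalSet (t : ℂ) {b : H c} (hb : b ∈ normalSet c) : t • b ∈ normalSet c := by
  obtain ⟨i, R, q, rfl | rfl⟩ := hb
  · exact ⟨i, t • R, q, .inl (by rw [kp_smul, mul_smul_comm, smul_mul_assoc])⟩
  · exact ⟨i, t • R, q, .inr (by rw [kp_smul, mul_smul_comm, smul_mul_assoc])⟩

theorem x_mul_mem_normalSet (hc0 : c 0 ≠ 0) {b : H c} (hb : b ∈ normalSet c) :
    xH c * b ∈ normalSet c := by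
  obtain ⟨i, R, q, rfl | rfl⟩ := hb
  · exact ⟨i + 1, R, q, .inl (by rw [pow_succ']; simp only [mul_assoc])⟩
  · cases i with
    | zero => exact ⟨1, R, q, .inl (by simp [mul_assoc])⟩
    | succ i => exact ⟨i, _, q, .inr (x_mul_ypow_succ hc0 i R q)⟩

theorem y_mul_mem_normalSet (hc0 : c 0 ≠ 0) {b : H c} (hb : b ∈ normalSet c) :
    yH c * b ∈ normalSet c := by
  obtain ⟨i, R, q, rfl | rfl⟩ := hb
  · cases i with
    | zero => exact ⟨1, R, q, .inr (by simp [mul_assoc])⟩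
    | succ i => exact ⟨i, _, q, .inl (y_mul_xpow_succ hc0 i R q)⟩
  · exact ⟨i + 1, R, q, .inr (by rw [pow_succ']; simp only [mul_assoc])⟩

theorem a_mul_mem_normalSet (j : ZMod (2 * m)) {b : H c} (hb : b ∈ normalSet c) :
    grp c (.a j) * b ∈ normalSet c := by
  have hb' := hb
  obtain ⟨i, R, q, rfl | rfl⟩ := hb
  · rw [a_mul_xnf]; exact smul_mem_normalSet _ hb'
  · rw [a_mul_ynf]; exact smul_mem_normalSet _ hb'

theorem mul_a_mem_normalSet (j : ZMod (2 * m)) {b : H c} (hb : b ∈ normalSet c) :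
    b * grp c (.a j) ∈ normalSet c := by
  have hb' := hb
  obtain ⟨i, R, q, rfl | rfl⟩ := hb
  all_goals
    rw [mul_assoc, e_mul_a, mul_smul_comm]; exact smul_mem_normalSet _ hb'

theorem exists_h_mul_eq (hc0 : c 0 ≠ 0) (hc : ∀ i, c (-i) = c i) {b : H c}
    (hb : b ∈ normalSet c) :
    ∃ b' ∈ normalSet c, grp c (hGen m) * b = b' * grp c (hGen m) := by
  obtain ⟨i, R, q, rfl | rfl⟩ := hb
  · exact ⟨_, ⟨i, _, _, .inr rfl⟩, h_mul_xnf hc0 hc i R q⟩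
  · exact ⟨_, smul_mem_normalSet ((-1) ^ i) ⟨i, _, _, .inl rfl⟩,
      (h_mul_ynf hc0 hc i R q).trans (smul_mul_assoc _ _ _).symm⟩

theorem xa_eq (j : ZMod (2 * m)) : (QuaternionGroup.xa j : Dic m) = hGen m * .a j := by
  simp [hGen]

theorem h_mul_h : grp c (hGen m) * grp c (hGen m) = grp c (.a (m : ZMod (2 * m))) := by
  rw [← map_mul]
  simp [hGen]

/-- The normal forms, and the normal forms times `h`, span `H_c`. -/
theorem mem_of_normal (hc0 : c 0 ≠ 0) (hc : ∀ i, c (-i) = c i) (V : Submodule ℂ (H c))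
    (h1 : ∀ b ∈ normalSet c, b ∈ V) (h2 : ∀ b ∈ normalSet c, b * grp c (hGen m) ∈ V) (a : H c) :
    a ∈ V := by
  let S : Set (H c) := normalSet c ∪ {b | ∃ b' ∈ normalSet c, b = b' * grp c (hGen m)}
  -- The span is a left ideal, which is checked on generators of `H_c`. As it contains `1 = ∑ e_q`,
  -- it is everything.
  have key : ∀ a b : H c, b ∈ Submodule.span ℂ S → a * b ∈ Submodule.span ℂ S := by
    intro a
    have red : ∀ a : H c, (∀ b ∈ S, a * b ∈ S) →
        ∀ b ∈ Submodule.span ℂ S, a * b ∈ Submodule.span ℂ S := by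
      intro a ha b hb
      induction hb using Submodule.span_induction with
      | mem b hb => exact Submodule.subset_span (ha b hb)
      | zero => rw [mul_zero]; exact zero_mem _
      | add b b' _ _ h h' => rw [mul_add]; exact add_mem h h'
      | smul t b _ h => rw [mul_smul_comm]; exact Submodule.smul_mem _ t h
    have left : ∀ a : H c, (∀ b ∈ normalSet c, a * b ∈ normalSet c) → ∀ b ∈ S, a * b ∈ S := by
      rintro a ha b (hb | ⟨b', hb', rfl⟩)
      · exact .inl (ha b hb)
      · exact .inr ⟨a * b', ha b' hb', (mul_assoc _ _ _).symm⟩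
    have ga : ∀ j, ∀ b ∈ S, grp c (.a j) * b ∈ S := fun j =>
      left _ fun b hb => a_mul_mem_normalSet j hb
    have gh : ∀ b ∈ S, grp c (hGen m) * b ∈ S := by
      rintro b (hb | ⟨b', hb', rfl⟩)
      · exact .inr (exists_h_mul_eq hc0 hc hb)
      · obtain ⟨b'', hb'', e⟩ := exists_h_mul_eq hc0 hc hb'
        rw [← mul_assoc, e, mul_assoc, h_mul_h]
        exact .inl (mul_a_mem_normalSet _ hb'')
    induction a using H_induction with
    | hx => exact red _ (left _ fun b hb => x_mul_mem_normalSet hc0 hb)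
    | hy => exact red _ (left _ fun b hb => y_mul_mem_normalSet hc0 hb)
    | hg w =>
      rcases w with j | j
      · exact red _ (ga j)
      · refine red _ fun b hb => ?_
        rw [xa_eq, map_mul, mul_assoc]
        exact gh _ (ga j b hb)
    | hadd a b ha hb => intro d hd; rw [add_mul]; exact add_mem (ha d hd) (hb d hd)
    | hmul a b ha hb => intro d hd; rw [mul_assoc]; exact ha _ (hb d hd)
    | hsmul t a ha => intro d hd; rw [smul_mul_assoc]; exact Submodule.smul_mem _ t (ha d hd)
  have hone : (1 : H c) ∈ Submodule.span ℂ S := by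
    rw [← sum_e]
    exact sum_mem fun q _ => Submodule.subset_span (.inl ⟨0, 1, q.val, .inl (by simp [kp_one])⟩)
  have hle : Submodule.span ℂ S ≤ V := by
    rw [Submodule.span_le]
    rintro b (hb | ⟨b', hb', rfl⟩)
    exacts [h1 b hb, h2 b' hb']
  exact hle (by simpa using key a 1 hone)

end Normal

end DicyclicTrace

namespace DicyclicTrace

/-! ### Traces and the extension rules. -/

section TraceRules

set_option maxSynthPendingDepth 4
set_option linter.unusedSectionVars false

variable {m : ℕ} [NeZero m] {c : ZMod (2 * m) → ℂ} {T : H c →ₗ[ℂ] ℂ}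

theorem grp_mul_inv (w : Dic m) : grp c w * grp c w⁻¹ = 1 := by
  rw [← map_mul, mul_inv_cancel, map_one]

theorem grp_inv_mul (w : Dic m) : grp c w⁻¹ * grp c w = 1 := by
  rw [← map_mul, inv_mul_cancel, map_one]

theorem isTrace_inv (hT : IsTrace c T) (w : Dic m) (b : H c) :
    T (grp c w * b * grp c w⁻¹) = T b := by
  rw [hT, ← mul_assoc, grp_inv_mul, one_mul]

/-- The element is an eigenvector of the commutator with `k` of eigenvalue `i` up to sign, and a
trace kills commutators. -/
theorem isTrace_x_off (hc0 : c 0 ≠ 0) (hT : IsTrace c T) (i : ℕ) (R : ℂ[X]) (q : ℤ) (hi : i ≠ 0) :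
    T (xH c ^ i * kp c R * eH c q) = 0 := by
  have hX : kp c X = kH c := aeval_X _
  have h : xH c ^ i * kp c R * eH c q * kH c =
      kH c * (xH c ^ i * kp c R * eH c q) + (i : ℂ) • (xH c ^ i * kp c R * eH c q) := by
    rw [← hX, mul_assoc, e_mul_kp, ← mul_assoc, mul_assoc (xH c ^ i), kp_comm, ← mul_assoc,
      xpow_mul_kp hc0 i X, taylor_X, kp_add, add_mul, add_mul, add_mul]
    congr 1
    · simp only [mul_assoc]
    · rw [kp, aeval_C, Algebra.algebraMap_eq_smul_one]
      simp only [smul_mul_assoc, one_mul]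
  have h2 := hT (xH c ^ i * kp c R * eH c q) (kH c)
  rw [h, map_add, map_smul, add_eq_left, smul_eq_mul] at h2
  exact (mul_eq_zero.1 h2).resolve_left (Nat.cast_ne_zero.2 hi)

theorem isTrace_y_off (hc0 : c 0 ≠ 0) (hT : IsTrace c T) (i : ℕ) (R : ℂ[X]) (q : ℤ) (hi : i ≠ 0) :
    T (yH c ^ i * kp c R * eH c q) = 0 := by
  have hX : kp c X = kH c := aeval_X _
  have h : yH c ^ i * kp c R * eH c q * kH c =
      kH c * (yH c ^ i * kp c R * eH c q) + (-i : ℂ) • (yH c ^ i * kp c R * eH c q) := by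
    rw [← hX, mul_assoc, e_mul_kp, ← mul_assoc, mul_assoc (yH c ^ i), kp_comm, ← mul_assoc,
      ypow_mul_kp hc0 i X, taylor_X, kp_add, add_mul, add_mul, add_mul]
    congr 1
    · simp only [mul_assoc]
    · rw [kp, aeval_C, Algebra.algebraMap_eq_smul_one]
      simp only [smul_mul_assoc, one_mul]
  have h2 := hT (yH c ^ i * kp c R * eH c q) (kH c)
  rw [h, map_add, map_smul, add_eq_left, smul_eq_mul] at h2
  exact (mul_eq_zero.1 h2).resolve_left (neg_ne_zero.2 (Nat.cast_ne_zero.2 hi))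

theorem a_inv (j : ZMod (2 * m)) : (QuaternionGroup.a j : Dic m)⁻¹ = .a (-j) := by
  rw [inv_eq_iff_mul_eq_one]; simp

/-- The weight of `b h` under conjugation by `g ^ j`. -/
theorem inv_weight (hT : ∀ (w : Dic m) (b : H c), T (grp c w * b * grp c w⁻¹) = T b)
    (j : ZMod (2 * m)) (b : H c) (t : ZMod (2 * m)) (q : ℤ)
    (h1 : grp c (.a j) * b = (ZMod.stdAddChar (j * (t - (q : ZMod (2 * m)))) : ℂ) • b)
    (h2 : b * grp c (.a j) = (ZMod.stdAddChar (-(j * (q : ZMod (2 * m)))) : ℂ) • b)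
    (h3 : (ZMod.stdAddChar (j * (t - 2 * (q : ZMod (2 * m)))) : ℂ) ≠ 1) :
    T (b * grp c (hGen m)) = 0 := by
  have h := hT (.a j) (b * grp c (hGen m))
  have e : grp c (.a j) * (b * grp c (hGen m)) * grp c (QuaternionGroup.a j)⁻¹ =
      (ZMod.stdAddChar (j * (t - 2 * (q : ZMod (2 * m)))) : ℂ) • (b * grp c (hGen m)) := by
    rw [a_inv, mul_assoc, mul_assoc, h_mul_a, neg_neg, ← mul_assoc, ← mul_assoc, h1,
      smul_mul_assoc, h2, smul_smul, ← AddChar.map_add_eq_mul, smul_mul_assoc]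
    congr 3
    ring
  rw [e, map_smul, smul_eq_mul] at h
  by_contra hne
  exact h3 (mul_right_cancel₀ hne (by rw [h, one_mul]))

theorem xnf_mul_a (j : ZMod (2 * m)) (b : H c) (q : ℤ) :
    b * eH c q * grp c (.a j) =
      (ZMod.stdAddChar (-(j * (q : ZMod (2 * m)))) : ℂ) • (b * eH c q) := by
  rw [mul_assoc, e_mul_a, mul_smul_comm]

/-- Conjugation by `g^m = h^2` multiplies `x` and `y` by `-1` and fixes `k`, `e_q` and `h`. Hence
odd powers of `x` or `y` have weight `-1`: an odd multiple of `m` is `m` modulo `2 m`. -/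
theorem stdAddChar_half_mul_odd (t : ZMod (2 * m)) (i : ℕ) (hi : ¬ 2 ∣ i)
    (ht : t = i ∨ t = -i) (q : ℤ) :
    (ZMod.stdAddChar ((m : ZMod (2 * m)) * (t - 2 * (q : ZMod (2 * m)))) : ℂ) ≠ 1 := by
  have h2 : (2 : ZMod (2 * m)) * m = 0 := by
    have := ZMod.natCast_self (2 * m)
    push_cast at this
    exact this
  obtain ⟨l, rfl⟩ : ∃ l, i = 2 * l + 1 := ⟨i / 2, by omega⟩
  have e : (m : ZMod (2 * m)) * (t - 2 * (q : ZMod (2 * m))) = m := by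
    rcases ht with rfl | rfl <;> push_cast
    · linear_combination ((l : ZMod (2 * m)) - q) * h2
    · linear_combination (-(l : ZMod (2 * m)) - q - 1) * h2
  rw [e, stdAddChar_natCast_half]
  norm_num

theorem inv_x_odd (hT : ∀ (w : Dic m) (b : H c), T (grp c w * b * grp c w⁻¹) = T b)
    (i : ℕ) (R : ℂ[X]) (q : ℤ) (hi : ¬ 2 ∣ i) :
    T (xH c ^ i * kp c R * eH c q * grp c (hGen m)) = 0 :=
  inv_weight hT m _ i q (a_mul_xnf _ _ _ _) (xnf_mul_a _ _ _)
    (stdAddChar_half_mul_odd _ i hi (.inl rfl) q)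

theorem inv_y_odd (hT : ∀ (w : Dic m) (b : H c), T (grp c w * b * grp c w⁻¹) = T b)
    (i : ℕ) (R : ℂ[X]) (q : ℤ) (hi : ¬ 2 ∣ i) :
    T (yH c ^ i * kp c R * eH c q * grp c (hGen m)) = 0 :=
  inv_weight hT m _ (-i) q (a_mul_ynf _ _ _ _) (xnf_mul_a _ _ _)
    (stdAddChar_half_mul_odd _ i hi (.inr rfl) q)

/-- Conjugation by `g` multiplies `e_q h` by `ε^{-2q}`. -/
theorem inv_e_h (hT : ∀ (w : Dic m) (b : H c), T (grp c w * b * grp c w⁻¹) = T b)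
    (q : ℤ) (hq : 2 * (q : ZMod (2 * m)) ≠ 0) : T (eH c q * grp c (hGen m)) = 0 := by
  have h := inv_weight hT 1 (xH c ^ 0 * kp c 1 * eH c q) (0 : ℕ) q (a_mul_xnf _ _ _ _)
    (xnf_mul_a _ _ _)
  simp only [kp_one, pow_zero, one_mul, Nat.cast_zero, zero_sub] at h
  refine h (stdAddChar_ne_one ?_)
  exact neg_ne_zero.2 hq

/-- Cyclicity moves half of the power, `x^i`, to the end; passing it leftwards through `h` turns it
into `y^i`, which meets the remaining `x^i`. -/
theorem isTrace_even_x (hc0 : c 0 ≠ 0) (hT : IsTrace c T) (i : ℕ) (R S : ℂ[X]) (q : ℤ)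
    (hS : xH c ^ i * yH c ^ i * eH c (q - i) = kp c S * eH c (q - i)) :
    T (xH c ^ (2 * i) * kp c R * eH c q * grp c (hGen m)) =
      T (kp c S * kp c (taylor (i : ℂ) R) * eH c (q - i) * grp c (hGen m)) := by
  have e1 : xH c ^ (2 * i) * kp c R * eH c q * grp c (hGen m) =
      xH c ^ i * (xH c ^ i * kp c R * eH c q * grp c (hGen m)) := by
    rw [two_mul, pow_add]; simp only [mul_assoc]
  have e2 : xH c ^ i * kp c R * eH c q * grp c (hGen m) * xH c ^ i =
      kp c S * kp c (taylor (i : ℂ) R) * eH c (q - i) * grp c (hGen m) := by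
    calc _ = xH c ^ i * kp c R * (eH c q * yH c ^ i) * grp c (hGen m) := by
          rw [mul_assoc, h_mul_xpow]; simp only [mul_assoc]
      _ = kp c (taylor (i : ℂ) R) * (xH c ^ i * yH c ^ i * eH c (q - i)) * grp c (hGen m) := by
          rw [e_mul_ypow, xpow_mul_kp hc0]; simp only [mul_assoc]
      _ = _ := by rw [hS, ← mul_assoc, kp_comm]
  rw [e1, hT, e2]

theorem isTrace_even_y (hc0 : c 0 ≠ 0) (hT : IsTrace c T) (i : ℕ) (R S : ℂ[X]) (q : ℤ)
    (hS : yH c ^ i * xH c ^ i * eH c (q + i) = kp c S * eH c (q + i)) :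
    T (yH c ^ (2 * i) * kp c R * eH c q * grp c (hGen m)) =
      (-1) ^ i * T (kp c S * kp c (taylor (-i : ℂ) R) * eH c (q + i) * grp c (hGen m)) := by
  have e1 : yH c ^ (2 * i) * kp c R * eH c q * grp c (hGen m) =
      yH c ^ i * (yH c ^ i * kp c R * eH c q * grp c (hGen m)) := by
    rw [two_mul, pow_add]; simp only [mul_assoc]
  have e2 : yH c ^ i * kp c R * eH c q * grp c (hGen m) * yH c ^ i =
      (-1 : ℂ) ^ i • (kp c S * kp c (taylor (-i : ℂ) R) * eH c (q + i) * grp c (hGen m)) := by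
    calc _ = (-1 : ℂ) ^ i • (yH c ^ i * kp c R * (eH c q * xH c ^ i) * grp c (hGen m)) := by
          rw [mul_assoc, h_mul_ypow, mul_smul_comm]; simp only [mul_assoc]
      _ = (-1 : ℂ) ^ i •
          (kp c (taylor (-i : ℂ) R) * (yH c ^ i * xH c ^ i * eH c (q + i)) * grp c (hGen m)) := by
          rw [e_mul_xpow, ypow_mul_kp hc0]; simp only [mul_assoc]
      _ = _ := by rw [hS, ← mul_assoc, kp_comm]
  rw [e1, hT, e2, map_smul, smul_eq_mul]

/-- Moving one factor `k` cyclically around `h` changes the sign, so the value equals its own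
negative. -/
theorem isTrace_k_pow (hc0 : c 0 ≠ 0) (hc : ∀ i, c (-i) = c i) (hT : IsTrace c T) (i : ℕ) (q : ℤ)
    (hi : 0 < i) : T (kH c ^ i * eH c q * grp c (hGen m)) = 0 := by
  obtain ⟨i, rfl⟩ : ∃ j, i = j + 1 := ⟨i - 1, by omega⟩
  have hX : ∀ j, kp c (X ^ j) = kH c ^ j := fun j => by rw [kp, map_pow, aeval_X]
  have h1 : kH c ^ (i + 1) * eH c q * grp c (hGen m) =
      kH c * (kH c ^ i * eH c q * grp c (hGen m)) := by
    rw [pow_succ']; simp only [mul_assoc]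
  have h2 : kH c ^ i * eH c q * grp c (hGen m) * kH c =
      -(kH c ^ (i + 1) * eH c q * grp c (hGen m)) := by
    have h3 := e_mul_kp (c := c) q X
    rw [kp, aeval_X] at h3
    rw [mul_assoc, h_mul_k hc0 hc, neg_mul, mul_neg, mul_assoc, ← mul_assoc (eH c q), h3, pow_succ]
    simp only [mul_assoc]
  have h := congrArg T h2
  rw [← hT, ← h1, map_neg] at h
  exact self_eq_neg.1 h

theorem aeval_add_natCast (i : ℕ) (R : ℂ[X]) :
    aeval (kH c + (i : H c)) R = kp c (taylor (i : ℂ) R) := by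
  rw [← aeval_add_eq, map_natCast]

theorem aeval_sub_natCast (i : ℕ) (R : ℂ[X]) :
    aeval (kH c - (i : H c)) R = kp c (taylor (-i : ℂ) R) := by
  rw [← aeval_add_eq, map_neg, map_natCast, sub_eq_add_neg]

theorem IsTrace.isExtended (hc0 : c 0 ≠ 0) (hc : ∀ i, c (-i) = c i) (hT : IsTrace c T) :
    IsExtended c T where
  inv := isTrace_inv hT
  off_diagonal i R q hi := ⟨isTrace_x_off hc0 hT i R q hi, isTrace_y_off hc0 hT i R q hi⟩
  odd i R q hi := ⟨inv_x_odd (isTrace_inv hT) i R q hi, inv_y_odd (isTrace_inv hT) i R q hi⟩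
  even_x i R S q hS := by rw [aeval_add_natCast]; exact isTrace_even_x hc0 hT i R S q hS
  even_y i R S q hS := by rw [aeval_sub_natCast]; exact isTrace_even_y hc0 hT i R S q hS
  k_pow i q hi := isTrace_k_pow hc0 hc hT i q hi

/-- The extension rules with the polynomials in `k` evaluated. -/
structure Rules (T : H c →ₗ[ℂ] ℂ) : Prop where
  inv : ∀ (w : Dic m) (b : H c), T (grp c w * b * grp c w⁻¹) = T b
  off_x : ∀ (i : ℕ) (R : ℂ[X]) (q : ℤ), i ≠ 0 → T (xH c ^ i * kp c R * eH c q) = 0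
  off_y : ∀ (i : ℕ) (R : ℂ[X]) (q : ℤ), i ≠ 0 → T (yH c ^ i * kp c R * eH c q) = 0
  even_x : ∀ (i : ℕ) (R : ℂ[X]) (q : ℤ),
    T (xH c ^ (2 * i) * kp c R * eH c q * grp c (hGen m)) =
      (polyXY c i (q - i)).eval 0 * R.eval (i : ℂ) * T (eH c (q - i) * grp c (hGen m))
  even_y : ∀ (i : ℕ) (R : ℂ[X]) (q : ℤ),
    T (yH c ^ (2 * i) * kp c R * eH c q * grp c (hGen m)) =
      (-1) ^ i * ((polyYX c i (q + i)).eval 0 * R.eval (-i : ℂ) *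
        T (eH c (q + i) * grp c (hGen m)))

/-- Only the constant term in `k` survives in front of `e_q h`; the factor `S(k) R(k ± i)` of the
even rules thus becomes the number `S(0) R(± i)`. -/
theorem eval_zero_of_k_pow
    (h : ∀ (i : ℕ) (q : ℤ), 0 < i → T (kH c ^ i * eH c q * grp c (hGen m)) = 0)
    (R : ℂ[X]) (q : ℤ) :
    T (kp c R * eH c q * grp c (hGen m)) = R.eval 0 * T (eH c q * grp c (hGen m)) := by
  induction R using Polynomial.induction_on' with
  | add p q hp hq => rw [kp_add, add_mul, add_mul, map_add, hp, hq, eval_add, add_mul]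
  | monomial n t =>
    have e : kp c (monomial n t) = t • kH c ^ n := by
      rw [kp, aeval_monomial, Algebra.smul_def]
    rw [e, smul_mul_assoc, smul_mul_assoc, map_smul, smul_eq_mul]
    cases n with
    | zero => simp
    | succ n => rw [h _ _ n.succ_pos]; simp

theorem IsExtended.rules (hc0 : c 0 ≠ 0) (hT : IsExtended c T) : Rules T where
  inv := hT.inv
  off_x i R q hi := (hT.off_diagonal i R q hi).1
  off_y i R q hi := (hT.off_diagonal i R q hi).2
  even_x i R q := by
    have h := hT.even_x i R (polyXY c i (q - i)) q (polyXY_spec hc0 _ _)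
    rw [aeval_add_natCast] at h
    refine h.trans ?_
    change T (kp c _ * _ * _ * _) = _
    rw [← kp_mul, eval_zero_of_k_pow hT.k_pow, eval_mul, taylor_eval, zero_add]
  even_y i R q := by
    have h := hT.even_y i R (polyYX c i (q + i)) q (polyYX_spec hc0 _ _)
    rw [aeval_sub_natCast] at h
    refine h.trans ?_
    change _ * T (kp c _ * _ * _ * _) = _
    rw [← kp_mul, eval_zero_of_k_pow hT.k_pow, eval_mul, taylor_eval, zero_add]

/-- Under the hypothesis `q + 2 i` and `-q` agree modulo `n`, so the reflection `lin_eval_neg`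
applies. -/
theorem lin_eval_add_eq_zero (hc0 : c 0 ≠ 0) (hc : ∀ i, c (-i) = c i) (q : ℤ) (i : ℕ)
    (h : 2 * ((q + i : ℤ) : ZMod (2 * m)) = 0) :
    (lin c (q + 2 * i)).eval (i : ℂ) = -(lin c (q - 1)).eval (-(i + 1) : ℂ) := by
  have e : lin c (q + 2 * i) = lin c (-q) := by
    rw [lin, lin, alpha_congr]
    push_cast at h ⊢
    linear_combination h
  rw [e, lin_eval_neg hc0 hc]
  congr 2
  ring

theorem h_mul_x' (b : H c) : b * grp c (hGen m) * xH c = b * yH c * grp c (hGen m) := by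
  rw [mul_assoc, h_mul_x, mul_assoc]

theorem nf_mul_y (hc0 : c 0 ≠ 0) (b : H c) (R : ℂ[X]) (q : ℤ) :
    b * kp c R * eH c q * yH c = b * yH c * kp c (taylor 1 R) * eH c (q - 1) := by
  rw [mul_assoc, e_mul_y, ← mul_assoc, mul_assoc b, kp_mul_y hc0]
  simp only [mul_assoc]

theorem nf_mul_x (hc0 : c 0 ≠ 0) (b : H c) (R : ℂ[X]) (q : ℤ) :
    b * kp c R * eH c q * xH c = b * xH c * kp c (taylor (-1) R) * eH c (q + 1) := by
  rw [mul_assoc, e_mul_x, ← mul_assoc, mul_assoc b, kp_mul_x hc0]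
  simp only [mul_assoc]

theorem ypow_succ_mul_x (hc0 : c 0 ≠ 0) (i : ℕ) (R : ℂ[X]) (q : ℤ) :
    yH c ^ (i + 1) * kp c R * eH c q * xH c =
      yH c ^ i * kp c (taylor (-1) (lin c q) * taylor (-1) R) * eH c (q + 1) := by
  rw [nf_mul_x hc0, pow_succ, mul_assoc, ← e_mul_kp, ← mul_assoc, mul_assoc (yH c ^ i),
    mul_assoc (yH c ^ i), yx_mul_e hc0, add_sub_cancel_right, kp_mul, mul_assoc (yH c ^ i),
    mul_assoc (yH c ^ i), mul_assoc, mul_assoc, e_mul_kp]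

theorem xpow_succ_mul_y (hc0 : c 0 ≠ 0) (i : ℕ) (R : ℂ[X]) (q : ℤ) :
    xH c ^ (i + 1) * kp c R * eH c q * yH c =
      xH c ^ i * kp c (lin c (q - 1) * taylor 1 R) * eH c (q - 1) := by
  rw [nf_mul_y hc0, pow_succ, mul_assoc, ← e_mul_kp, ← mul_assoc, mul_assoc (xH c ^ i),
    mul_assoc (xH c ^ i), xy_mul_e hc0, kp_mul, mul_assoc (xH c ^ i),
    mul_assoc (xH c ^ i), mul_assoc, mul_assoc, e_mul_kp]

/-- By the off-diagonal rules both sides vanish unless `b = y R(k) e_q`; in that case the claim is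
the shift identity `hs`. -/
theorem Rules.x_comm_normal (hc0 : c 0 ≠ 0) (hT : Rules T)
    (hs : ∀ (q : ℤ) (R : ℂ[X]), T (kp c (lin c q * R) * eH c q) =
      T (kp c (taylor (-1) (lin c q * R)) * eH c (q + 1))) (b : H c) (hb : b ∈ normalSet c) :
    T (xH c * b) = T (b * xH c) := by
  obtain ⟨i, R, q, rfl | rfl⟩ := hb
  · rw [nf_mul_x hc0, ← pow_succ, ← mul_assoc, ← mul_assoc, ← pow_succ',
      hT.off_x _ _ _ i.succ_ne_zero, hT.off_x _ _ _ i.succ_ne_zero]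
  · rcases i with _ | _ | i
    · rw [nf_mul_x hc0, ← mul_assoc, ← mul_assoc, pow_zero, mul_one, one_mul, ← pow_one (xH c),
        hT.off_x _ _ _ one_ne_zero, hT.off_x _ _ _ one_ne_zero]
    · rw [x_mul_ypow_succ hc0, ypow_succ_mul_x hc0, pow_zero, one_mul, one_mul]
      simpa using hs q R
    · rw [x_mul_ypow_succ hc0, ypow_succ_mul_x hc0, hT.off_y _ _ _ i.succ_ne_zero,
        hT.off_y _ _ _ i.succ_ne_zero]

/-- For even `i` both sides have odd total power and vanish. For odd `i` the even rules evaluate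
both sides, and the linear factors have to be compared. -/
theorem Rules.x_comm_normal_h (hc0 : c 0 ≠ 0) (hc : ∀ i, c (-i) = c i) (hT : Rules T)
    (b : H c) (hb : b ∈ normalSet c) :
    T (xH c * (b * grp c (hGen m))) = T (b * grp c (hGen m) * xH c) := by
  rw [h_mul_x', ← mul_assoc]
  obtain ⟨i, R, q, rfl | rfl⟩ := hb
  · rw [← mul_assoc, ← mul_assoc, ← pow_succ']
    obtain ⟨j, rfl | rfl⟩ : ∃ j, i = 2 * j ∨ i = 2 * j + 1 := ⟨i / 2, by omega⟩
    · rw [inv_x_odd hT.inv _ _ _ (by omega)]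
      cases j with
      | zero =>
        rw [nf_mul_y hc0, mul_zero, pow_zero, one_mul, ← pow_one (yH c),
          inv_y_odd hT.inv _ _ _ (by omega)]
      | succ j =>
        rw [show 2 * (j + 1) = 2 * j + 1 + 1 by ring, xpow_succ_mul_y hc0,
          inv_x_odd hT.inv _ _ _ (by omega)]
    · rw [show 2 * j + 1 + 1 = 2 * (j + 1) by ring, hT.even_x, xpow_succ_mul_y hc0, hT.even_x,
        polyXY_succ, eval_mul, eval_mul, taylor_eval, taylor_eval]
      push_cast
      rw [show q - ((j : ℤ) + 1) + j = q - 1 by ring, show q - 1 - (j : ℤ) = q - (j + 1) by ring,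
        zero_add]
      ring
  · rw [nf_mul_y hc0, ← pow_succ]
    obtain ⟨j, rfl | rfl⟩ : ∃ j, i = 2 * j ∨ i = 2 * j + 1 := ⟨i / 2, by omega⟩
    · rw [inv_y_odd hT.inv _ _ _ (by omega)]
      cases j with
      | zero =>
        rw [← mul_assoc, ← mul_assoc, mul_zero, pow_zero, mul_one, ← pow_one (xH c),
          inv_x_odd hT.inv _ _ _ (by omega)]
      | succ j =>
        rw [show 2 * (j + 1) = 2 * j + 1 + 1 by ring, x_mul_ypow_succ hc0,
          inv_y_odd hT.inv _ _ _ (by omega)]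
    · rw [show 2 * j + 1 + 1 = 2 * (j + 1) by ring, hT.even_y, x_mul_ypow_succ hc0, hT.even_y,
        polyYX_succ, eval_mul, eval_mul, taylor_eval, taylor_eval, taylor_eval]
      push_cast
      rw [show q - 1 + ((j : ℤ) + 1) = q + j by ring,
        show q + (j : ℤ) - (j + 1) = q - 1 by ring]
      -- The two sides carry factors `L_{q+2j}(j)` and `-L_{q-1}(-j-1)`, which need not agree in
      -- general; when the congruence fails, the common factor `T(e_{q+j} h)` is zero.
      by_cases h : 2 * ((q + j : ℤ) : ZMod (2 * m)) = 0
      · rw [show -(j : ℂ) + 2 * j = j by ring, lin_eval_add_eq_zero hc0 hc q j h,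
          show -((j : ℂ) + 1) + 1 = -j by ring, zero_add]
        ring
      · rw [inv_e_h hT.inv _ h]
        ring

/-- A functional that obeys the extension rules and the shift identity on the elements `R(k) e_q`
is a trace. -/
theorem Rules.isTrace (hc0 : c 0 ≠ 0) (hc : ∀ i, c (-i) = c i) (hT : Rules T)
    (hs : ∀ (q : ℤ) (R : ℂ[X]), T (kp c (lin c q * R) * eH c q) =
      T (kp c (taylor (-1) (lin c q * R)) * eH c (q + 1))) : IsTrace c T := by
  have hx : ∀ b, T (xH c * b) = T (b * xH c) := by
    let V : Submodule ℂ (H c) :=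
      LinearMap.eqLocus (T ∘ₗ LinearMap.mulLeft ℂ (xH c)) (T ∘ₗ LinearMap.mulRight ℂ (xH c))
    exact mem_of_normal hc0 hc V (hT.x_comm_normal hc0 hs) (hT.x_comm_normal_h hc0 hc)
  have hw : ∀ w b, T (grp c w * b) = T (b * grp c w) := by
    intro w b
    rw [← hT.inv w (b * grp c w), ← mul_assoc, mul_assoc, grp_mul_inv, mul_one]
  -- The elements that may be moved cyclically inside `T` are closed under products, so generators
  -- suffice.
  have hmul : ∀ a a', (∀ b, T (a * b) = T (b * a)) → (∀ b, T (a' * b) = T (b * a')) →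
      ∀ b, T (a * a' * b) = T (b * (a * a')) := by
    intro a a' ha ha' b
    rw [mul_assoc, ha, mul_assoc, ha', mul_assoc]
  intro a
  induction a using H_induction with
  | hx => exact hx
  | hy =>
    -- `y` is conjugate to `x` under `h`, so no separate check for `y` is needed.
    have e : yH c = grp c (hGen m) * xH c * grp c (hGen m)⁻¹ := by
      rw [h_mul_x, mul_assoc, grp_mul_inv, mul_one]
    rw [e]
    exact hmul _ _ (hmul _ _ (hw _) hx) (hw _)
  | hg w => exact hw w
  | hadd a a' ha ha' => intro b; rw [add_mul, mul_add, map_add, map_add, ha, ha']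
  | hmul a a' ha ha' => exact hmul a a' ha ha'
  | hsmul t a ha => intro b; rw [smul_mul_assoc, mul_smul_comm, map_smul, map_smul, ha]

/-- Cyclicity for `x` and `y R(k) e_q`. -/
theorem IsTrace.shift (hc0 : c 0 ≠ 0) (hT : IsTrace c T) (q : ℤ) (R : ℂ[X]) :
    T (kp c (lin c q * R) * eH c q) = T (kp c (taylor (-1) (lin c q * R)) * eH c (q + 1)) := by
  have h := hT (xH c) (yH c ^ (0 + 1) * kp c R * eH c q)
  rw [x_mul_ypow_succ hc0, ypow_succ_mul_x hc0] at h
  simpa using h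

/-- Two functionals obeying the rules agree if they agree on `R(k) e_q` and on `e_q h`. -/
theorem Rules.ext (hc0 : c 0 ≠ 0) (hc : ∀ i, c (-i) = c i) {T' : H c →ₗ[ℂ] ℂ} (hT : Rules T)
    (hT' : Rules T') (h1 : ∀ (R : ℂ[X]) (q : ℤ), T (kp c R * eH c q) = T' (kp c R * eH c q))
    (h2 : ∀ q : ℤ, T (eH c q * grp c (hGen m)) = T' (eH c q * grp c (hGen m))) : T = T' := by
  refine LinearMap.ext (mem_of_normal hc0 hc (LinearMap.eqLocus T T') ?_ ?_)
  · rintro b ⟨i, R, q, rfl | rfl⟩ <;> change T _ = T' _ <;> rcases eq_or_ne i 0 with rfl | hi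
    · simpa using h1 R q
    · rw [hT.off_x _ _ _ hi, hT'.off_x _ _ _ hi]
    · simpa using h1 R q
    · rw [hT.off_y _ _ _ hi, hT'.off_y _ _ _ hi]
  · rintro b ⟨i, R, q, rfl | rfl⟩ <;> change T _ = T' _ <;>
      obtain ⟨j, rfl | rfl⟩ : ∃ j, i = 2 * j ∨ i = 2 * j + 1 := ⟨i / 2, by omega⟩
    · rw [hT.even_x, hT'.even_x, h2]
    · rw [inv_x_odd hT.inv _ _ _ (by omega), inv_x_odd hT'.inv _ _ _ (by omega)]
    · rw [hT.even_y, hT'.even_y, h2]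
    · rw [inv_y_odd hT.inv _ _ _ (by omega), inv_y_odd hT'.inv _ _ _ (by omega)]

end TraceRules

end DicyclicTrace

namespace DicyclicTrace

/-! ### A concrete module for `H_c`, which shows that values on normal forms can be prescribed. -/

section Model

set_option maxSynthPendingDepth 4
set_option linter.unusedSectionVars false

variable {m : ℕ} [NeZero m] {c : ZMod (2 * m) → ℂ}

/-! ### A model of the subalgebra generated by `x`, `y` and `g` -/

/-- The free module on the symbols `v_i R(k) e_q`, where `v_i = x ^ i` for `i ≥ 0` and
`v_i = y ^ (-i)` for `i ≤ 0`. -/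
abbrev Model (m : ℕ) : Type := (ℤ × ZMod (2 * m)) →₀ ℂ[X]

/-- The operator that sends `R` at `p` to `d p * R` at `p + s`. -/
def shiftOp (s : ℤ) (d : ℤ × ZMod (2 * m) → ℂ[X]) : Module.End ℂ (Model m) :=
  Finsupp.lsum ℂ fun p => Finsupp.lsingle (p.1 + s, p.2) ∘ₗ LinearMap.mulLeft ℂ (d p)

theorem shiftOp_single (s : ℤ) (d : ℤ × ZMod (2 * m) → ℂ[X]) (p : ℤ × ZMod (2 * m)) (R : ℂ[X]) :
    shiftOp s d (Finsupp.single p R) = Finsupp.single (p.1 + s, p.2) (d p * R) := by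
  simp [shiftOp]

theorem end_ext {A B : Module.End ℂ (Model m)}
    (h : ∀ p R, A (Finsupp.single p R) = B (Finsupp.single p R)) : A = B :=
  Finsupp.lhom_ext h

/-- All operators of the model move the index by a fixed amount and multiply by a polynomial, so the
relations of `H_c` reduce to identities between coefficient functions. -/
theorem shiftOp_mul (s s' : ℤ) (d d' : ℤ × ZMod (2 * m) → ℂ[X]) :
    shiftOp s d * shiftOp s' d' = shiftOp (s' + s) fun p => d (p.1 + s', p.2) * d' p := by
  refine end_ext fun p R => ?_
  rw [Module.End.mul_apply, shiftOp_single, shiftOp_single, shiftOp_single, mul_assoc, add_assoc]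

theorem shiftOp_sub (s : ℤ) (d d' : ℤ × ZMod (2 * m) → ℂ[X]) :
    shiftOp s d - shiftOp s d' = shiftOp s fun p => d p - d' p := by
  refine end_ext fun p R => ?_
  rw [LinearMap.sub_apply, shiftOp_single, shiftOp_single, shiftOp_single, sub_mul,
    Finsupp.single_sub]

theorem shiftOp_add (s : ℤ) (d d' : ℤ × ZMod (2 * m) → ℂ[X]) :
    shiftOp s d + shiftOp s d' = shiftOp s fun p => d p + d' p := by
  refine end_ext fun p R => ?_
  rw [LinearMap.add_apply, shiftOp_single, shiftOp_single, shiftOp_single, add_mul,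
    Finsupp.single_add]

theorem shiftOp_smul (t : ℂ) (s : ℤ) (d : ℤ × ZMod (2 * m) → ℂ[X]) :
    t • shiftOp s d = shiftOp s fun p => t • d p := by
  refine end_ext fun p R => ?_
  rw [LinearMap.smul_apply, shiftOp_single, shiftOp_single, smul_mul_assoc, Finsupp.smul_single]

theorem shiftOp_one : shiftOp (m := m) 0 (fun _ => 1) = 1 := by
  refine end_ext fun p R => ?_
  rw [shiftOp_single, add_zero, one_mul, Module.End.one_apply]

theorem shiftOp_sum {ι : Type*} (t : Finset ι) (s : ℤ) (d : ι → ℤ × ZMod (2 * m) → ℂ[X]) :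
    ∑ i ∈ t, shiftOp s (d i) = shiftOp s fun p => ∑ i ∈ t, d i p := by
  refine end_ext fun p R => ?_
  rw [LinearMap.sum_apply]
  simp only [shiftOp_single]
  rw [Finset.sum_mul, Finsupp.single_finsetSum]

/-- The number `α_q` for `q` modulo `n`. -/
def alphaZ (c : ZMod (2 * m) → ℂ) (q : ZMod (2 * m)) : ℂ :=
  1 / c 0 * ∑ j, phi c j * (ZMod.stdAddChar (-(j * q)) : ℂ)

/-- The polynomial `L_{q - i}(k - i)` by which `x y` acts on `v_i e_q`. -/
def modelLin (c : ZMod (2 * m) → ℂ) (p : ℤ × ZMod (2 * m)) : ℂ[X] :=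
  C (c 0) * (X + C (1 / 2 - p.1 - alphaZ c (p.2 - p.1)))

/-- The action of `x` on the model. -/
def modelX (c : ZMod (2 * m) → ℂ) : Module.End ℂ (Model m) :=
  shiftOp 1 fun p => if 0 ≤ p.1 then 1 else modelLin c (p.1 + 1, p.2)

/-- The action of `y` on the model. -/
def modelY (c : ZMod (2 * m) → ℂ) : Module.End ℂ (Model m) :=
  shiftOp (-1) fun p => if p.1 ≤ 0 then 1 else modelLin c p

/-- The action of `g ^ j` on the model. -/
def modelG (j : ZMod (2 * m)) : Module.End ℂ (Model m) :=
  shiftOp 0 fun p => C (ZMod.stdAddChar (j * ((p.1 : ZMod (2 * m)) - p.2)) : ℂ)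

/-- For either sign of the index exactly one of the two operators lowers a power, and that one
contributes the linear polynomial. -/
theorem modelX_mul_modelY : modelX c * modelY c = shiftOp 0 (modelLin c) := by
  rw [modelX, modelY, shiftOp_mul]
  congr 1
  funext p
  by_cases h : p.1 ≤ 0
  · rw [if_pos h, if_neg (by simp; omega), mul_one]
    simp
  · rw [if_neg h, if_pos (by simp; omega), one_mul]

theorem modelY_mul_modelX :
    modelY c * modelX c = shiftOp 0 fun p => modelLin c (p.1 + 1, p.2) := by
  rw [modelX, modelY, shiftOp_mul]
  congr 1
  funext p
  by_cases h : 0 ≤ p.1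
  · rw [if_pos h, if_neg (by simp; omega), mul_one]
  · rw [if_neg h, if_pos (by simp; omega), one_mul]

theorem modelG_mul (i j : ZMod (2 * m)) : modelG i * modelG j = modelG (i + j) := by
  rw [modelG, modelG, modelG, shiftOp_mul]
  congr 1
  funext p
  rw [← C_mul, add_zero, ← AddChar.map_add_eq_mul, add_mul]

theorem modelG_zero : modelG (m := m) 0 = 1 := by
  rw [modelG, ← shiftOp_one]
  simp

theorem modelG_mul_modelX (j : ZMod (2 * m)) :
    modelG j * modelX c = (ZMod.stdAddChar j : ℂ) • (modelX c * modelG j) := by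
  rw [modelG, modelX, shiftOp_mul, shiftOp_mul, shiftOp_smul]
  congr 1
  funext p
  rw [add_zero, smul_eq_C_mul, mul_left_comm, ← C_mul, ← AddChar.map_add_eq_mul, mul_comm]
  push_cast
  congr 4
  ring

theorem modelG_mul_modelY (j : ZMod (2 * m)) :
    modelG j * modelY c = (ZMod.stdAddChar (-j) : ℂ) • (modelY c * modelG j) := by
  rw [modelG, modelY, shiftOp_mul, shiftOp_mul, shiftOp_smul]
  congr 1
  funext p
  rw [add_zero, smul_eq_C_mul, mul_left_comm, ← C_mul, ← AddChar.map_add_eq_mul, mul_comm]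
  push_cast
  congr 4
  ring

theorem alphaZ_sub_one (hc0 : c 0 ≠ 0) (q : ZMod (2 * m)) :
    alphaZ c (q - 1) = alphaZ c q + 1 / c 0 * ∑ j, c j * (ZMod.stdAddChar (-(j * q)) : ℂ) - 1 := by
  have h := alpha_sub_one hc0 (q.val : ℤ)
  rw [alpha_eq, alpha_eq] at h
  push_cast at h
  simpa only [alphaZ, ZMod.natCast_zmod_val] using h

/-- The difference of consecutive linear coefficients is constant, and by `alphaZ_sub_one` it is the
eigenvalue of `c`. -/
theorem modelXY_comm (hc0 : c 0 ≠ 0) :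
    modelX c * modelY c - modelY c * modelX c = ∑ j, c j • modelG j := by
  simp only [modelX_mul_modelY, modelY_mul_modelX, shiftOp_sub, modelG, shiftOp_smul, shiftOp_sum]
  congr 1
  funext p
  simp only [modelLin, smul_eq_C_mul, ← C_mul]
  rw [← map_sum]
  have e := alphaZ_sub_one hc0 (p.2 - p.1)
  have e2 : ∀ j : ZMod (2 * m), -(j * (p.2 - (p.1 : ZMod (2 * m)))) = j * ((p.1 : ZMod (2 * m)) - p.2) :=
    fun j => by ring
  simp only [e2] at e
  push_cast
  rw [← sub_sub p.2, e, ← mul_sub, add_sub_add_left_eq_sub, ← C_sub, ← C_mul]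
  congr 1
  field_simp
  ring

/-! ### The representation of `H_c` by matrices over the model -/

/-- The images of `x` and `y`. -/
def repXY (c : ZMod (2 * m) → ℂ) : FreeXY →ₐ[ℂ] Matrix (Fin 2) (Fin 2) (Module.End ℂ (Model m)) :=
  FreeAlgebra.lift ℂ ![!![modelX c, 0; 0, modelY c], !![modelY c, 0; 0, -modelX c]]

/-- The images of the group elements. -/
def repG : Dic m →* Matrix (Fin 2) (Fin 2) (Module.End ℂ (Model m)) where
  toFun
    | .a j => !![modelG j, 0; 0, modelG (-j)]
    | .xa j => !![0, modelG (-j); modelG ((m : ZMod (2 * m)) + j), 0]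
  map_one' := by
    change !![modelG 0, 0; 0, modelG (-0)] = 1
    rw [neg_zero, modelG_zero, Matrix.one_fin_two]
  map_mul' v w := by
    have hm : (m : ZMod (2 * m)) + m = 0 := by
      have := ZMod.natCast_self (2 * m)
      push_cast at this
      rw [← two_mul]; exact this
    rcases v with i | i <;> rcases w with j | j
    · change !![modelG (i + j), 0; 0, modelG (-(i + j))] = _
      rw [Matrix.mul_fin_two]
      simp [modelG_mul, add_comm]
    · change !![0, modelG (-(j - i)); modelG ((m : ZMod (2 * m)) + (j - i)), 0] = _
      rw [Matrix.mul_fin_two]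
      simp only [modelG_mul, mul_zero, zero_mul, add_zero, zero_add]
      congr 5 <;> ring
    · change !![0, modelG (-(i + j)); modelG ((m : ZMod (2 * m)) + (i + j)), 0] = _
      rw [Matrix.mul_fin_two]
      simp only [modelG_mul, mul_zero, zero_mul, add_zero, zero_add]
      congr 5 <;> ring
    · change !![modelG ((m : ZMod (2 * m)) + j - i), 0; 0, modelG (-((m : ZMod (2 * m)) + j - i))] = _
      rw [Matrix.mul_fin_two]
      simp only [modelG_mul, mul_zero, zero_mul, add_zero, zero_add]
      rw [show -i + ((m : ZMod (2 * m)) + j) = m + j - i by ring,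
        show (m : ZMod (2 * m)) + i + -j = -(m + j - i) by linear_combination hm]

theorem repXY_X : repXY c freeX = !![modelX c, 0; 0, modelY c] := by
  simp [repXY, freeX]

theorem repXY_Y : repXY c freeY = !![modelY c, 0; 0, -modelX c] := by
  simp [repXY, freeY]

theorem smul_fin_two {A : Type*} [AddCommGroup A] [Module ℂ A] (t : ℂ) (a b d e : A) :
    t • !![a, b; d, e] = !![t • a, t • b; t • d, t • e] := by
  simp

theorem neg_fin_two {A : Type*} [AddCommGroup A] (a b d e : A) :
    -!![a, b; d, e] = !![-a, -b; -d, -e] := by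
  simp

/-- The covariance needed to extend to the skew group algebra. The second diagonal block is the
first one twisted by conjugation with `h` (`x ↦ y`, `y ↦ -x`, `g ↦ g⁻¹`), and `h` exchanges the
blocks; the summand `m` in `repG` encodes `h^2 = g^m`. -/
theorem repXY_smul (P : FreeXY) (w : Dic m) :
    repXY c (w • P) * repG w = repG w * repXY c P := by
  change repXY c (actHom w P) * repG w = repG w * repXY c P
  induction P using FreeAlgebra.induction with
  | grade0 r => rw [AlgHom.commutes, AlgHom.commutes, Algebra.commutes]
  | grade1 i =>
    have hneg : ∀ j : ZMod (2 * m), (ZMod.stdAddChar ((m : ZMod (2 * m)) + j) : ℂ) =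
        -ZMod.stdAddChar j := fun j => by
      rw [AddChar.map_add_eq_mul, stdAddChar_natCast_half, neg_one_mul]
    have hneg' : ∀ j : ZMod (2 * m), (ZMod.stdAddChar (-j + -(m : ZMod (2 * m))) : ℂ) =
        -ZMod.stdAddChar (-j) := fun j => by
      rw [← neg_add, add_comm, AddChar.map_neg_eq_inv, hneg, AddChar.map_neg_eq_inv, inv_neg]
    have e : actHom w (FreeAlgebra.ι ℂ i) = genImage w i := by simp [actHom]
    rw [e]
    rcases w with j | j <;> fin_cases i
    · change repXY c (_ • freeX) * !![modelG j, 0; 0, modelG (-j)] =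
        !![modelG j, 0; 0, modelG (-j)] * repXY c freeX
      rw [map_smul, repXY_X, smul_fin_two, Matrix.mul_fin_two, Matrix.mul_fin_two]
      simp [modelG_mul_modelX, modelG_mul_modelY]
    · change repXY c (_ • freeY) * !![modelG j, 0; 0, modelG (-j)] =
        !![modelG j, 0; 0, modelG (-j)] * repXY c freeY
      rw [map_smul, repXY_Y, smul_fin_two, Matrix.mul_fin_two, Matrix.mul_fin_two]
      simp [modelG_mul_modelX, modelG_mul_modelY]
    · change repXY c (_ • freeY) * !![0, modelG (-j); modelG ((m : ZMod (2 * m)) + j), 0] =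
        !![0, modelG (-j); modelG ((m : ZMod (2 * m)) + j), 0] * repXY c freeX
      rw [map_smul, repXY_X, repXY_Y, smul_fin_two, Matrix.mul_fin_two, Matrix.mul_fin_two]
      simp [modelG_mul_modelX, modelG_mul_modelY, hneg]
    · change repXY c (-(_ • freeX)) * !![0, modelG (-j); modelG ((m : ZMod (2 * m)) + j), 0] =
        !![0, modelG (-j); modelG ((m : ZMod (2 * m)) + j), 0] * repXY c freeY
      rw [map_neg, map_smul, repXY_X, repXY_Y, smul_fin_two, neg_fin_two, Matrix.mul_fin_two,
        Matrix.mul_fin_two]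
      simp [modelG_mul_modelX, modelG_mul_modelY, hneg']
  | mul a b ha hb => rw [map_mul, map_mul, map_mul, mul_assoc, hb, ← mul_assoc, ha, mul_assoc]
  | add a b ha hb => rw [map_add, map_add, map_add, add_mul, mul_add, ha, hb]

/-- The representation of the skew group algebra. -/
def repSkew (c : ZMod (2 * m) → ℂ) :
    Skew m →ₐ[ℂ] Matrix (Fin 2) (Fin 2) (Module.End ℂ (Model m)) :=
  SkewMonoidAlgebra.liftNCAlgHom (repXY c) repG fun {P w} => repXY_smul P w

theorem repSkew_single (w : Dic m) (P : FreeXY) :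
    repSkew c (SkewMonoidAlgebra.single w P) = repXY c P * repG w :=
  SkewMonoidAlgebra.liftNC_single _ _ _ _

/-- The first block is `modelXY_comm`. In the twisted block the left side is the same commutator and
the right side is `∑ c_j g^{-j}`, so the evenness of `c` is required. -/
theorem repSkew_rel (hc0 : c 0 ≠ 0) (hc : ∀ i, c (-i) = c i) ⦃a b : Skew m⦄ (h : Rel c a b) :
    repSkew c a = repSkew c b := by
  cases h
  rw [repSkew_single, map_one, mul_one, map_sub, map_mul, map_mul, repXY_X, repXY_Y, cElt, map_sum,
    Matrix.mul_fin_two, Matrix.mul_fin_two]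
  have e : ∀ j, repSkew c (c j • SkewMonoidAlgebra.of FreeXY (Dic m) (.a j)) =
      c j • !![modelG j, 0; 0, modelG (-j)] := by
    intro j
    rw [map_smul, SkewMonoidAlgebra.of_apply, repSkew_single, map_one, one_mul]
    rfl
  have h2 : ∑ j, c j • modelG (m := m) (-j) = ∑ j, c j • modelG j := by
    rw [← Equiv.sum_comp (Equiv.neg _)]
    simp [hc]
  rw [Finset.sum_congr rfl fun j _ => e j]
  ext1 i j
  rw [Matrix.sum_apply]
  fin_cases i <;> fin_cases j
  · simpa using modelXY_comm hc0
  · simp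
  · simp
  · simp only [← modelXY_comm hc0] at h2
    simpa [sub_eq_add_neg, add_comm] using h2.symm

/-- The representation of `H_c`. -/
def rep (hc0 : c 0 ≠ 0) (hc : ∀ i, c (-i) = c i) :
    H c →ₐ[ℂ] Matrix (Fin 2) (Fin 2) (Module.End ℂ (Model m)) :=
  RingQuot.liftAlgHom ℂ ⟨repSkew c, repSkew_rel hc0 hc⟩

theorem rep_toH (hc0 : c 0 ≠ 0) (hc : ∀ i, c (-i) = c i) (a : Skew m) :
    rep hc0 hc (toH c a) = repSkew c a :=
  RingQuot.liftAlgHom_mkAlgHom_apply ℂ _ _ _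

theorem rep_x (hc0 : c 0 ≠ 0) (hc : ∀ i, c (-i) = c i) :
    rep hc0 hc (xH c) = !![modelX c, 0; 0, modelY c] := by
  rw [xH, rep_toH, repSkew_single, map_one, mul_one, repXY_X]

theorem rep_y (hc0 : c 0 ≠ 0) (hc : ∀ i, c (-i) = c i) :
    rep hc0 hc (yH c) = !![modelY c, 0; 0, -modelX c] := by
  rw [yH, rep_toH, repSkew_single, map_one, mul_one, repXY_Y]

theorem rep_grp (hc0 : c 0 ≠ 0) (hc : ∀ i, c (-i) = c i) (w : Dic m) :
    rep hc0 hc (grp c w) = repG w := by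
  change rep hc0 hc (toH c (SkewMonoidAlgebra.of FreeXY (Dic m) w)) = _
  rw [rep_toH, SkewMonoidAlgebra.of_apply, repSkew_single, map_one, one_mul]

end Model

end DicyclicTrace

namespace DicyclicTrace

/-! ### Construction of the functional with prescribed data. -/

section Existence

set_option maxSynthPendingDepth 4
set_option linter.unusedSectionVars false

variable {m : ℕ} [NeZero m] {c : ZMod (2 * m) → ℂ} {hc0 : c 0 ≠ 0} {hc : ∀ i, c (-i) = c i}

/-- `a` acts with first row `(A, 0)`. -/
def RepRow (hc0 : c 0 ≠ 0) (hc : ∀ i, c (-i) = c i) (a : H c) (A : Module.End ℂ (Model m)) : Prop :=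
  rep hc0 hc a 0 0 = A ∧ rep hc0 hc a 0 1 = 0

theorem RepRow.mul {a b : H c} {A B : Module.End ℂ (Model m)} (ha : RepRow hc0 hc a A)
    (hb : RepRow hc0 hc b B) : RepRow hc0 hc (a * b) (A * B) := by
  constructor <;> rw [map_mul, Matrix.mul_apply, Fin.sum_univ_two, ha.1, ha.2]
  · rw [hb.1, zero_mul, add_zero]
  · rw [hb.2, mul_zero, zero_mul, add_zero]

theorem RepRow.add {a b : H c} {A B : Module.End ℂ (Model m)} (ha : RepRow hc0 hc a A)
    (hb : RepRow hc0 hc b B) : RepRow hc0 hc (a + b) (A + B) := by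
  constructor <;> rw [map_add, Matrix.add_apply]
  · rw [ha.1, hb.1]
  · rw [ha.2, hb.2, add_zero]

theorem RepRow.sub {a b : H c} {A B : Module.End ℂ (Model m)} (ha : RepRow hc0 hc a A)
    (hb : RepRow hc0 hc b B) : RepRow hc0 hc (a - b) (A - B) := by
  constructor <;> rw [map_sub, Matrix.sub_apply]
  · rw [ha.1, hb.1]
  · rw [ha.2, hb.2, sub_zero]

theorem RepRow.smul {a : H c} {A : Module.End ℂ (Model m)} (t : ℂ) (ha : RepRow hc0 hc a A) :
    RepRow hc0 hc (t • a) (t • A) := by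
  constructor <;> rw [map_smul, Matrix.smul_apply]
  · rw [ha.1]
  · rw [ha.2, smul_zero]

theorem RepRow.one : RepRow hc0 hc (1 : H c) 1 := by
  constructor <;> rw [map_one] <;> simp

theorem RepRow.pow {a : H c} {A : Module.End ℂ (Model m)} (ha : RepRow hc0 hc a A) (i : ℕ) :
    RepRow hc0 hc (a ^ i) (A ^ i) := by
  induction i with
  | zero => rw [pow_zero, pow_zero]; exact RepRow.one
  | succ i ih => rw [pow_succ, pow_succ]; exact ih.mul ha

theorem RepRow.sum {ι : Type*} (t : Finset ι) {a : ι → H c} {A : ι → Module.End ℂ (Model m)}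
    (h : ∀ i, RepRow hc0 hc (a i) (A i)) : RepRow hc0 hc (∑ i ∈ t, a i) (∑ i ∈ t, A i) := by
  constructor <;> rw [map_sum, Matrix.sum_apply]
  · exact Finset.sum_congr rfl fun i _ => (h i).1
  · exact Finset.sum_eq_zero fun i _ => (h i).2

theorem repRow_x : RepRow hc0 hc (xH c) (modelX c) := by
  constructor <;> rw [rep_x] <;> simp

theorem repRow_y : RepRow hc0 hc (yH c) (modelY c) := by
  constructor <;> rw [rep_y] <;> simp

theorem repRow_a (j : ZMod (2 * m)) : RepRow hc0 hc (grp c (.a j)) (modelG j) := by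
  constructor <;> rw [rep_grp] <;> rfl

theorem repRow_cyc (f : ZMod (2 * m) → ℂ) :
    RepRow hc0 hc (cyc c f)
      (shiftOp 0 fun p => C (∑ j, f j * (ZMod.stdAddChar (j * ((p.1 : ZMod (2 * m)) - p.2)) : ℂ))) := by
  have h : RepRow hc0 hc (cyc c f) (∑ j, f j • modelG j) :=
    RepRow.sum _ fun j => (repRow_a j).smul (f j)
  simp only [modelG, shiftOp_smul, shiftOp_sum, smul_eq_C_mul, ← C_mul, ← map_sum] at h
  exact h

/-- On `v_i` the element `k` acts as `X - i`, reflecting `k x^i = x^i (k - i)`: the `α` terms of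
`modelLin` and of the group part cancel. -/
theorem repRow_k : RepRow hc0 hc (kH c) (shiftOp 0 fun p => X - C (p.1 : ℂ)) := by
  have h := ((((repRow_x (hc0 := hc0) (hc := hc)).mul repRow_y).add (repRow_cyc (phi c))).smul
    (1 / c 0)).sub (RepRow.one.smul (1 / 2))
  rw [modelX_mul_modelY, ← shiftOp_one, shiftOp_add, shiftOp_smul, shiftOp_smul, shiftOp_sub] at h
  rw [kH_eq, Algebra.algebraMap_eq_smul_one]
  convert h using 2
  funext p
  have e : ∑ j, phi c j * (ZMod.stdAddChar (j * ((p.1 : ZMod (2 * m)) - p.2)) : ℂ) =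
      c 0 * alphaZ c (p.2 - p.1) := by
    rw [alphaZ, ← mul_assoc, mul_one_div_cancel hc0, one_mul]
    refine Finset.sum_congr rfl fun j _ => ?_
    rw [← mul_neg, neg_sub]
  rw [e, modelLin, C_mul, ← mul_add, smul_eq_C_mul, ← mul_assoc, ← C_mul,
    one_div_mul_cancel hc0, C_1, one_mul, smul_eq_C_mul, mul_one, C_sub, C_sub]
  ring

theorem repRow_kp (R : ℂ[X]) :
    RepRow hc0 hc (kp c R) (shiftOp 0 fun p => R.comp (X - C (p.1 : ℂ))) := by
  induction R using Polynomial.induction_on' with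
  | add R S hR hS =>
    rw [kp_add]
    simpa only [shiftOp_add, ← add_comp] using hR.add hS
  | monomial n t =>
    have e : kp c (monomial n t) = t • kH c ^ n := by
      rw [kp, aeval_monomial, Algebra.smul_def]
    rw [e]
    convert ((repRow_k (hc0 := hc0) (hc := hc)).pow n).smul t using 1
    have h : ∀ n : ℕ, (shiftOp (m := m) 0 fun p => X - C (p.1 : ℂ)) ^ n =
        shiftOp 0 fun p => (X - C (p.1 : ℂ)) ^ n := by
      intro n
      induction n with
      | zero => simp only [pow_zero, shiftOp_one]
      | succ n ih => rw [pow_succ, ih, shiftOp_mul]; simp only [add_zero, ← pow_succ]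
    rw [h, shiftOp_smul]
    simp only [monomial_comp, smul_eq_C_mul]

theorem repRow_e (q : ℤ) :
    RepRow hc0 hc (eH c q) (shiftOp 0 fun p => C (if p.2 - p.1 = q then 1 else 0)) := by
  rw [eH_eq]
  convert repRow_cyc (hc0 := hc0) (hc := hc) _ using 2
  funext p
  congr 1
  simp only [mul_assoc, ← AddChar.map_add_eq_mul, ← Finset.mul_sum, ← mul_add]
  rw [sum_stdAddChar_mul]
  have hm : ((2 * m : ℕ) : ℂ) ≠ 0 := Nat.cast_ne_zero.mpr (NeZero.ne _)
  by_cases h : p.2 - (p.1 : ZMod (2 * m)) = q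
  · rw [if_pos h, if_pos (by rw [← h]; ring), one_div_mul_cancel hm]
  · rw [if_neg h, if_neg (fun h' => h (by linear_combination -h')), mul_zero]

/-- The unit `∑ e_q` of the model. -/
def modelOne : Model m := ∑ q : ZMod (2 * m), Finsupp.single (0, q) 1

/-- Applying an element to `modelOne` reads off its normal form; this is the case without powers of
`x` or `y`. -/
theorem nf_apply (R : ℂ[X]) (q : ℤ) :
    (shiftOp 0 (fun p => R.comp (X - C (p.1 : ℂ))) *
      shiftOp 0 fun p => C (if p.2 - p.1 = q then 1 else 0) : Module.End ℂ (Model m)) modelOne =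
      Finsupp.single (0, (q : ZMod (2 * m))) R := by
  rw [shiftOp_mul, modelOne, map_sum]
  simp only [shiftOp_single, add_zero, Int.cast_zero, sub_zero, C_0, comp_X, mul_one]
  rw [Finset.sum_eq_single (q : ZMod (2 * m))]
  · simp
  · intro b _ hb
    rw [if_neg hb, C_0, mul_zero, Finsupp.single_zero]
  · intro h; exact absurd (Finset.mem_univ _) h

theorem modelX_pow_single (i : ℕ) (q : ZMod (2 * m)) (R : ℂ[X]) :
    (modelX c ^ i) (Finsupp.single (0, q) R) = Finsupp.single ((i : ℤ), q) R := by
  induction i with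
  | zero => simp
  | succ i ih =>
    rw [pow_succ', Module.End.mul_apply, ih, modelX, shiftOp_single, if_pos (by simp), one_mul]
    push_cast
    rfl

theorem modelY_pow_single (i : ℕ) (q : ZMod (2 * m)) (R : ℂ[X]) :
    (modelY c ^ i) (Finsupp.single (0, q) R) = Finsupp.single (-(i : ℤ), q) R := by
  induction i with
  | zero => simp
  | succ i ih =>
    rw [pow_succ', Module.End.mul_apply, ih, modelY, shiftOp_single, if_pos (by simp), one_mul]
    push_cast
    rw [neg_add]

variable (J : ZMod (2 * m) → ℂ[X] →ₗ[ℂ] ℂ) (E : ZMod (2 * m) → ℂ)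

/-- The functional on the model for the part of `H_c` without `h`. -/
def tauDiag : Model m →ₗ[ℂ] ℂ :=
  Finsupp.lsum ℂ fun p => if p.1 = 0 then J p.2 else 0

/-- The coefficients by which the part of the trace with `h` is evaluated. -/
def hWeight (c : ZMod (2 * m) → ℂ) (i : ℤ) (q : ZMod (2 * m)) : ℂ :=
  if ¬ 2 ∣ i then 0
  else if 0 ≤ i then (polyXY c (i / 2).toNat (q.val - i / 2)).eval 0 * E (q - (i / 2 : ℤ))
  else (-1) ^ (-i / 2).toNat *
    ((polyYX c (-i / 2).toNat (q.val + -i / 2)).eval 0 * E (q + (-i / 2 : ℤ)))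

/-- The functional on the model for the part of `H_c` with `h`. -/
def tauH (c : ZMod (2 * m) → ℂ) : Model m →ₗ[ℂ] ℂ :=
  -- The rules evaluate `R` at `i` for `x^{2i}` and at `-i` for `y^{2i}`, that is, at half the
  -- index.
  Finsupp.lsum ℂ fun p => hWeight E c p.1 p.2 • Polynomial.leval ((p.1 : ℂ) / 2)

/-- The functional on `H_c` given by the functionals on the two parts. -/
def buildTrace (hc0 : c 0 ≠ 0) (hc : ∀ i, c (-i) = c i) : H c →ₗ[ℂ] ℂ :=
  tauDiag J ∘ₗ LinearMap.applyₗ modelOne ∘ₗ Matrix.entryLinearMap ℂ _ 0 0 ∘ₗ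
      (rep hc0 hc).toLinearMap +
    tauH E c ∘ₗ LinearMap.applyₗ modelOne ∘ₗ Matrix.entryLinearMap ℂ _ 0 1 ∘ₗ
      (rep hc0 hc).toLinearMap

theorem buildTrace_apply (a : H c) :
    buildTrace J E hc0 hc a =
      tauDiag J (rep hc0 hc a 0 0 modelOne) + tauH E c (rep hc0 hc a 0 1 modelOne) := rfl

variable {J E}

theorem buildTrace_of_row {a : H c} {A : Module.End ℂ (Model m)} (h : RepRow hc0 hc a A) :
    buildTrace J E hc0 hc a = tauDiag J (A modelOne) := by
  rw [buildTrace_apply, h.1, h.2]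
  simp

/-- Right multiplication by `h` moves the entry `(0, 0)` to `(0, 1)`, so the two summands of
`buildTrace` see the parts without and with `h` separately. -/
theorem buildTrace_of_row_h {a : H c} {A : Module.End ℂ (Model m)} (h : RepRow hc0 hc a A) :
    buildTrace J E hc0 hc (a * grp c (hGen m)) = tauH E c (A modelOne) := by
  have e : rep hc0 hc (grp c (hGen m)) =
      !![0, modelG (-0); modelG ((m : ZMod (2 * m)) + 0), 0] := by
    rw [rep_grp]; rfl
  rw [buildTrace_apply, map_mul, e, neg_zero, modelG_zero, Matrix.mul_apply, Matrix.mul_apply,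
    Fin.sum_univ_two, Fin.sum_univ_two, h.1, h.2]
  simp

theorem repRow_nf (R : ℂ[X]) (q : ℤ) {v : H c} {A : Module.End ℂ (Model m)}
    (h : RepRow hc0 hc v A) :
    ∃ B, RepRow hc0 hc (v * kp c R * eH c q) B ∧
      B modelOne = A (Finsupp.single (0, (q : ZMod (2 * m))) R) := by
  refine ⟨_, (h.mul (repRow_kp R)).mul (repRow_e q), ?_⟩
  rw [mul_assoc, Module.End.mul_apply, nf_apply]

theorem buildTrace_x (i : ℕ) (R : ℂ[X]) (q : ℤ) :
    buildTrace J E hc0 hc (xH c ^ i * kp c R * eH c q) = if i = 0 then J q R else 0 := by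
  obtain ⟨B, hB, e⟩ := repRow_nf R q ((repRow_x (hc0 := hc0) (hc := hc)).pow i)
  rw [buildTrace_of_row hB, e, modelX_pow_single, tauDiag, Finsupp.lsum_single]
  simp only [Nat.cast_eq_zero]
  split_ifs <;> simp

theorem buildTrace_y (i : ℕ) (R : ℂ[X]) (q : ℤ) :
    buildTrace J E hc0 hc (yH c ^ i * kp c R * eH c q) = if i = 0 then J q R else 0 := by
  obtain ⟨B, hB, e⟩ := repRow_nf R q ((repRow_y (hc0 := hc0) (hc := hc)).pow i)
  rw [buildTrace_of_row hB, e, modelY_pow_single, tauDiag, Finsupp.lsum_single]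
  simp only [neg_eq_zero, Nat.cast_eq_zero]
  split_ifs <;> simp

theorem buildTrace_x_h (i : ℕ) (R : ℂ[X]) (q : ℤ) :
    buildTrace J E hc0 hc (xH c ^ i * kp c R * eH c q * grp c (hGen m)) =
      hWeight E c i q * R.eval ((i : ℂ) / 2) := by
  obtain ⟨B, hB, e⟩ := repRow_nf R q ((repRow_x (hc0 := hc0) (hc := hc)).pow i)
  rw [buildTrace_of_row_h hB, e, modelX_pow_single, tauH, Finsupp.lsum_single]
  simp

theorem buildTrace_y_h (i : ℕ) (R : ℂ[X]) (q : ℤ) :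
    buildTrace J E hc0 hc (yH c ^ i * kp c R * eH c q * grp c (hGen m)) =
      hWeight E c (-i) q * R.eval (-(i : ℂ) / 2) := by
  obtain ⟨B, hB, e⟩ := repRow_nf R q ((repRow_y (hc0 := hc0) (hc := hc)).pow i)
  rw [buildTrace_of_row_h hB, e, modelY_pow_single, tauH, Finsupp.lsum_single]
  simp

theorem lin_congr {p q : ℤ} (h : (p : ZMod (2 * m)) = q) : lin c p = lin c q := by
  rw [lin, lin, alpha_congr h]

theorem polyXY_congr (i : ℕ) {p q : ℤ} (h : (p : ZMod (2 * m)) = q) :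
    polyXY c i p = polyXY c i q :=
  Finset.prod_congr rfl fun j _ => by rw [lin_congr]; push_cast; rw [h]

theorem polyYX_congr (i : ℕ) {p q : ℤ} (h : (p : ZMod (2 * m)) = q) :
    polyYX c i p = polyYX c i q :=
  Finset.prod_congr rfl fun j _ => by rw [lin_congr]; push_cast; rw [h]

theorem hWeight_even_x (i : ℕ) (q : ℤ) :
    hWeight E c ((2 * i : ℕ) : ℤ) q = (polyXY c i (q - i)).eval 0 * E (q - i) := by
  have e : ((2 * i : ℕ) : ℤ) / 2 = i := by omega
  rw [hWeight, if_neg (by push Not; exact ⟨i, by push_cast; rfl⟩), if_pos (by positivity), e,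
    Int.toNat_natCast, polyXY_congr i (q := q - i) (by simp)]
  push_cast
  rfl

theorem hWeight_even_y (i : ℕ) (q : ℤ) :
    hWeight E c (-((2 * i : ℕ) : ℤ)) q =
      (-1) ^ i * ((polyYX c i (q + i)).eval 0 * E (q + i)) := by
  rcases Nat.eq_zero_or_pos i with rfl | hi
  · simp [hWeight, polyXY, polyYX]
  have e : -(-((2 * i : ℕ) : ℤ)) / 2 = i := by omega
  rw [hWeight, if_neg (by push Not; exact ⟨-i, by push_cast; ring⟩), if_neg (by omega), e,
    Int.toNat_natCast, polyYX_congr i (q := q + i) (by simp)]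
  push_cast
  rfl

theorem hWeight_odd (i : ℤ) (q : ZMod (2 * m)) (h : ¬ 2 ∣ i) : hWeight E c i q = 0 :=
  if_pos h

theorem buildTrace_even_x (i : ℕ) (R : ℂ[X]) (q : ℤ) :
    buildTrace J E hc0 hc (xH c ^ (2 * i) * kp c R * eH c q * grp c (hGen m)) =
      (polyXY c i (q - i)).eval 0 * R.eval (i : ℂ) * E (q - i) := by
  rw [buildTrace_x_h, hWeight_even_x]
  push_cast
  rw [mul_div_cancel_left₀ _ (two_ne_zero)]
  ring

theorem buildTrace_even_y (i : ℕ) (R : ℂ[X]) (q : ℤ) :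
    buildTrace J E hc0 hc (yH c ^ (2 * i) * kp c R * eH c q * grp c (hGen m)) =
      (-1) ^ i * ((polyYX c i (q + i)).eval 0 * R.eval (-i : ℂ) * E (q + i)) := by
  rw [buildTrace_y_h, hWeight_even_y]
  push_cast
  rw [neg_div, mul_div_cancel_left₀ _ (two_ne_zero)]
  ring

theorem buildTrace_e_h (q : ℤ) :
    buildTrace J E hc0 hc (eH c q * grp c (hGen m)) = E q := by
  have h := buildTrace_even_x (J := J) (E := E) (hc0 := hc0) (hc := hc) 0 1 q
  simpa [kp_one, polyXY] using h

theorem buildTrace_odd_x (i : ℕ) (R : ℂ[X]) (q : ℤ) (hi : ¬ 2 ∣ i) :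
    buildTrace J E hc0 hc (xH c ^ i * kp c R * eH c q * grp c (hGen m)) = 0 := by
  rw [buildTrace_x_h, hWeight_odd _ _ (by omega), zero_mul]

theorem buildTrace_odd_y (i : ℕ) (R : ℂ[X]) (q : ℤ) (hi : ¬ 2 ∣ i) :
    buildTrace J E hc0 hc (yH c ^ i * kp c R * eH c q * grp c (hGen m)) = 0 := by
  rw [buildTrace_y_h, hWeight_odd _ _ (by omega), zero_mul]

theorem buildTrace_inv_of_normal (w : Dic m)
    (h1 : ∀ b ∈ normalSet c, buildTrace J E hc0 hc (grp c w * b * grp c w⁻¹) =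
      buildTrace J E hc0 hc b)
    (h2 : ∀ b ∈ normalSet c, buildTrace J E hc0 hc (grp c w * (b * grp c (hGen m)) * grp c w⁻¹) =
      buildTrace J E hc0 hc (b * grp c (hGen m))) (b : H c) :
    buildTrace J E hc0 hc (grp c w * b * grp c w⁻¹) = buildTrace J E hc0 hc b :=
  mem_of_normal hc0 hc (LinearMap.eqLocus (buildTrace J E hc0 hc ∘ₗ
    LinearMap.mulRight ℂ (grp c w⁻¹) ∘ₗ LinearMap.mulLeft ℂ (grp c w)) (buildTrace J E hc0 hc))
    h1 h2 b

theorem conj_a_normal (j t : ZMod (2 * m)) (b : H c) (q : ℤ)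
    (h : grp c (.a j) * (b * eH c q) =
      (ZMod.stdAddChar (j * (t - (q : ZMod (2 * m)))) : ℂ) • (b * eH c q)) :
    grp c (.a j) * (b * eH c q) * grp c (QuaternionGroup.a j)⁻¹ =
      (ZMod.stdAddChar (j * t) : ℂ) • (b * eH c q) := by
  rw [h, a_inv, smul_mul_assoc, xnf_mul_a, smul_smul, ← AddChar.map_add_eq_mul]
  congr 2
  ring

theorem conj_a_normal_h (j t : ZMod (2 * m)) (b : H c) (q : ℤ)
    (h : grp c (.a j) * (b * eH c q) =
      (ZMod.stdAddChar (j * (t - (q : ZMod (2 * m)))) : ℂ) • (b * eH c q)) :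
    grp c (.a j) * (b * eH c q * grp c (hGen m)) * grp c (QuaternionGroup.a j)⁻¹ =
      (ZMod.stdAddChar (j * (t - 2 * (q : ZMod (2 * m)))) : ℂ) •
        (b * eH c q * grp c (hGen m)) := by
  rw [a_inv, mul_assoc, mul_assoc _ (grp c (hGen m)), h_mul_a, neg_neg, ← mul_assoc, ← mul_assoc,
    h, smul_mul_assoc, xnf_mul_a, smul_smul, ← AddChar.map_add_eq_mul, smul_mul_assoc]
  congr 3
  ring

/-- The weight of an even normal form times `h` under `g^j` can differ from `1` only where `E`
vanishes. -/
theorem stdAddChar_eq_one_or (hE2 : ∀ q : ZMod (2 * m), 2 * q ≠ 0 → E q = 0)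
    (j t : ZMod (2 * m)) (q : ZMod (2 * m)) (i : ZMod (2 * m)) (ht : t = 2 * i) :
    (ZMod.stdAddChar (j * (t - 2 * q)) : ℂ) * E (q - i) = E (q - i) := by
  by_cases h : 2 * (q - i) = 0
  · rw [ht, ← mul_sub, show 2 * (i - q) = -(2 * (q - i)) by ring, h, neg_zero, mul_zero,
      AddChar.map_zero_eq_one, one_mul]
  · rw [hE2 _ h, mul_zero]

theorem buildTrace_inv_a (hE2 : ∀ q : ZMod (2 * m), 2 * q ≠ 0 → E q = 0) (j : ZMod (2 * m))
    (b : H c) : buildTrace J E hc0 hc (grp c (.a j) * b * grp c (QuaternionGroup.a j)⁻¹) =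
      buildTrace J E hc0 hc b := by
  refine buildTrace_inv_of_normal (.a j) ?_ ?_ b
  · rintro b ⟨i, R, q, rfl | rfl⟩
    · rw [conj_a_normal _ _ _ _ (a_mul_xnf _ _ _ _), map_smul, buildTrace_x]
      split_ifs with h
      · simp [h]
      · simp
    · rw [conj_a_normal _ _ _ _ (a_mul_ynf _ _ _ _), map_smul, buildTrace_y]
      split_ifs with h
      · simp [h]
      · simp
  · rintro b ⟨i, R, q, rfl | rfl⟩ <;>
      obtain ⟨l, rfl | rfl⟩ : ∃ l, i = 2 * l ∨ i = 2 * l + 1 := ⟨i / 2, by omega⟩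
    · rw [conj_a_normal_h _ _ _ _ (a_mul_xnf _ _ _ _), map_smul, buildTrace_even_x, smul_eq_mul,
        mul_left_comm, stdAddChar_eq_one_or hE2 _ _ _ _ (by push_cast; rfl)]
    · rw [conj_a_normal_h _ _ _ _ (a_mul_xnf _ _ _ _), map_smul,
        buildTrace_odd_x _ _ _ (by omega), smul_zero]
    · rw [conj_a_normal_h _ _ _ _ (a_mul_ynf _ _ _ _), map_smul, buildTrace_even_y, smul_eq_mul,
        mul_left_comm, mul_left_comm (ZMod.stdAddChar _ : ℂ), ← sub_neg_eq_add _ (l : ZMod (2 * m)),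
        stdAddChar_eq_one_or hE2 _ _ _ _ (by push_cast; ring)]
    · rw [conj_a_normal_h _ _ _ _ (a_mul_ynf _ _ _ _), map_smul,
        buildTrace_odd_y _ _ _ (by omega), smul_zero]

/-- Conjugation by `h` exchanges `x` and `y` forms. Without `h`, `hJ` settles the claim; with `h`,
the sign of the `y` rule, or of `h y^i`, cancels the sign in `polyYX_neg_eval_zero`. -/
theorem buildTrace_inv_h (hE : ∀ q, E (-q) = E q) (hJ : ∀ q R, J (-q) (R.comp (-X)) = J q R)
    (b : H c) : buildTrace J E hc0 hc (grp c (hGen m) * b * grp c (hGen m)⁻¹) =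
      buildTrace J E hc0 hc b := by
  refine buildTrace_inv_of_normal (hGen m) ?_ ?_ b
  · rintro b ⟨i, R, q, rfl | rfl⟩
    · rw [h_mul_xnf hc0 hc, mul_assoc, grp_mul_inv, mul_one, buildTrace_x, buildTrace_y]
      push_cast
      rw [hJ]
    · rw [h_mul_ynf hc0 hc, smul_mul_assoc, mul_assoc, grp_mul_inv, mul_one, map_smul,
        buildTrace_x, buildTrace_y]
      push_cast
      rw [hJ]
      split_ifs with h
      · simp [h]
      · simp
  · intro b hb
    rw [mul_assoc, mul_assoc, grp_mul_inv, mul_one]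
    obtain ⟨i, R, q, rfl | rfl⟩ := hb <;>
      obtain ⟨l, rfl | rfl⟩ : ∃ l, i = 2 * l ∨ i = 2 * l + 1 := ⟨i / 2, by omega⟩
    · rw [h_mul_xnf hc0 hc, buildTrace_even_x, buildTrace_even_y,
        show -q + (l : ℤ) = -(q - l) by ring, polyYX_neg_eval_zero hc0 hc, ← hE]
      push_cast
      rw [eval_comp, eval_neg, eval_X, neg_neg,
        show -(-(q : ZMod (2 * m)) + l) = q - l by ring, ← mul_assoc, ← mul_assoc, ← mul_assoc,
        ← mul_pow]
      simp
    · rw [h_mul_xnf hc0 hc, buildTrace_odd_x _ _ _ (by omega), buildTrace_odd_y _ _ _ (by omega)]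
    · rw [h_mul_ynf hc0 hc, map_smul, buildTrace_even_x, buildTrace_even_y,
        show q + (l : ℤ) = -(-q - l) by ring, polyYX_neg_eval_zero hc0 hc, ← hE]
      push_cast
      rw [eval_comp, eval_neg, eval_X, neg_sub, sub_neg_eq_add, add_comm (l : ZMod (2 * m)),
        ← mul_assoc ((-1 : ℂ) ^ l), ← mul_assoc ((-1 : ℂ) ^ l), ← mul_assoc ((-1 : ℂ) ^ l),
        ← mul_pow]
      simp
    · rw [h_mul_ynf hc0 hc, map_smul, buildTrace_odd_x _ _ _ (by omega),
        buildTrace_odd_y _ _ _ (by omega), smul_zero]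

theorem buildTrace_rules (hE : ∀ q, E (-q) = E q)
    (hE2 : ∀ q : ZMod (2 * m), 2 * q ≠ 0 → E q = 0)
    (hJ : ∀ q R, J (-q) (R.comp (-X)) = J q R) : Rules (buildTrace J E hc0 hc) where
  inv w b := by
    rcases w with j | j
    · exact buildTrace_inv_a hE2 j b
    · rw [xa_eq, map_mul (grp c), mul_inv_rev, map_mul (grp c)]
      have e : ∀ a a' b b' : H c, a * a' * b * (b' * grp c (hGen m)⁻¹) =
          a * (a' * b * b') * grp c (hGen m)⁻¹ := fun a a' b b' => by simp only [mul_assoc]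
      rw [e, buildTrace_inv_h hE hJ, buildTrace_inv_a hE2]
  off_x i R q hi := by rw [buildTrace_x, if_neg hi]
  off_y i R q hi := by rw [buildTrace_y, if_neg hi]
  even_x i R q := by rw [buildTrace_even_x, buildTrace_e_h]; push_cast; rfl
  even_y i R q := by rw [buildTrace_even_y, buildTrace_e_h]; push_cast; rfl

/-- Every family of functionals on polynomials that satisfies the shift identities and the
reflection identity, with suitable values on `e_q h`, comes from a trace. -/
theorem exists_trace (hc0 : c 0 ≠ 0) (hc : ∀ i, c (-i) = c i) (hE : ∀ q, E (-q) = E q)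
    (hE2 : ∀ q : ZMod (2 * m), 2 * q ≠ 0 → E q = 0)
    (hJ : ∀ q R, J (-q) (R.comp (-X)) = J q R)
    (hs : ∀ (q : ℤ) (R : ℂ[X]), J q (lin c q * R) =
      J ((q + 1 : ℤ) : ZMod (2 * m)) (taylor (-1) (lin c q * R))) :
    ∃ T : H c →ₗ[ℂ] ℂ, IsTrace c T ∧ (∀ (q : ℤ) (R : ℂ[X]), T (kp c R * eH c q) = J q R) ∧
      ∀ q : ℤ, T (eH c q * grp c (hGen m)) = E q := by
  have h0 : ∀ (q : ℤ) (R : ℂ[X]), buildTrace J E hc0 hc (kp c R * eH c q) = J q R := by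
    intro q R
    have := buildTrace_x (J := J) (E := E) (hc0 := hc0) (hc := hc) 0 R q
    simpa using this
  refine ⟨buildTrace J E hc0 hc, (buildTrace_rules hE hE2 hJ).isTrace hc0 hc ?_, h0,
    buildTrace_e_h⟩
  intro q R
  rw [h0, h0, hs]

end Existence

end DicyclicTrace

namespace DicyclicTrace

/-! ### Uniqueness of periodic families with given shift defects. -/

section Families

/-! ### Functionals on polynomials and shifts -/

/-- The difference `(X + a)^{N+1} - X^{N+1}` is `(N + 1) a X^N` plus lower terms, so `D` vanishes on
all powers by induction. -/
theorem eq_zero_of_taylor_invariant {D : ℂ[X] →ₗ[ℂ] ℂ} {a : ℂ} (ha : a ≠ 0)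
    (h : ∀ f, D (taylor a f) = D f) : D = 0 := by
  have key : ∀ N : ℕ, D (X ^ N) = 0 := by
    intro N
    induction N using Nat.strong_induction_on with
    | _ N ih =>
      have h1 := h (X ^ (N + 1))
      have h2 : taylor a (X ^ (N + 1)) =
          ∑ k ∈ Finset.range (N + 2), (a ^ (N + 1 - k) * ((N + 1).choose k : ℂ)) • X ^ k := by
        rw [taylor_apply, pow_comp, X_comp, add_pow]
        refine Finset.sum_congr rfl fun k _ => ?_
        rw [smul_eq_C_mul, C_mul, C_pow, C_eq_natCast]
        ring
      rw [h2, map_sum, Finset.sum_range_succ, Finset.sum_range_succ, Finset.sum_eq_zero] at h1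
      · simp only [map_smul, zero_add, smul_eq_mul, Nat.choose_self, Nat.sub_self, pow_zero,
          Nat.cast_one, one_mul, add_eq_right, mul_eq_zero, Nat.choose_succ_self_right,
          Nat.add_sub_cancel_left, pow_one] at h1
        exact h1.resolve_left (not_or.2 ⟨ha, Nat.cast_ne_zero.2 N.succ_ne_zero⟩)
      · intro k hk
        rw [map_smul, ih k (Finset.mem_range.1 hk), smul_zero]
  refine LinearMap.ext fun f => ?_
  induction f using Polynomial.induction_on' with
  | add p q hp hq => rw [map_add, hp, hq, map_add]
  | monomial n t => rw [← smul_X_eq_monomial, map_smul, key, smul_zero, LinearMap.zero_apply]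

/-- Going once around the period makes each `D q` invariant under translation by `n`. -/
theorem eq_zero_of_shift {n : ℕ} (hn : n ≠ 0) {D : ℤ → ℂ[X] →ₗ[ℂ] ℂ}
    (hper : ∀ q, D (q + n) = D q) (h : ∀ q f, D q (taylor 1 f) = D (q + 1) f) (q : ℤ) :
    D q = 0 := by
  have key : ∀ (k : ℕ) (f : ℂ[X]), D q (taylor (k : ℂ) f) = D (q + k) f := by
    intro k
    induction k with
    | zero => intro f; simp
    | succ k ih =>
      intro f
      have e : taylor ((k + 1 : ℕ) : ℂ) f = taylor (k : ℂ) (taylor 1 f) := by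
        rw [taylor_taylor]; push_cast; rfl
      rw [e, ih, h]
      push_cast
      rw [add_assoc]
  exact eq_zero_of_taylor_invariant (Nat.cast_ne_zero.2 hn) fun f => by rw [key, hper]

/-- A periodic family of functionals is determined by the defects of its shift relations. -/
theorem family_ext {n : ℕ} (hn : n ≠ 0) {J J' : ℤ → ℂ[X] →ₗ[ℂ] ℂ}
    (hper : ∀ q, J (q + n) = J q) (hper' : ∀ q, J' (q + n) = J' q) {d : ℤ → ℂ[X] → ℂ}
    (h : ∀ q f, J q (taylor 1 f) - J (q + 1) f = d q f)
    (h' : ∀ q f, J' q (taylor 1 f) - J' (q + 1) f = d q f) : J = J' := by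
  funext q
  refine sub_eq_zero.1 (eq_zero_of_shift (D := fun q => J q - J' q) hn ?_ ?_ q)
  · intro q
    simp only [hper, hper']
  · intro q f
    rw [LinearMap.sub_apply, LinearMap.sub_apply]
    linear_combination h q f - h' q f

end Families

end DicyclicTrace

namespace DicyclicTrace

open Filter Topology

/-! ### Geometry of good contours and absolute convergence. -/

section Contour

/-! ### Piecewise `C¹` curves -/

/-- A point has positive distance to the other break points. It may be a break point itself, hence
the separate one-sided intervals. -/
theorem PiecewiseC1.exists_pieces {γ : ℝ → ℂ} (hγ : PiecewiseC1 γ) :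
    ∃ S : Finset ℝ, (∀ t ∉ S, DifferentiableAt ℝ γ t) ∧ ∀ x, ∃ ε > 0,
      ContDiffOn ℝ 1 γ (Icc (x - ε) x) ∧ ContDiffOn ℝ 1 γ (Icc x (x + ε)) := by
  obtain ⟨-, S, hS⟩ := hγ
  have key : ∀ x : ℝ, ∃ ε > 0, ∀ t ∈ S, t ≠ x → ε < |t - x| := by
    intro x
    have hopen : IsOpen ((S.erase x : Finset ℝ) : Set ℝ)ᶜ := (Finset.finite_toSet _).isClosed.isOpen_compl
    obtain ⟨ε, hε, h⟩ := Metric.isOpen_iff.1 hopen x (by simp)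
    refine ⟨ε / 2, half_pos hε, fun t ht hne => ?_⟩
    by_contra hlt
    have : t ∈ Metric.ball x ε := by
      rw [Metric.mem_ball, Real.dist_eq]
      linarith
    exact h this (by simp [ht, hne])
  refine ⟨S, fun t ht => ?_, fun x => ?_⟩
  · obtain ⟨ε, hε, h⟩ := key t
    have hd := hS (t - ε) (t + ε) (by linarith) ?_
    · exact (hd.differentiableOn one_ne_zero).differentiableAt
        (Icc_mem_nhds (by linarith) (by linarith))
    · rw [Set.disjoint_left]
      intro u hu hu'
      have := h u hu' (fun e => ht (e ▸ hu'))
      rw [lt_abs] at this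
      rcases this with h1 | h1 <;> linarith [hu.1, hu.2]
  · obtain ⟨ε, hε, h⟩ := key x
    refine ⟨ε, hε, hS _ _ (by linarith) ?_, hS _ _ (by linarith) ?_⟩ <;>
    · rw [Set.disjoint_left]
      intro u hu hu'
      have := h u hu' (by rintro rfl; linarith [hu.1, hu.2])
      rw [lt_abs] at this
      rcases this with h1 | h1 <;> linarith [hu.1, hu.2]

theorem integrableOn_deriv_of_contDiffOn {γ : ℝ → ℂ} {s t : ℝ} (hst : s < t)
    (h : ContDiffOn ℝ 1 γ (Icc s t)) : IntegrableOn (deriv γ) (Icc s t) := by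
  have h1 : IntegrableOn (derivWithin γ (Icc s t)) (Icc s t) :=
    (h.continuousOn_derivWithin (uniqueDiffOn_Icc hst) le_rfl).integrableOn_Icc
  rw [integrableOn_Icc_iff_integrableOn_Ioo] at h1 ⊢
  refine h1.congr_fun (fun u hu => ?_) measurableSet_Ioo
  exact derivWithin_of_mem_nhds (Icc_mem_nhds hu.1 hu.2)

theorem PiecewiseC1.locallyIntegrable_deriv {γ : ℝ → ℂ} (hγ : PiecewiseC1 γ) :
    LocallyIntegrable (deriv γ) := by
  obtain ⟨S, -, h⟩ := hγ.exists_pieces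
  intro x
  obtain ⟨ε, hε, h1, h2⟩ := h x
  refine ⟨Icc (x - ε) x ∪ Icc x (x + ε), ?_, ?_⟩
  · rw [Icc_union_Icc_eq_Icc (by linarith) (by linarith)]
    exact Icc_mem_nhds (by linarith) (by linarith)
  · exact (integrableOn_deriv_of_contDiffOn (by linarith) h1).union
      (integrableOn_deriv_of_contDiffOn (by linarith) h2)

/-! ### Geometry of good contours -/

variable {α : ℤ → ℂ} {γ : ℝ → ℂ}

theorem IsGoodContour.continuous (hγ : IsGoodContour α γ) : Continuous γ := hγ.piecewiseC1.1

theorem IsGoodContour.exists_im (hγ : IsGoodContour α γ) (y : ℝ) : ∃ t, (γ t).im = y := by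
  obtain ⟨z, ⟨⟨t, rfl⟩, h⟩, -⟩ := hγ.one_point y
  exact ⟨t, h⟩

theorem IsGoodContour.tendsto_im_atTop (hγ : IsGoodContour α γ) :
    Tendsto (fun t => (γ t).im) atTop atTop :=
  tendsto_atTop_atTop_of_monotone hγ.upward.monotone fun y =>
    (hγ.exists_im y).imp fun _ h => h.ge

theorem IsGoodContour.tendsto_im_atBot (hγ : IsGoodContour α γ) :
    Tendsto (fun t => (γ t).im) atBot atBot :=
  tendsto_atBot_atBot_of_monotone hγ.upward.monotone fun y =>
    (hγ.exists_im y).imp fun _ h => h.le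

theorem IsGoodContour.exists_re (hγ : IsGoodContour α γ) :
    ∃ r a : ℝ, 0 < r ∧ (∀ t, r ≤ (γ t).im → (γ t).re = a) ∧
      ∀ t, (γ t).im ≤ -r → (γ t).re = -a := by
  obtain ⟨r, a, hr, h⟩ := hγ.straight
  have key : ∀ t, r ≤ |(γ t).im| → γ t ∈ {z : ℂ | z.re = a ∧ 0 < z.im} ∪
      {z : ℂ | z.re = -a ∧ z.im < 0} := by
    intro t ht
    have : γ t ∈ range γ \ Metric.ball 0 r := by
      refine ⟨⟨t, rfl⟩, ?_⟩
      rw [mem_ball_zero_iff, not_lt]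
      exact ht.trans (Complex.abs_im_le_norm _)
    rw [h] at this
    exact this.1
  refine ⟨r, a, hr, fun t ht => ?_, fun t ht => ?_⟩
  · rcases key t (ht.trans (le_abs_self _)) with h1 | h1
    · exact h1.1
    · linarith [h1.2]
  · rcases key t (by rw [abs_of_neg (by linarith)]; linarith) with h1 | h1
    · linarith [h1.2]
    · exact h1.1

theorem IsGoodContour.exists_re_bound (hγ : IsGoodContour α γ) : ∃ A, ∀ t, |(γ t).re| ≤ A := by
  obtain ⟨r, a, -, h1, h2⟩ := hγ.exists_re
  obtain ⟨t1, ht1⟩ := hγ.exists_im r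
  obtain ⟨t2, ht2⟩ := hγ.exists_im (-r)
  obtain ⟨B, hB⟩ := (isCompact_Icc (a := t2) (b := t1)).exists_bound_of_continuousOn
    (Complex.continuous_re.comp hγ.continuous).continuousOn
  refine ⟨max B |a|, fun t => ?_⟩
  rcases le_total t1 t with h | h
  · rw [h1 t (ht1 ▸ hγ.upward.monotone h)]
    exact le_max_right _ _
  rcases le_total t t2 with h' | h'
  · rw [h2 t (ht2 ▸ hγ.upward.monotone h'), abs_neg]
    exact le_max_right _ _
  · exact (hB t ⟨h', h⟩).trans (le_max_left _ _)

/-- Far out in the parameter the curve is vertical and past all break points; there `|γ'|` is the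
derivative of the height (`norm_deriv`). -/
theorem IsGoodContour.exists_tail (hγ : IsGoodContour α γ) :
    ∃ b : ℝ, ∀ t, b < |t| → DifferentiableAt ℝ γ t ∧ (deriv γ t).re = 0 := by
  obtain ⟨S, hS, -⟩ := hγ.piecewiseC1.exists_pieces
  obtain ⟨r, a, -, h1, h2⟩ := hγ.exists_re
  obtain ⟨t1, ht1⟩ := hγ.exists_im r
  obtain ⟨t2, ht2⟩ := hγ.exists_im (-r)
  obtain ⟨B, hB⟩ := (S.finite_toSet.isBounded).exists_norm_le
  refine ⟨max B (max t1 (-t2)), fun t ht => ?_⟩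
  obtain ⟨hB', h12⟩ := max_lt_iff.1 ht
  obtain ⟨ht1', ht2'⟩ := max_lt_iff.1 h12
  have hd : DifferentiableAt ℝ γ t := hS t fun h => absurd (hB t h) (not_le.2 hB')
  refine ⟨hd, ?_⟩
  have hre : HasDerivAt (fun u => (γ u).re) (deriv γ t).re t :=
    (Complex.reCLM.hasFDerivAt.comp_hasDerivAt t hd.hasDerivAt)
  rcases le_total 0 t with h0 | h0
  · rw [abs_of_nonneg h0] at ht1'
    refine hre.unique ((hasDerivAt_const t a).congr_of_eventuallyEq ?_)
    filter_upwards [Ioi_mem_nhds ht1'] with u hu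
    exact h1 u (ht1 ▸ hγ.upward.monotone (le_of_lt hu))
  · rw [abs_of_nonpos h0] at ht2'
    refine hre.unique ((hasDerivAt_const t (-a)).congr_of_eventuallyEq ?_)
    filter_upwards [Iio_mem_nhds (show t < t2 by linarith)] with u hu
    exact h2 u (ht2 ▸ hγ.upward.monotone (le_of_lt hu))

/-- The integrand is the nonnegative derivative of `-(1/δ) exp(-δ y)`, which converges. No bound on
the speed of the parametrization is involved. -/
theorem integrableOn_exp_neg_mul_deriv {y y' : ℝ → ℝ} {b δ : ℝ} (hδ : 0 < δ)
    (hc : Continuous y) (hy : ∀ t, b < t → HasDerivAt y (y' t) t) (hy' : ∀ t, b < t → 0 ≤ y' t)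
    (hlim : Tendsto y atTop atTop) :
    IntegrableOn (fun t => Real.exp (-(δ * y t)) * y' t) (Ioi b) := by
  have hg : ∀ t ∈ Ioi b, HasDerivAt (fun t => -(1 / δ) * Real.exp (-(δ * y t)))
      (Real.exp (-(δ * y t)) * y' t) t := by
    intro t ht
    have := (((hy t ht).const_mul δ).neg.exp).const_mul (-(1 / δ))
    refine this.congr_deriv ?_
    rw [Pi.neg_apply]
    field_simp
  refine integrableOn_Ioi_deriv_of_nonneg (l := -(1 / δ) * 0) ?_ hg
    (fun t ht => mul_nonneg (Real.exp_pos _).le (hy' t ht)) ?_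
  · exact Continuous.continuousWithinAt (by fun_prop)
  · refine Tendsto.const_mul _ (Real.tendsto_exp_atBot.comp ?_)
    exact tendsto_neg_atTop_atBot.comp (hlim.const_mul_atTop hδ)

theorem IsGoodContour.deriv_im_nonneg (hγ : IsGoodContour α γ) {t : ℝ}
    (h : DifferentiableAt ℝ γ t) : 0 ≤ (deriv γ t).im := by
  have him : HasDerivAt (fun u => (γ u).im) (deriv γ t).im t :=
    (Complex.imCLM.hasFDerivAt.comp_hasDerivAt t h.hasDerivAt)
  rw [← him.deriv]
  exact hγ.upward.monotone.deriv_nonneg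

theorem IsGoodContour.norm_deriv (hγ : IsGoodContour α γ) {t : ℝ}
    (h : DifferentiableAt ℝ γ t) (h0 : (deriv γ t).re = 0) : ‖deriv γ t‖ = (deriv γ t).im := by
  have e : deriv γ t = (deriv γ t).im * I := by
    apply Complex.ext <;> simp [h0]
  rw [e]
  simp only [norm_mul, Complex.norm_real, Complex.norm_I, mul_one, Complex.mul_im,
    Complex.ofReal_re, Complex.I_im, Complex.ofReal_im, Complex.I_re, mul_zero, add_zero,
    Real.norm_eq_abs]
  exact abs_of_nonneg (hγ.deriv_im_nonneg h)

theorem IsGoodContour.integrable_pullback (hγ : IsGoodContour α γ) {F : ℂ → ℂ}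
    (hF : Continuous fun t => F (γ t)) {K δ Y : ℝ} (hδ : 0 < δ)
    (hb : ∀ t, Y ≤ |(γ t).im| → ‖F (γ t)‖ ≤ K * Real.exp (-(δ * |(γ t).im|))) :
    Integrable (pullback γ F) := by
  obtain ⟨b, htail⟩ := hγ.exists_tail
  have hmeas : AEStronglyMeasurable (pullback γ F) volume :=
    (hF.measurable.mul (measurable_deriv γ)).aestronglyMeasurable
  have hloc : ∀ s t, IntegrableOn (pullback γ F) (Icc s t) := fun s t =>
    ((hγ.piecewiseC1.locallyIntegrable_deriv.integrableOn_isCompact isCompact_Icc).continuousOn_mul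
      hF.continuousOn isCompact_Icc)
  have him : ∀ t, DifferentiableAt ℝ γ t → HasDerivAt (fun u => (γ u).im) (deriv γ t).im t :=
    fun t h => (Complex.imCLM.hasFDerivAt.comp_hasDerivAt t h.hasDerivAt)
  have hcont : Continuous fun t => (γ t).im := Complex.continuous_im.comp hγ.continuous
  obtain ⟨b1, hb1⟩ := (hγ.tendsto_im_atTop.eventually_ge_atTop (max Y 0)).exists_forall_of_atTop
  obtain ⟨b2, hb2⟩ := (hγ.tendsto_im_atBot.eventually_le_atBot (-(max Y 0))).exists_forall_of_atBot
  let B := max (max b 0) (max b1 (-b2))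
  have hB : b ≤ B := (le_max_left _ _).trans (le_max_left _ _)
  have hB0 : 0 ≤ B := (le_max_right _ _).trans (le_max_left _ _)
  have hB1 : b1 ≤ B := (le_max_left _ _).trans (le_max_right _ _)
  have hB2 : -b2 ≤ B := (le_max_right _ _).trans (le_max_right _ _)
  have hpos : ∀ t, B < t → DifferentiableAt ℝ γ t ∧ (deriv γ t).re = 0 := fun t ht =>
    htail t (lt_of_lt_of_le (hB.trans_lt ht) (le_abs_self t))
  have hneg : ∀ t, B < t → DifferentiableAt ℝ γ (-t) ∧ (deriv γ (-t)).re = 0 := fun t ht =>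
    htail (-t) (by rw [abs_neg]; exact lt_of_lt_of_le (hB.trans_lt ht) (le_abs_self t))
  have h1 : IntegrableOn (pullback γ F) (Ioi B) := by
    have := (integrableOn_exp_neg_mul_deriv hδ hcont (fun t ht => him t (hpos t ht).1)
      (fun t ht => hγ.deriv_im_nonneg (hpos t ht).1) hγ.tendsto_im_atTop).const_mul K
    refine Integrable.mono' this hmeas.restrict ?_
    filter_upwards [ae_restrict_mem measurableSet_Ioi] with t ht
    have h0 := hb1 t (hB1.trans (le_of_lt ht))
    have habs : |(γ t).im| = (γ t).im := abs_of_nonneg ((le_max_right _ _).trans h0)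
    have := hb t (by rw [habs]; exact (le_max_left _ _).trans h0)
    rw [habs] at this
    rw [pullback, norm_mul, hγ.norm_deriv (hpos t ht).1 (hpos t ht).2, ← mul_assoc]
    exact mul_le_mul_of_nonneg_right this (hγ.deriv_im_nonneg (hpos t ht).1)
  -- The lower tail is treated as an upper one after `t ↦ -t`, with height `-Im γ(-t)`.
  have h2 : IntegrableOn (fun t => pullback γ F (-t)) (Ioi B) := by
    have := (integrableOn_exp_neg_mul_deriv (y := fun t => -(γ (-t)).im)
      (y' := fun t => (deriv γ (-t)).im) (b := B) hδ (hcont.comp continuous_neg).neg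
      (fun t ht => ?_)
      (fun t ht => hγ.deriv_im_nonneg (hneg t ht).1)
      (tendsto_neg_atBot_atTop.comp (hγ.tendsto_im_atBot.comp
        tendsto_neg_atTop_atBot))).const_mul K
    · refine Integrable.mono' this ?_ ?_
      · exact ((hF.comp continuous_neg).measurable.mul
          ((measurable_deriv γ).comp measurable_neg)).aestronglyMeasurable
      filter_upwards [ae_restrict_mem measurableSet_Ioi] with t ht
      have ht' : B < t := ht
      have h0 := hb2 (-t) (by linarith)
      have h00 : (γ (-t)).im ≤ 0 := h0.trans (neg_nonpos.2 (le_max_right _ _))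
      have habs : |(γ (-t)).im| = -(γ (-t)).im := abs_of_nonpos h00
      have := hb (-t) (by rw [habs]; linarith [le_max_left Y 0])
      rw [habs] at this
      rw [pullback, norm_mul, hγ.norm_deriv (hneg t ht).1 (hneg t ht).2, ← mul_assoc]
      exact mul_le_mul_of_nonneg_right this (hγ.deriv_im_nonneg (hneg t ht).1)
    · have h3 := ((him (-t) (hneg t ht).1).scomp t (hasDerivAt_neg t)).neg
      exact HasDerivAt.congr_deriv (f := fun t => -(γ (-t)).im) h3 (by simp)
  have h3 : IntegrableOn (pullback γ F) (Iio (-B)) := by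
    have e : IntegrableOn (fun t => pullback γ F (-t)) (Neg.neg ⁻¹' Iio (-B)) := by
      rw [show (Neg.neg ⁻¹' Iio (-B) : Set ℝ) = Ioi B by ext t; simp]
      exact h2
    exact ((Measure.measurePreserving_neg (volume : Measure ℝ)).integrableOn_comp_preimage
      (Homeomorph.neg ℝ).measurableEmbedding).1 e
  have h4 := (h3.union (hloc (-B) B)).union h1
  rw [← integrableOn_univ]
  refine h4.mono_set fun t _ => ?_
  rcases lt_or_ge t (-B) with h | h
  · exact .inl (.inl h)
  · rcases le_or_gt t B with h' | h'
    · exact .inl (.inr ⟨h, h'⟩)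
    · exact .inr h'

end Contour

end DicyclicTrace

namespace DicyclicTrace

open Filter Topology Bornology

section Decay

/-! ### Decay of the weight functions along vertical lines -/

/-- The function `z ↦ exp (2 π i z / n)`. -/
def expDiv (n : ℕ) (z : ℂ) : ℂ := Complex.exp (2 * Real.pi * I / (n : ℂ) * z)

theorem norm_expDiv (n : ℕ) (z : ℂ) :
    ‖expDiv n z‖ = Real.exp (-(2 * Real.pi / n * z.im)) := by
  have : 2 * (Real.pi : ℂ) * I / (n : ℂ) * z = ((2 * Real.pi / n : ℝ) : ℂ) * (I * z) := by
    push_cast; ring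
  rw [expDiv, Complex.norm_exp, this, Complex.re_ofReal_mul]
  simp

/-- Put `u = expDiv n z`. Upwards `u → 0`, where `G / P` is bounded and the factor `u` decays.
Downwards `u → ∞`, and the degree gap of two gives `u G / P = O(1 / u)`. -/
theorem exists_bound_ratio {n : ℕ} (hn : 0 < n) {G P : ℂ[X]} (hP : P.eval 0 ≠ 0)
    (hdeg : G.natDegree + 2 ≤ P.natDegree) :
    ∃ K Y, 0 < K ∧ ∀ z : ℂ, Y ≤ |z.im| →
      ‖expDiv n z * (G.eval (expDiv n z) / P.eval (expDiv n z))‖ ≤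
        K * Real.exp (-(2 * Real.pi / n * |z.im|)) := by
  have h1 : (fun u => G.eval u / P.eval u) =O[𝓝 0] fun _ => (1 : ℝ) :=
    (G.continuous.continuousAt.div P.continuous.continuousAt hP).isBigO_one ℝ
  have h2 : (fun u => (X ^ 2 * G).eval u) =O[cobounded ℂ] fun u => P.eval u := by
    refine isBigO_cobounded_of_degree_le ?_
    rcases eq_or_ne G 0 with rfl | hG
    · simp
    have hP0 : P ≠ 0 := by rintro rfl; simp at hdeg
    rw [degree_eq_natDegree (by simp [hG]), degree_eq_natDegree hP0,
      natDegree_mul (by simp) hG, natDegree_X_pow, Nat.cast_le]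
    omega
  obtain ⟨K1, hK1, h1⟩ := h1.exists_pos
  obtain ⟨K2, hK2, h2⟩ := h2.exists_pos
  rw [Asymptotics.isBigOWith_iff] at h1 h2
  obtain ⟨r, hr, h1⟩ := Metric.eventually_nhds_iff.1 h1
  obtain ⟨R, -, h2⟩ := (hasBasis_cobounded_norm (E := ℂ)).eventually_iff.1 h2
  have hτ : 0 < 2 * Real.pi / n := by positivity
  have hlim1 : Tendsto (fun y : ℝ => Real.exp (-(2 * Real.pi / n * y))) atTop (𝓝 0) :=
    Real.tendsto_exp_neg_atTop_nhds_zero.comp (tendsto_id.const_mul_atTop hτ)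
  have hlim2 : Tendsto (fun y : ℝ => Real.exp (2 * Real.pi / n * y)) atTop atTop :=
    Real.tendsto_exp_atTop.comp (tendsto_id.const_mul_atTop hτ)
  obtain ⟨Y, hY⟩ := ((hlim1.eventually_lt_const hr).and
    (hlim2.eventually_ge_atTop R)).exists_forall_of_atTop
  refine ⟨max K1 K2, Y, lt_max_of_lt_left hK1, fun z hz => ?_⟩
  obtain ⟨hs, hl⟩ := hY _ hz
  have hU0 : expDiv n z ≠ 0 := Complex.exp_ne_zero _
  have hU := norm_expDiv n z
  rcases le_total 0 z.im with h | h
  · rw [abs_of_nonneg h] at hs ⊢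
    have := h1 (y := expDiv n z) (by rw [dist_zero_right, hU]; exact hs)
    rw [norm_mul, hU, mul_comm]
    refine mul_le_mul_of_nonneg_right (this.trans ?_) (Real.exp_pos _).le
    simp
  · rw [abs_of_nonpos h] at hl ⊢
    have hU' : ‖expDiv n z‖ = Real.exp (2 * Real.pi / n * -z.im) := by rw [hU]; ring_nf
    have := h2 (x := expDiv n z) (by rw [mem_ofPred_eq, hU']; exact hl)
    rcases eq_or_ne (P.eval (expDiv n z)) 0 with h0 | h0
    · simp only [h0, div_zero, mul_zero, norm_zero]
      positivity
    have e : expDiv n z * (G.eval (expDiv n z) / P.eval (expDiv n z)) =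
        (X ^ 2 * G).eval (expDiv n z) / P.eval (expDiv n z) * (expDiv n z)⁻¹ := by
      simp only [eval_mul, eval_pow, eval_X]
      field_simp
    rw [e, norm_mul, norm_div, norm_inv, hU', ← Real.exp_neg]
    refine mul_le_mul_of_nonneg_right ?_ (Real.exp_pos _).le
    rw [div_le_iff₀ (norm_pos_iff.2 h0)]
    exact this.trans (mul_le_mul_of_nonneg_right (le_max_right _ _) (norm_nonneg _))

theorem exists_bound_eval (f : ℂ[X]) (A : ℝ) {δ : ℝ} (hδ : 0 < δ) :
    ∃ K Y, 0 < K ∧ ∀ z : ℂ, |z.re| ≤ A → Y ≤ |z.im| →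
      ‖f.eval z‖ ≤ K * Real.exp (δ * |z.im|) := by
  -- Once the height `y = |Im z|` is at least `A`, one has `|z| ≤ A + y ≤ 2 y`.
  have key : (fun y : ℝ => ∑ i ∈ Finset.range (f.natDegree + 1), ‖f.coeff i‖ * (2 * y) ^ i)
      =O[atTop] fun y => Real.exp (δ * y) := by
    refine Asymptotics.IsBigO.fun_sum fun i _ => Asymptotics.IsBigO.const_mul_left ?_ _
    simp_rw [mul_pow]
    exact ((isLittleO_pow_exp_pos_mul_atTop i hδ).isBigO).const_mul_left _
  obtain ⟨K, hK, key⟩ := key.exists_pos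
  obtain ⟨Y, hY⟩ := (Asymptotics.isBigOWith_iff.1 key).exists_forall_of_atTop
  refine ⟨K, max Y A, hK, fun z hre him => ?_⟩
  have h := hY _ ((le_max_left _ _).trans him)
  rw [Real.norm_of_nonneg (Real.exp_pos _).le] at h
  refine le_trans ?_ ((le_abs_self _).trans h)
  rw [eval_eq_sum_range]
  refine (norm_sum_le _ _).trans (Finset.sum_le_sum fun i _ => ?_)
  rw [norm_mul, norm_pow]
  gcongr
  have := Complex.norm_le_abs_re_add_abs_im z
  linarith [(le_max_right _ _).trans him]

theorem exists_bound_weight {n : ℕ} (hn : 0 < n) {G P : ℂ[X]} (hP : P.eval 0 ≠ 0)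
    (hdeg : G.natDegree + 2 ≤ P.natDegree) (f : ℂ[X]) (A : ℝ) :
    ∃ K Y δ, 0 < K ∧ 0 < δ ∧ ∀ z : ℂ, |z.re| ≤ A → Y ≤ |z.im| →
      ‖f.eval z * (expDiv n z * (G.eval (expDiv n z) / P.eval (expDiv n z)))‖ ≤
        K * Real.exp (-(δ * |z.im|)) := by
  obtain ⟨K1, Y1, hK1, h1⟩ := exists_bound_ratio hn hP hdeg
  -- Half of the decay rate `2 π / n` is spent on the polynomial factor.
  obtain ⟨K2, Y2, hK2, h2⟩ := exists_bound_eval f A (δ := Real.pi / n) (by positivity)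
  refine ⟨K2 * K1, max Y1 Y2, Real.pi / n, by positivity, by positivity, fun z hre him => ?_⟩
  rw [norm_mul]
  refine (mul_le_mul (h2 z hre ((le_max_right _ _).trans him))
    (h1 z ((le_max_left _ _).trans him)) (norm_nonneg _) (by positivity)).trans_eq ?_
  rw [mul_mul_mul_comm, ← Real.exp_add]
  ring_nf

end Decay

section Residue

/-! ### Shifting a contour across a simple pole -/

/-- Differentiation under the integral, dominated on a compact thickening of the segment, followed
by the fundamental theorem. It yields a primitive of `r(z + 1) - r(z)` without any topological
condition on `Ω`. -/
theorem hasDerivAt_integral_segment {Ω : Set ℂ} (hΩ : IsOpen Ω) {r : ℂ → ℂ}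
    (hr : DifferentiableOn ℂ r Ω) {w : ℂ} (hw : ∀ s ∈ Icc (0 : ℝ) 1, w + s ∈ Ω) :
    HasDerivAt (fun v => ∫ s in (0 : ℝ)..1, r (v + s)) (r (w + 1) - r w) w := by
  let k : Set ℂ := (fun s : ℝ => w + s) '' Icc 0 1
  have hcs : Continuous fun s : ℝ => w + (s : ℂ) := by fun_prop
  have hk : IsCompact k := isCompact_Icc.image hcs
  obtain ⟨δ, hδ, hsub⟩ := hk.exists_cthickening_subset_open hΩ (by rintro _ ⟨s, hs, rfl⟩; exact hw s hs)
  have hd : DifferentiableOn ℂ (deriv r) Ω := hr.deriv hΩ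
  obtain ⟨M, hM⟩ := (hk.cthickening (r := δ)).exists_bound_of_continuousOn
    (hd.continuousOn.mono hsub)
  have hmem : ∀ v ∈ Metric.ball w δ, ∀ s ∈ Icc (0 : ℝ) 1, v + s ∈ Metric.cthickening δ k := by
    intro v hv s hs
    refine Metric.mem_cthickening_of_dist_le _ (w + s) _ _ ⟨s, hs, rfl⟩ ?_
    rw [dist_add_right]
    exact (Metric.mem_ball.1 hv).le
  have hderiv : ∀ z ∈ Ω, HasDerivAt r (deriv r z) z := fun z hz =>
    (hr.differentiableAt (hΩ.mem_nhds hz)).hasDerivAt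
  have hcont : ∀ g : ℂ → ℂ, ContinuousOn g Ω → ∀ v ∈ Metric.ball w δ,
      ContinuousOn (fun s : ℝ => g (v + s)) (Icc 0 1) := fun g hg v hv =>
    hg.comp (by fun_prop) fun s hs => hsub (hmem v hv s hs)
  have hint : ∀ g : ℂ → ℂ, ContinuousOn g Ω → ∀ v ∈ Metric.ball w δ,
      IntervalIntegrable (fun s : ℝ => g (v + s)) volume 0 1 := fun g hg v hv =>
    ContinuousOn.intervalIntegrable_of_Icc zero_le_one (hcont g hg v hv)
  have hw0 : w ∈ Metric.ball w δ := Metric.mem_ball_self hδ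
  have hIoc : Set.uIoc (0 : ℝ) 1 ⊆ Icc 0 1 := by
    rw [uIoc_of_le zero_le_one]; exact Ioc_subset_Icc_self
  have main := (intervalIntegral.hasDerivAt_integral_of_dominated_loc_of_deriv_le
    (μ := volume) (F := fun v s => r (v + (s : ℝ))) (F' := fun v s => deriv r (v + (s : ℝ)))
    (x₀ := w) (s := Metric.ball w δ) (a := 0) (b := 1) (bound := fun _ => M)
    (Metric.ball_mem_nhds w hδ) ?_ (hint r hr.continuousOn w hw0) ?_ ?_
    (intervalIntegrable_const) ?_).2
  · have e : ∫ s in (0 : ℝ)..1, deriv r (w + s) = r (w + 1) - r w := by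
      have h := intervalIntegral.integral_eq_sub_of_hasDerivAt (a := 0) (b := 1)
        (f := fun s : ℝ => r (w + s)) (f' := fun s : ℝ => deriv r (w + s)) ?_
        (hint _ hd.continuousOn w hw0)
      · simpa using h
      · intro s hs
        rw [uIcc_of_le zero_le_one] at hs
        have h1 : HasDerivAt (fun s : ℝ => w + (s : ℂ)) 1 s :=
          (Complex.ofRealCLM.hasDerivAt).const_add w
        exact HasDerivAt.congr_deriv (f := fun s : ℝ => r (w + s))
          ((hderiv _ (hw s hs)).comp_of_eq s h1 rfl) (mul_one _)
    rwa [e] at main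
  · filter_upwards [Metric.ball_mem_nhds w hδ] with v hv
    exact ((hcont r hr.continuousOn v hv).mono hIoc).aestronglyMeasurable measurableSet_uIoc
  · exact ((hcont _ hd.continuousOn w hw0).mono hIoc).aestronglyMeasurable measurableSet_uIoc
  · exact .of_forall fun s hs v hv => hM _ (hmem v hv s (hIoc hs))
  · refine .of_forall fun s hs v hv => ?_
    have h := hderiv _ (hsub (hmem v hv s (hIoc hs)))
    simpa using h.comp_add_const v (s : ℂ)

theorem tendsto_arg_of_im_atTop {ι : Type*} {l : Filter ι} {w : ι → ℂ} {A : ℝ}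
    (hre : ∀ i, |(w i).re| ≤ A) (him : Tendsto (fun i => (w i).im) l atTop) :
    Tendsto (fun i => (w i).arg) l (𝓝 (Real.pi / 2)) := by
  have h1 : Tendsto (fun i => (w i).re / ‖w i‖) l (𝓝 0) := by
    refine squeeze_zero_norm' ?_ ((tendsto_const_nhds (x := A)).div_atTop him)
    filter_upwards [him.eventually_gt_atTop 0] with i hi
    rw [norm_div, norm_norm, Real.norm_eq_abs]
    exact div_le_div₀ ((abs_nonneg _).trans (hre i)) (hre i) hi
      ((le_abs_self _).trans (Complex.abs_im_le_norm _))
  have h2 := (Real.continuous_arccos.tendsto 0).comp h1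
  rw [Real.arccos_zero] at h2
  refine h2.congr' ?_
  filter_upwards [him.eventually_gt_atTop 0] with i hi
  exact (Complex.arg_of_im_pos hi).symm

/-- The moduli become asymptotically equal. In the upper half plane the argument of `-w` is that of
`w` minus `π`, and the arguments of `w` and `w + 1` both tend to `π / 2`. -/
theorem tendsto_log_add_one_sub_log_neg {ι : Type*} {l : Filter ι} {w : ι → ℂ} {A : ℝ}
    (hre : ∀ i, |(w i).re| ≤ A) (him : Tendsto (fun i => (w i).im) l atTop) :
    Tendsto (fun i => Complex.log (w i + 1) - Complex.log (-w i)) l (𝓝 (Real.pi * I)) := by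
  have harg : Tendsto (fun i => (w i + 1).arg - (-w i).arg) l (𝓝 Real.pi) := by
    have h1 : Tendsto (fun i => (w i + 1).arg) l (𝓝 (Real.pi / 2)) :=
      tendsto_arg_of_im_atTop (A := A + 1)
        (fun i => by
          rw [Complex.add_re, Complex.one_re]
          exact (abs_add_le _ _).trans (by rw [abs_one]; linarith [hre i])) (by simpa using him)
    have h2 := (tendsto_arg_of_im_atTop hre him).sub_const Real.pi
    have h3 := h1.sub h2
    rw [show Real.pi / 2 - (Real.pi / 2 - Real.pi) = Real.pi by ring] at h3
    refine h3.congr' ?_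
    filter_upwards [him.eventually_gt_atTop 0] with i hi
    rw [Complex.arg_neg_eq_arg_sub_pi_of_im_pos hi]
  have hnorm : Tendsto (fun i => Real.log ‖w i + 1‖ - Real.log ‖-w i‖) l (𝓝 0) := by
    have h0 : Tendsto (fun i => ‖w i‖) l atTop :=
      tendsto_atTop_mono (fun i => (le_abs_self _).trans (Complex.abs_im_le_norm _)) him
    have h1 : Tendsto (fun i => (w i)⁻¹) l (𝓝 0) :=
      tendsto_inv₀_cobounded.comp (tendsto_norm_atTop_iff_cobounded.1 h0)
    have h2 : Tendsto (fun i => Real.log ‖1 + (w i)⁻¹‖) l (𝓝 0) := by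
      have h3 : ContinuousAt (fun z : ℂ => Real.log ‖1 + z‖) 0 :=
        ContinuousAt.log (by fun_prop) (by simp)
      have h4 := h3.tendsto.comp h1
      simp only [add_zero, norm_one, Real.log_one] at h4
      exact h4
    refine h2.congr' ?_
    filter_upwards [him.eventually_gt_atTop 0] with i hi
    have hw : w i ≠ 0 := fun h => by rw [h] at hi; simp at hi
    have hw1 : w i + 1 ≠ 0 := fun h => by
      have := congrArg Complex.im h
      simp at this
      linarith
    rw [norm_neg, ← Real.log_div (norm_ne_zero_iff.2 hw1) (norm_ne_zero_iff.2 hw), ← norm_div,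
      add_div, div_self hw, one_div]
  have := ((Complex.continuous_ofReal.tendsto _).comp hnorm).add
    (((Complex.continuous_ofReal.tendsto _).comp harg).mul_const I)
  rw [Complex.ofReal_zero, zero_add] at this
  refine this.congr fun i => ?_
  simp only [Complex.log, Function.comp_apply]
  push_cast
  ring

theorem tendsto_log_add_one_sub_log_neg' {ι : Type*} {l : Filter ι} {w : ι → ℂ} {A : ℝ}
    (hre : ∀ i, |(w i).re| ≤ A) (him : Tendsto (fun i => (w i).im) l atBot) :
    Tendsto (fun i => Complex.log (w i + 1) - Complex.log (-w i)) l (𝓝 (-(Real.pi * I))) := by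
  -- The substitution `w ↦ -w - 1` exchanges the two logarithms and turns downwards into upwards.
  have h := (tendsto_log_add_one_sub_log_neg (w := fun i => -w i - 1) (A := A + 1) (l := l)
    (fun i => ?_) ?_).neg
  · refine h.congr fun i => ?_
    rw [sub_add_cancel, neg_sub, show -(-w i - 1) = w i + 1 by ring]
  · rw [Complex.sub_re, Complex.neg_re, Complex.one_re]
    exact (abs_sub _ _).trans (by rw [abs_neg, abs_one]; linarith [hre i])
  · simpa using him

variable {α : ℤ → ℂ} {γ : ℝ → ℂ}

/-- The residue theorem for the strip between `C` and `C + 1`, proved with a primitive `B` of `Φ(z +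
1) - Φ(z)` along `C`. The polar part integrates to two logarithms, the rest to a segment integral
`K`. Far out `K → 0`, while the logarithms contribute `± π i` at the two ends. -/
theorem contourIntegral_shift_sub (hγ : IsGoodContour α γ) {Φ hh : ℂ → ℂ} {p : ℂ} {Ω : Set ℂ}
    (hΩ : IsOpen Ω) (hhol : DifferentiableOn ℂ hh Ω)
    (hstrip : ∀ t, ∀ s ∈ Icc (0 : ℝ) 1, γ t + s ∈ Ω) (hΦ : ∀ z, z ≠ p → Φ z = hh z / (z - p))
    (hleft : LeftOf γ (p - 1)) (hright : RightOf γ p) (hint : Integrable (pullback γ Φ))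
    (hint1 : Integrable (pullback γ fun z => Φ (z + 1)))
    (hlim : ∀ ε > 0, ∃ Y, ∀ t, ∀ s ∈ Icc (0 : ℝ) 1, Y ≤ |(γ t).im| → ‖Φ (γ t + s)‖ ≤ ε) :
    contourIntegral γ (fun z => Φ (z + 1)) - contourIntegral γ Φ = 2 * Real.pi * I * hh p := by
  obtain ⟨S, hS, -⟩ := hγ.piecewiseC1.exists_pieces
  obtain ⟨A, hA⟩ := hγ.exists_re_bound
  have hp : p ∈ Ω := by
    obtain ⟨t, ht⟩ := hγ.exists_im p.im
    have h1 := hright t ht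
    have h2 := hleft t (by simpa using ht)
    have e : p = γ t + ((p.re - (γ t).re : ℝ) : ℂ) := by
      apply Complex.ext <;> simp [ht]
    rw [e]
    simp only [Complex.sub_re, Complex.one_re] at h2
    exact hstrip t _ ⟨by linarith, by linarith⟩
  -- The part of `Φ` left after removing the pole, extended holomorphically over `p`.
  let rem := dslope hh p
  have hrem : DifferentiableOn ℂ rem Ω := (Complex.differentiableOn_dslope (hΩ.mem_nhds hp)).2 hhol
  have hΦrem : ∀ z, z ≠ p → Φ z = rem z + hh p / (z - p) := by
    intro z hz
    have : z - p ≠ 0 := sub_ne_zero.2 hz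
    rw [hΦ z hz, show rem z = slope hh p z from dslope_of_ne _ hz, slope_def_field]
    field_simp
    ring
  let K : ℂ → ℂ := fun v => ∫ s in (0 : ℝ)..1, rem (v + s)
  have hK : ∀ t, HasDerivAt K (rem (γ t + 1) - rem (γ t)) (γ t) := fun t =>
    hasDerivAt_integral_segment hΩ hrem (hstrip t)
  -- As `p - 1` is left of `C` and `p` is right of it, principal branches of both logarithms are
  -- holomorphic near `C`.
  have hs1 : ∀ t, γ t - p + 1 ∈ Complex.slitPlane := by
    intro t
    rw [Complex.mem_slitPlane_iff]
    by_cases h : (γ t).im = p.im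
    · left
      have := hleft t (by simpa using h)
      simp at this ⊢
      linarith
    · right
      simpa [sub_eq_zero] using h
  have hs2 : ∀ t, -(γ t - p) ∈ Complex.slitPlane := by
    intro t
    rw [Complex.mem_slitPlane_iff]
    by_cases h : (γ t).im = p.im
    · left
      have := hright t h
      simpa using this
    · right
      simpa [sub_eq_zero, eq_comm] using h
  let B : ℂ → ℂ := fun z => hh p * (Complex.log (z - p + 1) - Complex.log (-(z - p))) + K z
  have hB : ∀ t, HasDerivAt B (Φ (γ t + 1) - Φ (γ t)) (γ t) := by
    intro t
    have hid : HasDerivAt (fun z : ℂ => z - p) 1 (γ t) := (hasDerivAt_id _).sub_const p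
    have h1 := (((hid.add_const 1).clog (hs1 t)).sub (hid.neg.clog (hs2 t))).const_mul (hh p)
    refine (h1.add (hK t)).congr_deriv ?_
    have n1 := Complex.slitPlane_ne_zero (hs1 t)
    have n2 : γ t - p ≠ 0 := neg_ne_zero.1 (Complex.slitPlane_ne_zero (hs2 t))
    rw [hΦrem (γ t + 1) (fun h => n1 (by rw [← h]; ring)), hΦrem (γ t) (sub_ne_zero.1 n2),
      show γ t + 1 - p = γ t - p + 1 by ring]
    simp only [Pi.neg_apply]
    field_simp
    ring
  have hBγ : Continuous fun t => B (γ t) := continuous_iff_continuousAt.2 fun t =>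
    (hB t).continuousAt.comp_of_eq hγ.continuous.continuousAt rfl
  have hd : ∀ t ∉ S, HasDerivAt (fun t => B (γ t))
      (pullback γ (fun z => Φ (z + 1)) t - pullback γ Φ t) t := by
    intro t ht
    exact ((hB t).comp_of_eq t (hS t ht).hasDerivAt rfl).congr_deriv (sub_mul _ _ _)
  have hIN : ∀ a b : ℝ, ∫ t in a..b, (pullback γ (fun z => Φ (z + 1)) t - pullback γ Φ t) =
      B (γ b) - B (γ a) := fun a b =>
    integral_eq_of_hasDerivAt_off_countable (fun t => B (γ t)) _ S.countable_toSet
      hBγ.continuousOn (fun t ht => hd t (by simpa using ht.2))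
      (hint1.sub hint).intervalIntegrable
  have hKlim : ∀ l : Filter ℝ, Tendsto (fun t => |(γ t).im|) l atTop →
      Tendsto (fun t => K (γ t)) l (𝓝 0) := by
    intro l hl
    rw [Metric.tendsto_nhds]
    intro ε hε
    obtain ⟨Y, hY⟩ := hlim (ε / 4) (by positivity)
    filter_upwards [hl.eventually_ge_atTop Y,
      hl.eventually_ge_atTop (|p.im| + (‖hh p‖ / (ε / 4) + 1))] with t h1 h2
    have hb : ‖K (γ t)‖ ≤ (ε / 4 + ε / 4) * |1 - 0| := by
      refine intervalIntegral.norm_integral_le_of_norm_le_const fun s hs => ?_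
      rw [uIoc_of_le zero_le_one] at hs
      have him : ‖hh p‖ / (ε / 4) + 1 ≤ ‖γ t + s - p‖ := by
        have h3 := Complex.abs_im_le_norm (γ t + s - p)
        have h4 := abs_sub_abs_le_abs_sub (γ t).im p.im
        simp only [Complex.sub_im, Complex.add_im, Complex.ofReal_im, add_zero] at h3
        linarith
      have hpos : 0 < ‖γ t + s - p‖ := lt_of_lt_of_le (by positivity) him
      have hne : γ t + s ≠ p := fun h => by rw [h, sub_self, norm_zero] at hpos; exact hpos.false
      have e : rem (γ t + s) = Φ (γ t + s) - hh p / (γ t + s - p) := by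
        rw [hΦrem _ hne]; ring
      rw [e]
      refine (norm_sub_le _ _).trans (add_le_add (hY t s ⟨hs.1.le, hs.2⟩ h1) ?_)
      rw [norm_div, div_le_iff₀ hpos]
      have h5 : ‖hh p‖ / (ε / 4) ≤ ‖γ t + s - p‖ := by linarith
      rwa [div_le_iff₀ (by positivity), mul_comm] at h5
    rw [dist_zero_right]
    refine hb.trans_lt ?_
    rw [sub_zero, abs_one]
    linarith
  have hre : ∀ t, |(γ t - p).re| ≤ A + |p.re| := fun t => by
    rw [Complex.sub_re]
    exact (abs_sub _ _).trans (by linarith [hA t])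
  have htop : Tendsto (fun t => B (γ t)) atTop (𝓝 (hh p * (Real.pi * I) + 0)) := by
    refine ((tendsto_log_add_one_sub_log_neg hre ?_).const_mul (hh p)).add (hKlim _ ?_)
    · simp only [Complex.sub_im]
      exact tendsto_atTop_add_const_right _ _ hγ.tendsto_im_atTop
    · exact tendsto_abs_atTop_atTop.comp hγ.tendsto_im_atTop
  have hbot : Tendsto (fun t => B (γ t)) atBot (𝓝 (hh p * (-(Real.pi * I)) + 0)) := by
    refine ((tendsto_log_add_one_sub_log_neg' hre ?_).const_mul (hh p)).add (hKlim _ ?_)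
    · simp only [Complex.sub_im]
      exact tendsto_atBot_add_const_right _ _ hγ.tendsto_im_atBot
    · exact tendsto_abs_atBot_atTop.comp hγ.tendsto_im_atBot
  have hI := intervalIntegral_tendsto_integral (hint1.sub hint) tendsto_neg_atTop_atBot tendsto_id
  have hI' := htop.sub (hbot.comp tendsto_neg_atTop_atBot)
  have := tendsto_nhds_unique hI (hI'.congr fun N => (hIN _ _).symm)
  rw [contourIntegral, contourIntegral, ← integral_sub hint1 hint]
  refine this.trans ?_
  ring

end Residue

end DicyclicTrace

namespace DicyclicTrace

open Filter Topology Bornology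

/-! ### The poles of the weights and the shift relation of the integrals. -/

section Weight

set_option linter.unusedSectionVars false

variable {m : ℕ} [NeZero m] (c : ZMod (2 * m) → ℂ)

theorem expDiv_ne_zero (n : ℕ) (z : ℂ) : expDiv n z ≠ 0 := Complex.exp_ne_zero _

theorem expDiv_eq_iff {n : ℕ} (hn : n ≠ 0) {z w : ℂ} :
    expDiv n z = expDiv n w ↔ ∃ k : ℤ, z = w + n * k := by
  have hn' : (n : ℂ) ≠ 0 := Nat.cast_ne_zero.2 hn
  have h2 : 2 * (Real.pi : ℂ) * I ≠ 0 := Complex.two_pi_I_ne_zero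
  rw [expDiv, expDiv, Complex.exp_eq_exp_iff_exists_int]
  refine exists_congr fun k => ?_
  rw [show 2 * (Real.pi : ℂ) * I / n * w + k * (2 * Real.pi * I) =
    2 * Real.pi * I / n * (w + n * k) by field_simp]
  exact mul_right_inj' (div_ne_zero h2 hn')

/-- The roots of `𝐏`. -/
def rho (q : ℤ) : ℂ := expDiv (2 * m) (alpha c q - (q : ℂ) - 1 / 2)

theorem rho_congr {p q : ℤ} (h : (p : ZMod (2 * m)) = q) : rho c p = rho c q := by
  rw [rho, rho, alpha_congr (c := c) h, expDiv_eq_iff (NeZero.ne _)]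
  obtain ⟨k, hk⟩ := (ZMod.intCast_eq_intCast_iff_dvd_sub _ _ _).1 h
  refine ⟨k, ?_⟩
  have : (q : ℂ) = p + (2 * m : ℕ) * k := by
    rw [eq_add_of_sub_eq' hk]
    push_cast
    ring
  rw [this]
  ring

theorem bP_eq_nodal : bP c = Lagrange.nodal (Finset.range (2 * m)) fun q : ℕ => rho c q := rfl

theorem eval_bP_rho (q : ℤ) : (bP c).eval (rho c q) = 0 := by
  have h : rho c q = rho c (((q : ZMod (2 * m)).val : ℕ) : ℤ) := by
    apply rho_congr
    simp
  rw [h, bP_eq_nodal]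
  exact Lagrange.eval_nodal_at_node (v := fun q : ℕ => rho c q) (Finset.mem_range.2 (ZMod.val_lt (q : ZMod (2 * m))))

theorem eval_bP_eq_zero_iff {z : ℂ} : (bP c).eval (expDiv (2 * m) z) = 0 ↔
    ∃ j : ℤ, z = alpha c j - j - 1 / 2 := by
  constructor
  · intro h
    rw [bP_eq_nodal, Lagrange.eval_nodal, Finset.prod_eq_zero_iff] at h
    obtain ⟨q, -, hq⟩ := h
    obtain ⟨k, hk⟩ := (expDiv_eq_iff (NeZero.ne _)).1 (sub_eq_zero.1 hq)
    refine ⟨q - (2 * m : ℕ) * k, ?_⟩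
    have h := alpha_congr (c := c) (p := q - (2 * m : ℕ) * k) (q := q)
      (by rw [Int.cast_sub, Int.cast_mul, Int.cast_natCast (2 * m), ZMod.natCast_self]; simp)
    rw [h, hk]
    push_cast
    ring
  · rintro ⟨j, rfl⟩
    exact eval_bP_rho c j

theorem eval_zero_bP_ne_zero : (bP c).eval 0 ≠ 0 := by
  rw [bP_eq_nodal, Lagrange.eval_nodal, Finset.prod_ne_zero_iff]
  intro q _
  rw [zero_sub, neg_ne_zero]
  exact expDiv_ne_zero _ _

theorem natDegree_bP : (bP c).natDegree = 2 * m := by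
  rw [bP_eq_nodal, Lagrange.natDegree_nodal, Finset.card_range]

theorem w0_eq (G : ℂ[X]) (z : ℂ) : w0 c G z = expDiv (2 * m) z *
    (G.eval (expDiv (2 * m) z) / (bP c).eval (expDiv (2 * m) z)) := rfl

theorem expDiv_periodic (n : ℕ) (hn : n ≠ 0) (z : ℂ) (k : ℤ) :
    expDiv n (z - n * k) = expDiv n z :=
  (expDiv_eq_iff hn).2 ⟨-k, by push_cast; ring⟩

theorem wq_congr (G : ℂ[X]) {p q : ℤ} (h : (p : ZMod (2 * m)) = q) : wq c G p = wq c G q := by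
  funext z
  obtain ⟨k, hk⟩ := (ZMod.intCast_eq_intCast_iff_dvd_sub _ _ _).1 h
  have hq : z - (q : ℂ) = z - p - (2 * m : ℕ) * k := by
    rw [eq_add_of_sub_eq' hk]
    push_cast
    ring
  rw [wq, wq, w0_eq, w0_eq, hq, expDiv_periodic _ (NeZero.ne _)]

theorem exists_bound_wq {G : ℂ[X]} (hG : G.natDegree ≤ 2 * m - 2) (q : ℤ) (f : ℂ[X]) (A : ℝ) :
    ∃ K Y δ, 0 < K ∧ 0 < δ ∧ ∀ z : ℂ, |z.re| ≤ A → Y ≤ |z.im| →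
      ‖f.eval z * wq c G q z‖ ≤ K * Real.exp (-(δ * |z.im|)) := by
  have hm : 0 < m := NeZero.pos m
  obtain ⟨K, Y, δ, hK, hδ, h⟩ := exists_bound_weight (n := 2 * m) (by omega)
    (eval_zero_bP_ne_zero c) (G := G) (by rw [natDegree_bP]; omega) (f.comp (X + C (q : ℂ)))
    (A + |(q : ℝ)|)
  refine ⟨K, Y, δ, hK, hδ, fun z hre him => ?_⟩
  have := h (z - q) ?_ (by simpa using him)
  · simpa [wq, w0_eq] using this
  · rw [Complex.sub_re, Complex.intCast_re]
    exact (abs_sub _ _).trans (by linarith)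

variable {c} {γ : ℝ → ℂ}

theorem LeftOf.not_rightOf {α : ℤ → ℂ} (hγ : IsGoodContour α γ) {z : ℂ} (h : LeftOf γ z) :
    ¬ RightOf γ z := fun h' => by
  obtain ⟨t, ht⟩ := hγ.exists_im z.im
  exact lt_asymm (h t ht) (h' t ht)

theorem IsGoodContour.leftOf {α : ℤ → ℂ} (hγ : IsGoodContour α γ) (q : ℤ) {j : ℤ} (hj : j < 0) :
    LeftOf γ (α q + j + 1 / 2) := by
  obtain ⟨k, hk⟩ := Int.eq_ofNat_of_zero_le (neg_nonneg.2 hj.le)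
  obtain rfl : j = -(k : ℤ) := by omega
  have := hγ.left q k (by omega)
  simpa [sub_eq_add_neg] using this

theorem IsGoodContour.rightOf {α : ℤ → ℂ} (hγ : IsGoodContour α γ) (q : ℤ) {j : ℤ} (hj : 0 ≤ j) :
    RightOf γ (α q + j + 1 / 2) := by
  lift j to ℕ using hj
  simpa using hγ.right q j

/-- A nonzero integer difference would force one point to lie on both sides of `C`. Consequently the
roots of `𝐏` are simple. -/
theorem IsGoodContour.alpha_sub {α : ℤ → ℂ} (hγ : IsGoodContour α γ) {p q d : ℤ}
    (h : α p - α q = d) : d = 0 := by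
  rcases lt_trichotomy d 0 with hd | hd | hd
  · refine absurd (hγ.rightOf p (le_refl 0)) (LeftOf.not_rightOf hγ ?_)
    have := hγ.leftOf q hd
    rwa [← h, add_sub_cancel, ← add_zero (α p), ← Int.cast_zero] at this
  · exact hd
  · refine absurd (hγ.rightOf q (j := d - 1) (by omega)) (LeftOf.not_rightOf hγ ?_)
    have := hγ.leftOf p (j := -1) (by omega)
    rw [eq_add_of_sub_eq' h] at this
    convert this using 1
    push_cast
    ring

theorem IsGoodContour.rho_injective (hγ : IsGoodContour (alpha c) γ) {p q : ℤ}
    (h : rho c p = rho c q) : (p : ZMod (2 * m)) = q := by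
  obtain ⟨k, hk⟩ := (expDiv_eq_iff (NeZero.ne _)).1 h
  have := hγ.alpha_sub (p := p) (q := q) (d := p - q + (2 * m : ℕ) * k) (by
    push_cast at hk ⊢
    linear_combination hk)
  rw [ZMod.intCast_eq_intCast_iff_dvd_sub]
  exact ⟨k, by linarith⟩

theorem IsGoodContour.injOn_rho (hγ : IsGoodContour (alpha c) γ) :
    Set.InjOn (fun q : ℕ => rho c q) (Finset.range (2 * m)) := by
  intro p hp q hq h
  have := hγ.rho_injective h
  simp only [Int.cast_natCast] at this
  rw [ZMod.natCast_eq_natCast_iff'] at this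
  rwa [Nat.mod_eq_of_lt (by simpa using hp), Nat.mod_eq_of_lt (by simpa using hq)] at this

theorem IsGoodContour.eval_derivative_bP_ne_zero (hγ : IsGoodContour (alpha c) γ) (q : ℤ) :
    (derivative (bP c)).eval (rho c q) ≠ 0 := by
  have hsep : (bP c).Separable := separable_prod_X_sub_C_iff'.2 fun x hx y hy h =>
    hγ.injOn_rho hx hy h
  exact hsep.eval₂_derivative_ne_zero (RingHom.id ℂ) (x := rho c q) (eval_bP_rho c q)

/-- The candidates are `α_j + (q - j) + 1/2`. Those with `q < j` lie left of `C`; those with `q > j`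
lie right of `C + 1`, because subtracting `1` leaves them right of `C`. Only `j = q` is left in the
closed strip. -/
theorem IsGoodContour.eq_of_zero_on_strip (hγ : IsGoodContour (alpha c) γ) {t s : ℝ} {q : ℤ}
    (hs : s ∈ Icc (0 : ℝ) 1)
    (h : (bP c).eval (expDiv (2 * m) (γ t + s - ((q + 1 : ℤ) : ℂ))) = 0) :
    γ t + s = alpha c q + 1 / 2 := by
  obtain ⟨j, hj⟩ := (eval_bP_eq_zero_iff c).1 h
  have hz : γ t + s = alpha c j + ((q - j : ℤ) : ℂ) + 1 / 2 := by
    push_cast at hj ⊢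
    linear_combination hj
  have him : (γ t).im = (γ t + s).im := by simp
  rcases lt_trichotomy (q - j) 0 with hd | hd | hd
  · have h1 := hγ.leftOf j hd t (by rw [← hz]; exact him)
    rw [← hz] at h1
    simp at h1
    linarith [hs.1]
  · obtain rfl : q = j := by omega
    simpa using hz
  · have h1 := hγ.rightOf j (j := q - j - 1) (by omega) t (by
      rw [him, hz]; simp)
    have e : alpha c j + ((q - j - 1 : ℤ) : ℂ) + 1 / 2 = γ t + s - 1 := by
      rw [hz]; push_cast; ring
    rw [e] at h1
    simp at h1
    linarith [hs.2]

theorem IsGoodContour.eval_bP_ne_zero (hγ : IsGoodContour (alpha c) γ) (t : ℝ) (q : ℤ) :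
    (bP c).eval (expDiv (2 * m) (γ t - q)) ≠ 0 := by
  intro h
  have h1 := hγ.eq_of_zero_on_strip (t := t) (s := 0) (q := q - 1) (by simp) (by simpa using h)
  have h2 := hγ.rightOf (q - 1) (le_refl 0) t (by
    rw [Int.cast_zero, add_zero, ← h1]; simp)
  rw [Int.cast_zero, add_zero, ← h1] at h2
  simp at h2

theorem continuous_expDiv (n : ℕ) : Continuous (expDiv n) := by
  unfold expDiv
  fun_prop

theorem IsGoodContour.integrable_wq (hγ : IsGoodContour (alpha c) γ) {G : ℂ[X]}
    (hG : G.natDegree ≤ 2 * m - 2) (q : ℤ) (f : ℂ[X]) :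
    Integrable (pullback γ fun z => f.eval z * wq c G q z) := by
  obtain ⟨A, hA⟩ := hγ.exists_re_bound
  obtain ⟨K, Y, δ, -, hδ, h⟩ := exists_bound_wq c hG q f A
  refine hγ.integrable_pullback ?_ hδ fun t ht => h _ (hA t) ht
  have h1 : Continuous fun t => expDiv (2 * m) (γ t - q) :=
    (continuous_expDiv _).comp (hγ.continuous.sub continuous_const)
  refine (f.continuous.comp hγ.continuous).mul (h1.mul ?_)
  exact (G.continuous.comp h1).div ((bP c).continuous.comp h1) fun t => hγ.eval_bP_ne_zero t q

theorem hasDerivAt_expDiv (n : ℕ) (z : ℂ) :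
    HasDerivAt (expDiv n) (expDiv n z * (2 * Real.pi * I / n)) z := by
  have := ((hasDerivAt_id z).const_mul (2 * (Real.pi : ℂ) * I / n)).cexp
  exact this.congr_deriv (by simp [expDiv])

/-- The residue of `2 π i w_{q + 1}` at `α_q + 1 / 2`. -/
def residue (c : ZMod (2 * m) → ℂ) (G : ℂ[X]) (q : ℤ) : ℂ :=
  ((2 * m : ℕ) : ℂ) * G.eval (rho c q) / (derivative (bP c)).eval (rho c q)

/-- Since `w_q(z) = w_{q+1}(z + 1)`, the left side is the effect of shifting the contour for `f
w_{q+1}` across its one pole in the strip. -/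
theorem IsGoodContour.contourIntegral_shift (hγ : IsGoodContour (alpha c) γ) {G : ℂ[X]}
    (hG : G.natDegree ≤ 2 * m - 2) (q : ℤ) (f : ℂ[X]) :
    contourIntegral γ (fun z => (taylor 1 f).eval z * wq c G q z) -
      contourIntegral γ (fun z => f.eval z * wq c G (q + 1) z) =
      residue c G q * f.eval (alpha c q + 1 / 2) := by
  let p : ℂ := alpha c q + 1 / 2
  let U : ℂ → ℂ := fun z => expDiv (2 * m) (z - ((q + 1 : ℤ) : ℂ))
  have hUd : ∀ z, HasDerivAt U (U z * (2 * Real.pi * I / (2 * m : ℕ))) z := fun z =>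
    (hasDerivAt_expDiv (2 * m) (z - ((q + 1 : ℤ) : ℂ))).comp_sub_const _ _
  have hUp : U p = rho c q := by
    change expDiv _ _ = expDiv _ _
    congr 1
    push_cast
    ring
  let den : ℂ → ℂ := fun z => (bP c).eval (U z)
  have hdend : ∀ z, HasDerivAt den ((derivative (bP c)).eval (U z) *
      (U z * (2 * Real.pi * I / (2 * m : ℕ)))) z := fun z =>
    ((bP c).hasDerivAt (U z)).comp z (hUd z)
  have hdenp : den p = 0 := by
    change (bP c).eval (U p) = 0
    rw [hUp]
    exact eval_bP_rho c q
  let D := dslope den p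
  have hD : Differentiable ℂ D := by
    rw [← differentiableOn_univ]
    exact (Complex.differentiableOn_dslope univ_mem).2 fun z _ =>
      (hdend z).differentiableAt.differentiableWithinAt
  -- The factors `ρ_q` and `2 π i` here cancel against the numerator and the residue theorem,
  -- leaving `n G(ρ_q) / 𝐏'(ρ_q)`.
  have hDp : D p = (derivative (bP c)).eval (rho c q) *
      (rho c q * (2 * Real.pi * I / (2 * m : ℕ))) := by
    rw [show D p = deriv den p from dslope_same _ _, (hdend p).deriv, hUp]
  have hDne : ∀ z, z ≠ p → den z = (z - p) * D z := by
    intro z hz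
    have := sub_ne_zero.2 hz
    rw [show D z = slope den p z from dslope_of_ne _ hz, slope_def_field, hdenp]
    field_simp
    ring
  let hh : ℂ → ℂ := fun z => f.eval z * (U z * G.eval (U z)) / D z
  let Ω : Set ℂ := {z | D z ≠ 0}
  have hn : ((2 * m : ℕ) : ℂ) ≠ 0 := Nat.cast_ne_zero.2 (NeZero.ne _)
  have hP' := hγ.eval_derivative_bP_ne_zero q
  have hρ : rho c q ≠ 0 := expDiv_ne_zero _ _
  have hDp0 : D p ≠ 0 := by
    rw [hDp]
    exact mul_ne_zero hP' (mul_ne_zero hρ (div_ne_zero Complex.two_pi_I_ne_zero hn))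
  have hΩ : IsOpen Ω := isOpen_ne_fun hD.continuous continuous_const
  have hhol : DifferentiableOn ℂ hh Ω := by
    refine DifferentiableOn.div ?_ hD.differentiableOn fun z hz => hz
    have hU : Differentiable ℂ U := fun z => (hUd z).differentiableAt
    exact (f.differentiable.mul (hU.mul (G.differentiable.comp hU))).differentiableOn
  have hstrip : ∀ t, ∀ s ∈ Icc (0 : ℝ) 1, γ t + s ∈ Ω := by
    intro t s hs
    by_cases h : γ t + s = p
    · rw [h]; exact hDp0
    · intro h0
      refine h (hγ.eq_of_zero_on_strip hs ?_)
      change den _ = 0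
      rw [hDne _ h, h0, mul_zero]
  let Φ : ℂ → ℂ := fun z => f.eval z * wq c G (q + 1) z
  have hΦ : ∀ z, z ≠ p → Φ z = hh z / (z - p) := by
    intro z hz
    have h1 : Φ z = f.eval z * (U z * (G.eval (U z) / den z)) := rfl
    rw [h1, hDne z hz]
    simp only [hh, div_eq_mul_inv, mul_inv]
    ring
  have hΦ1 : (fun z => (taylor 1 f).eval z * wq c G q z) = fun z => Φ (z + 1) := by
    funext z
    simp only [Φ, taylor_eval, wq]
    congr 2
    push_cast
    ring
  rw [hΦ1, contourIntegral_shift_sub hγ hΩ hhol hstrip hΦ ?_ ?_ (hγ.integrable_wq hG _ _) ?_ ?_]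
  · simp only [hh, hDp, hUp, residue]
    have := Complex.two_pi_I_ne_zero
    change _ = _ * f.eval p
    field_simp
  · have := hγ.leftOf q (j := -1) (by omega)
    convert this using 1
    push_cast
    ring
  · have := hγ.rightOf q (le_refl 0)
    rwa [Int.cast_zero, add_zero] at this
  · rw [← hΦ1]
    exact hγ.integrable_wq hG _ _
  · intro ε hε
    obtain ⟨A, hA⟩ := hγ.exists_re_bound
    obtain ⟨K, Y, δ, hK, hδ, h⟩ := exists_bound_wq c hG (q + 1) f (A + 1)
    have hlim : Tendsto (fun y : ℝ => K * Real.exp (-(δ * y))) atTop (𝓝 (K * 0)) :=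
      (Real.tendsto_exp_neg_atTop_nhds_zero.comp (tendsto_id.const_mul_atTop hδ)).const_mul K
    rw [mul_zero] at hlim
    obtain ⟨Y', hY'⟩ := (hlim.eventually_le_const hε).exists_forall_of_atTop
    refine ⟨max Y Y', fun t s hs ht => ?_⟩
    have him : (γ t + s).im = (γ t).im := by simp
    have h1 := h (γ t + s) ?_ (by rw [him]; exact (le_max_left _ _).trans ht)
    · rw [him] at h1
      exact h1.trans (hY' _ ((le_max_right _ _).trans ht))
    · rw [Complex.add_re, Complex.ofReal_re]
      refine (abs_add_le _ _).trans (add_le_add (hA t) ?_)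
      rw [abs_of_nonneg hs.1]
      exact hs.2

end Weight

end DicyclicTrace

namespace DicyclicTrace

/-! ### Inversion symmetry of `𝐏`, palindromic `G` and interpolation of residues. -/

section Symmetry

set_option linter.unusedSectionVars false

variable {m : ℕ} [NeZero m] {c : ZMod (2 * m) → ℂ} {γ : ℝ → ℂ}

theorem rho_neg (hc0 : c 0 ≠ 0) (hc : ∀ i, c (-i) = c i) (q : ℤ) :
    rho c (-q - 1) = (rho c q)⁻¹ := by
  have h := alpha_neg hc0 hc (q + 1)
  rw [add_sub_cancel_right] at h
  rw [rho, rho, expDiv, expDiv, ← Complex.exp_neg, show -q - 1 = -(q + 1) by ring, h]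
  congr 1
  push_cast
  ring

/-- A root equal to its inverse would give `-q - 1 = q` modulo `2 m`, which parity excludes. -/
theorem IsGoodContour.rho_ne_one (hγ : IsGoodContour (alpha c) γ) (hc0 : c 0 ≠ 0)
    (hc : ∀ i, c (-i) = c i) (q : ℤ) : rho c q ≠ 1 := by
  intro h
  have h1 : rho c (-q - 1) = rho c q := by rw [rho_neg hc0 hc, h, inv_one]
  have h2 := hγ.rho_injective h1
  obtain ⟨k, hk⟩ := (ZMod.intCast_eq_intCast_iff_dvd_sub _ _ _).1 h2
  push_cast at hk
  rw [mul_assoc] at hk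
  omega

theorem prod_rho_mul_eval_bP (hc0 : c 0 ≠ 0) (hc : ∀ i, c (-i) = c i) {z : ℂ} (hz : z ≠ 0) :
    (∏ q ∈ Finset.range (2 * m), rho c q) * (z ^ (2 * m) * (bP c).eval z⁻¹) = (bP c).eval z := by
  rw [bP_eq_nodal, Lagrange.eval_nodal, Lagrange.eval_nodal,
    ← Finset.prod_range_reflect (fun q : ℕ => z⁻¹ - rho c q),
    show z ^ (2 * m) = ∏ q ∈ Finset.range (2 * m), -z by
      rw [Finset.prod_const, Finset.card_range, (even_two_mul m).neg_pow],
    ← Finset.prod_mul_distrib, ← Finset.prod_mul_distrib]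
  refine Finset.prod_congr rfl fun q hq => ?_
  have e : rho c ((2 * m - 1 - q : ℕ) : ℤ) = (rho c q)⁻¹ := by
    rw [← rho_neg hc0 hc]
    apply rho_congr
    have hq' := Finset.mem_range.1 hq
    rw [Nat.cast_sub (by omega), Nat.cast_sub (by omega)]
    push_cast
    have h0 : (2 * m : ZMod (2 * m)) = 0 := by
      have := ZMod.natCast_self (2 * m)
      push_cast at this
      exact this
    rw [h0]
    ring
  have hρ : rho c q ≠ 0 := expDiv_ne_zero _ _
  rw [e]
  field_simp
  ring

/-- The roots are closed under inversion, so this holds up to the product of the roots. Evaluating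
at `1`, where `𝐏` does not vanish, shows that product to be `1`. -/
theorem IsGoodContour.eval_bP_inv (hγ : IsGoodContour (alpha c) γ) (hc0 : c 0 ≠ 0)
    (hc : ∀ i, c (-i) = c i) {z : ℂ} (hz : z ≠ 0) :
    z ^ (2 * m) * (bP c).eval z⁻¹ = (bP c).eval z := by
  have h1 : (bP c).eval 1 ≠ 0 := by
    rw [bP_eq_nodal, Lagrange.eval_nodal, Finset.prod_ne_zero_iff]
    exact fun q _ => sub_ne_zero.2 (hγ.rho_ne_one hc0 hc q).symm
  have h2 := prod_rho_mul_eval_bP (c := c) hc0 hc one_ne_zero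
  rw [inv_one, one_pow, one_mul] at h2
  have h3 := prod_rho_mul_eval_bP hc0 hc hz
  rwa [mul_eq_right₀ h1 |>.1 h2, one_mul] at h3

/-- Differentiate `eval_bP_inv` at a root: the term with `𝐏(ρ⁻¹)` drops out because `ρ⁻¹` is also a
root. -/
theorem IsGoodContour.eval_derivative_bP_inv (hγ : IsGoodContour (alpha c) γ) (hc0 : c 0 ≠ 0)
    (hc : ∀ i, c (-i) = c i) (q : ℤ) :
    (derivative (bP c)).eval (rho c q) =
      -(rho c q ^ (2 * m - 2) * (derivative (bP c)).eval (rho c q)⁻¹) := by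
  have hρ : rho c q ≠ 0 := expDiv_ne_zero _ _
  have h1 := (hasDerivAt_pow (2 * m) (rho c q)).mul
    (((bP c).hasDerivAt (rho c q)⁻¹).comp (rho c q) (hasDerivAt_inv hρ))
  have h2 : HasDerivAt (fun z => z ^ (2 * m) * (bP c).eval z⁻¹)
      ((derivative (bP c)).eval (rho c q)) (rho c q) := by
    refine ((bP c).hasDerivAt (rho c q)).congr_of_eventuallyEq ?_
    filter_upwards [isOpen_ne.mem_nhds hρ] with z hz
    exact hγ.eval_bP_inv hc0 hc hz
  have h3 := h2.unique h1
  simp only [Function.comp_apply] at h3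
  rw [← rho_neg hc0 hc q, eval_bP_rho, rho_neg hc0 hc q, mul_zero, zero_add] at h3
  have hm : 0 < m := NeZero.pos m
  have e : rho c q ^ (2 * m) = rho c q ^ (2 * m - 2) * rho c q ^ 2 := by
    rw [← pow_add]
    congr 1
    omega
  rw [h3, e]
  field_simp

theorem residue_congr {p q : ℤ} (h : (p : ZMod (2 * m)) = q) (G : ℂ[X]) :
    residue c G p = residue c G q := by
  rw [residue, residue, rho_congr (c := c) h]

theorem IsGoodContour.eval_rho_eq (hγ : IsGoodContour (alpha c) γ) (G : ℂ[X]) (q : ℤ) :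
    G.eval (rho c q) =
      residue c G q * (derivative (bP c)).eval (rho c q) / ((2 * m : ℕ) : ℂ) := by
  have hn : ((2 * m : ℕ) : ℂ) ≠ 0 := Nat.cast_ne_zero.2 (NeZero.ne _)
  have hP' := hγ.eval_derivative_bP_ne_zero q
  rw [residue]
  field_simp

theorem IsGoodContour.ext_of_residue (hγ : IsGoodContour (alpha c) γ) {G G' : ℂ[X]}
    (hG : G.natDegree ≤ 2 * m - 2) (hG' : G'.natDegree ≤ 2 * m - 2)
    (h : ∀ q : ℤ, residue c G q = residue c G' q) : G = G' := by
  have hm : 0 < m := NeZero.pos m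
  have hlt : ∀ F : ℂ[X], F.natDegree ≤ 2 * m - 2 →
      F.degree < (Finset.range (2 * m)).card := by
    intro F hF
    rw [Finset.card_range]
    exact (degree_le_of_natDegree_le hF).trans_lt (Nat.cast_lt.2 (by omega))
  refine Polynomial.eq_of_degrees_lt_of_eval_index_eq _ hγ.injOn_rho (hlt G hG) (hlt G' hG') ?_
  intro q _
  rw [hγ.eval_rho_eq, hγ.eval_rho_eq G', h]

theorem eval_reflect {N : ℕ} {G : ℂ[X]} (hG : G.natDegree ≤ N) {z : ℂ} (hz : z ≠ 0) :
    (reflect N G).eval z = z ^ N * G.eval z⁻¹ := by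
  let _ := invertibleOfNonzero (inv_ne_zero hz)
  have h := eval₂_reflect_mul_pow (RingHom.id ℂ) z⁻¹ N G hG
  rw [invOf_eq_inv, inv_inv] at h
  change (reflect N G).eval z * _ = G.eval z⁻¹ at h
  rw [← h, mul_left_comm, ← mul_pow, mul_inv_cancel₀ hz, one_pow, mul_one]

/-- The powers of `ρ` in numerator and denominator cancel and the minus sign of the derivative
remains. With `ext_of_residue` it makes palindromy equivalent to antisymmetry of the residues. -/
theorem IsGoodContour.residue_reflect (hγ : IsGoodContour (alpha c) γ) (hc0 : c 0 ≠ 0)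
    (hc : ∀ i, c (-i) = c i) {G : ℂ[X]} (hG : G.natDegree ≤ 2 * m - 2) (q : ℤ) :
    residue c (reflect (2 * m - 2) G) q = -residue c G (-q - 1) := by
  have hρ : rho c q ≠ 0 := expDiv_ne_zero _ _
  have hP := hγ.eval_derivative_bP_ne_zero (-q - 1)
  rw [rho_neg hc0 hc] at hP
  rw [residue, residue, rho_neg hc0 hc, eval_reflect hG hρ, hγ.eval_derivative_bP_inv hc0 hc]
  field_simp

theorem IsPalindromic.reflect_eq {G : ℂ[X]} (hG : IsPalindromic m G) :
    reflect (2 * m - 2) G = G := by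
  refine Polynomial.eq_of_infinite_eval_eq _ _ ((Set.finite_singleton (0 : ℂ)).infinite_compl.mono ?_)
  intro z hz
  exact (eval_reflect hG.1 hz).trans (hG.2 z hz).symm

theorem IsGoodContour.residue_neg (hγ : IsGoodContour (alpha c) γ) (hc0 : c 0 ≠ 0)
    (hc : ∀ i, c (-i) = c i) {G : ℂ[X]} (hG : IsPalindromic m G) (q : ℤ) :
    residue c G q = -residue c G (-q - 1) := by
  rw [← hγ.residue_reflect hc0 hc hG.1, hG.reflect_eq]

theorem IsGoodContour.isPalindromic (hγ : IsGoodContour (alpha c) γ) (hc0 : c 0 ≠ 0)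
    (hc : ∀ i, c (-i) = c i) {G : ℂ[X]} (hG : G.natDegree ≤ 2 * m - 2)
    (h : ∀ q : ℤ, residue c G q = -residue c G (-q - 1)) : IsPalindromic m G := by
  have e : reflect (2 * m - 2) G = G := by
    refine hγ.ext_of_residue ?_ hG fun q => ?_
    · refine natDegree_le_iff_coeff_eq_zero.2 fun i hi => ?_
      rw [coeff_reflect, revAt_eq_self_of_lt hi]
      exact coeff_eq_zero_of_natDegree_lt (hG.trans_lt hi)
    · rw [hγ.residue_reflect hc0 hc hG, ← h]
  refine ⟨hG, fun z hz => ?_⟩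
  rw [← eval_reflect hG hz, e]

/-- Lagrange interpolation gives degree at most `n - 1`. The coefficient of `X^{n-1}` is `∑ G(ρ_q) /
𝐏'(ρ_q)`, a multiple of the sum of the residues, and hence zero. -/
theorem IsGoodContour.exists_residue (hγ : IsGoodContour (alpha c) γ) {κ : ℤ → ℂ}
    (hκ : ∀ p q : ℤ, (p : ZMod (2 * m)) = q → κ p = κ q)
    (hsum : ∑ q ∈ Finset.range (2 * m), κ q = 0) :
    ∃ G : ℂ[X], G.natDegree ≤ 2 * m - 2 ∧ ∀ q, residue c G q = κ q := by
  have hm : 0 < m := NeZero.pos m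
  have hn : ((2 * m : ℕ) : ℂ) ≠ 0 := Nat.cast_ne_zero.2 (NeZero.ne _)
  let r : ℕ → ℂ := fun q => κ q * (derivative (bP c)).eval (rho c q) / ((2 * m : ℕ) : ℂ)
  let G := Lagrange.interpolate (Finset.range (2 * m)) (fun q : ℕ => rho c q) r
  have hdeg : G.degree < (Finset.range (2 * m)).card :=
    Lagrange.degree_interpolate_lt _ hγ.injOn_rho
  have heval : ∀ q ∈ Finset.range (2 * m), G.eval (rho c (q : ℕ)) = r q := fun q hq =>
    Lagrange.eval_interpolate_at_node (v := fun q : ℕ => rho c q) r hγ.injOn_rho hq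
  refine ⟨G, ?_, fun q => ?_⟩
  · have h0 : G.coeff (2 * m - 1) = 0 := by
      have h := Lagrange.coeff_eq_sum hγ.injOn_rho hdeg
      rw [Finset.card_range] at h
      rw [h]
      calc _ = ∑ q ∈ Finset.range (2 * m), κ q / ((2 * m : ℕ) : ℂ) := by
            refine Finset.sum_congr rfl fun q hq => ?_
            have h1 : (derivative (bP c)).eval (rho c q) =
                ∏ j ∈ (Finset.range (2 * m)).erase q, (rho c q - rho c j) := by
              rw [bP_eq_nodal, Lagrange.eval_nodal_derivative_eval_node_eq
                (v := fun q : ℕ => rho c q) hq, Lagrange.eval_nodal]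
            have h2 := hγ.eval_derivative_bP_ne_zero q
            rw [heval q hq, ← h1]
            simp only [r]
            field_simp
        _ = 0 := by rw [← Finset.sum_div, hsum, zero_div]
    rw [Finset.card_range] at hdeg
    refine natDegree_le_iff_coeff_eq_zero.2 fun i hi => ?_
    rcases (show i = 2 * m - 1 ∨ 2 * m ≤ i by omega) with rfl | hi'
    · exact h0
    · exact coeff_eq_zero_of_degree_lt (hdeg.trans_le (Nat.cast_le.2 hi'))
  · have hq : (((q : ZMod (2 * m)).val : ℤ) : ZMod (2 * m)) = q := by simp
    rw [← residue_congr hq, ← hκ _ _ hq, residue,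
      heval _ (Finset.mem_range.2 (ZMod.val_lt (q : ZMod (2 * m))))]
    have h2 := hγ.eval_derivative_bP_ne_zero (c := c) ((q : ZMod (2 * m)).val : ℤ)
    simp only [r]
    field_simp

end Symmetry

end DicyclicTrace

namespace DicyclicTrace

/-! ### Matching traces with contour integrals and class values. -/

section Moments

set_option maxSynthPendingDepth 4
set_option linter.unusedSectionVars false

variable {m : ℕ} [NeZero m] {c : ZMod (2 * m) → ℂ} {γ : ℝ → ℂ} {T : H c →ₗ[ℂ] ℂ}

/-! ### Families of functionals -/

/-- As `L_q` is `c_0` times `X - (α_q + 1/2)` translated by one, the hypothesis says that the left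
side kills multiples of `X - (α_q + 1/2)`. It is thus a multiple of evaluation at that point, and `f
= 1` gives the factor. -/
theorem shift_of_lin_shift (hc0 : c 0 ≠ 0) {J : ℤ → ℂ[X] →ₗ[ℂ] ℂ}
    (h : ∀ (q : ℤ) (R : ℂ[X]), J q (lin c q * R) = J (q + 1) (taylor (-1) (lin c q * R)))
    (q : ℤ) (f : ℂ[X]) : J q (taylor 1 f) - J (q + 1) f =
      (J q 1 - J (q + 1) 1) * f.eval (alpha c q + 1 / 2) := by
  obtain ⟨R, hR⟩ := X_sub_C_dvd_sub_C_eval (a := alpha c q + 1 / 2) (p := f)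
  have hf : f = (X - C (alpha c q + 1 / 2)) * R + f.eval (alpha c q + 1 / 2) • 1 := by
    rw [← hR, smul_eq_C_mul]
    ring
  have e : taylor 1 ((X - C (alpha c q + 1 / 2)) * R) = lin c q * (C (c 0)⁻¹ * taylor 1 R) := by
    rw [taylor_mul, map_sub, taylor_X, taylor_C, lin]
    have h1 : C (c 0) * C (c 0)⁻¹ = 1 := by rw [← C_mul, mul_inv_cancel₀ hc0, C_1]
    have h2 : X + C 1 - C (alpha c q + 1 / 2) = X + C (1 / 2 - alpha c q) := by
      rw [add_sub_assoc, ← C_sub]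
      congr 2
      ring
    rw [h2]
    linear_combination -(X + C (1 / 2 - alpha c q)) * taylor 1 R * h1
  have h3 := h q (C (c 0)⁻¹ * taylor 1 R)
  rw [← e, taylor_taylor, neg_add_cancel, taylor_zero] at h3
  generalize f.eval (alpha c q + 1 / 2) = v at hf ⊢
  generalize (X - C (alpha c q + 1 / 2)) * R = g at hf h3
  rw [hf]
  simp only [map_add, map_smul, taylor_one, C_1, h3, smul_eq_mul]
  ring

theorem lin_shift_of_shift {J : ℤ → ℂ[X] →ₗ[ℂ] ℂ} {κ : ℤ → ℂ}
    (h : ∀ (q : ℤ) (f : ℂ[X]),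
      J q (taylor 1 f) - J (q + 1) f = κ q * f.eval (alpha c q + 1 / 2))
    (q : ℤ) (R : ℂ[X]) : J q (lin c q * R) = J (q + 1) (taylor (-1) (lin c q * R)) := by
  have h1 := h q (taylor (-1) (lin c q * R))
  rw [taylor_taylor, add_neg_cancel, taylor_zero, taylor_eval, eval_mul] at h1
  have h2 : (lin c q).eval (alpha c q + 1 / 2 + -1) = 0 := by
    simp only [lin, eval_mul, eval_add, eval_X, eval_C]
    ring
  simp only [h2, zero_mul, mul_zero, sub_eq_zero] at h1
  exact h1

/-- The family obtained by reflecting `q` and the variable. -/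
def reflectFamily (J : ℤ → ℂ[X] →ₗ[ℂ] ℂ) (q : ℤ) : ℂ[X] →ₗ[ℂ] ℂ :=
  J (-q) ∘ₗ (aeval (-X : ℂ[X])).toLinearMap

theorem reflectFamily_apply (J : ℤ → ℂ[X] →ₗ[ℂ] ℂ) (q : ℤ) (R : ℂ[X]) :
    reflectFamily J q R = J (-q) (R.comp (-X)) := rfl

theorem reflectFamily_shift (hc0 : c 0 ≠ 0) (hc : ∀ i, c (-i) = c i) {J : ℤ → ℂ[X] →ₗ[ℂ] ℂ}
    {κ : ℤ → ℂ} (h : ∀ (q : ℤ) (f : ℂ[X]),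
      J q (taylor 1 f) - J (q + 1) f = κ q * f.eval (alpha c q + 1 / 2))
    (q : ℤ) (f : ℂ[X]) : reflectFamily J q (taylor 1 f) - reflectFamily J (q + 1) f =
      -κ (-q - 1) * f.eval (alpha c q + 1 / 2) := by
  have h1 := h (-q - 1) ((taylor 1 f).comp (-X))
  have ha := alpha_neg hc0 hc (q + 1)
  rw [add_sub_cancel_right, neg_add, ← sub_eq_add_neg] at ha
  have e : taylor 1 ((taylor 1 f).comp (-X)) = f.comp (-X) := by
    rw [taylor_apply, taylor_apply, comp_assoc, comp_assoc]
    congr 1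
    simp
  rw [e, sub_add_cancel, ha, eval_comp, taylor_eval] at h1
  rw [reflectFamily_apply, reflectFamily_apply, neg_add, ← sub_eq_add_neg]
  have e2 : eval (-alpha c q + 1 / 2) (-X : ℂ[X]) + 1 = alpha c q + 1 / 2 := by
    rw [eval_neg, eval_X]; ring
  rw [e2] at h1
  linear_combination -h1

/-- The functionals `R ↦ ∫_C R(z) w_q(z) dz`. -/
def moment (hγ : IsGoodContour (alpha c) γ) {G : ℂ[X]} (hG : G.natDegree ≤ 2 * m - 2) (q : ℤ) :
    ℂ[X] →ₗ[ℂ] ℂ where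
  toFun R := contourIntegral γ fun z => R.eval z * wq c G q z
  map_add' R S := by
    rw [contourIntegral, contourIntegral, contourIntegral,
      ← integral_add (hγ.integrable_wq hG q R) (hγ.integrable_wq hG q S)]
    congr 1
    funext t
    simp only [pullback, eval_add]
    ring
  map_smul' a R := by
    rw [contourIntegral, contourIntegral, RingHom.id_apply, ← integral_smul]
    congr 1
    funext t
    simp only [pullback, eval_smul, smul_eq_mul]
    ring

theorem moment_apply (hγ : IsGoodContour (alpha c) γ) {G : ℂ[X]} (hG : G.natDegree ≤ 2 * m - 2)
    (q : ℤ) (R : ℂ[X]) :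
    moment hγ hG q R = contourIntegral γ fun z => R.eval z * wq c G q z := rfl

theorem moment_congr (hγ : IsGoodContour (alpha c) γ) {G : ℂ[X]} (hG : G.natDegree ≤ 2 * m - 2)
    {p q : ℤ} (h : (p : ZMod (2 * m)) = q) : moment hγ hG p = moment hγ hG q := by
  refine LinearMap.ext fun R => ?_
  rw [moment_apply, moment_apply, wq_congr c G h]

theorem moment_shift (hγ : IsGoodContour (alpha c) γ) {G : ℂ[X]} (hG : G.natDegree ≤ 2 * m - 2)
    (q : ℤ) (f : ℂ[X]) : moment hγ hG q (taylor 1 f) - moment hγ hG (q + 1) f =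
      residue c G q * f.eval (alpha c q + 1 / 2) :=
  hγ.contourIntegral_shift hG q f

theorem intCast_add_period (q : ℤ) : ((q + (2 * m : ℕ) : ℤ) : ZMod (2 * m)) = q := by
  rw [Int.cast_add, Int.cast_natCast (2 * m), ZMod.natCast_self, add_zero]

/-- Both families have the same shift defects, by the antisymmetry of the residues, so they agree
without a change of variables in the integral. -/
theorem moment_reflect (hc0 : c 0 ≠ 0) (hc : ∀ i, c (-i) = c i)
    (hγ : IsGoodContour (alpha c) γ) {G : ℂ[X]} (hG : IsPalindromic m G) :
    reflectFamily (moment hγ hG.1) = moment hγ hG.1 := by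
  refine family_ext (NeZero.ne (2 * m)) (fun q => ?_)
    (fun q => moment_congr hγ hG.1 (intCast_add_period q)) (fun q f => ?_) (moment_shift hγ hG.1)
  · refine LinearMap.ext fun R => ?_
    rw [reflectFamily_apply, reflectFamily_apply, moment_congr hγ hG.1 (p := -(q + _)) (q := -q)]
    rw [Int.cast_neg, intCast_add_period, Int.cast_neg]
  · rw [reflectFamily_shift hc0 hc (moment_shift hγ hG.1), ← hγ.residue_neg hc0 hc hG]

/-- The functionals `R ↦ T(R(k) e_q)`. -/
def traceFamily (T : H c →ₗ[ℂ] ℂ) (q : ℤ) : ℂ[X] →ₗ[ℂ] ℂ :=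
  T ∘ₗ LinearMap.mulRight ℂ (eH c q) ∘ₗ (aeval (kH c)).toLinearMap

theorem traceFamily_apply (T : H c →ₗ[ℂ] ℂ) (q : ℤ) (R : ℂ[X]) :
    traceFamily T q R = T (kp c R * eH c q) := rfl

theorem traceFamily_congr (T : H c →ₗ[ℂ] ℂ) {p q : ℤ} (h : (p : ZMod (2 * m)) = q) :
    traceFamily T p = traceFamily T q := by
  rw [traceFamily, traceFamily, eH_congr h]

theorem traceFamily_one_neg (hT : IsTrace c T) (q : ℤ) :
    traceFamily T (-q) 1 = traceFamily T q 1 := by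
  have h := isTrace_inv hT (hGen m) (kp c 1 * eH c q)
  rw [kp_one, one_mul, h_mul_e, mul_assoc, grp_mul_inv, mul_one] at h
  rw [traceFamily_apply, traceFamily_apply, kp_one, one_mul, one_mul, h]

theorem hasIntegralFormula_iff (hγ : IsGoodContour (alpha c) γ) {G : ℂ[X]}
    (hG : G.natDegree ≤ 2 * m - 2) :
    HasIntegralFormula c γ G T ↔ traceFamily T = moment hγ hG :=
  ⟨fun h => funext fun q => LinearMap.ext fun R => h q R,
    fun h q R => LinearMap.congr_fun (congrFun h q) R⟩

/-- The shift relation at `f = 1`; it recovers the residues, and so `G`, from `T`. -/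
theorem HasIntegralFormula.residue_eq (hγ : IsGoodContour (alpha c) γ) {G : ℂ[X]}
    (hG : G.natDegree ≤ 2 * m - 2) (h : HasIntegralFormula c γ G T) (q : ℤ) :
    residue c G q = traceFamily T q 1 - traceFamily T (q + 1) 1 := by
  have h1 := moment_shift hγ hG q 1
  rw [(hasIntegralFormula_iff hγ hG).1 h]
  simpa using h1.symm

theorem IsTrace.exists_integralFormula (hc0 : c 0 ≠ 0) (hc : ∀ i, c (-i) = c i)
    (hγ : IsGoodContour (alpha c) γ) (hT : IsTrace c T) :
    ∃ G, IsPalindromic m G ∧ HasIntegralFormula c γ G T := by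
  let κ : ℤ → ℂ := fun q => traceFamily T q 1 - traceFamily T (q + 1) 1
  have hκ : ∀ p q : ℤ, (p : ZMod (2 * m)) = q → κ p = κ q := by
    intro p q h
    simp only [κ]
    rw [traceFamily_congr T h, traceFamily_congr T (p := p + 1) (q := q + 1)]
    rw [Int.cast_add, h, Int.cast_add]
  -- The sum of the defects over a period telescopes to zero; their antisymmetry below comes from
  -- conjugating `e_q` by `h`.
  obtain ⟨G, hG, hres⟩ := hγ.exists_residue hκ (by
    have h := Finset.sum_range_sub' (fun q : ℕ => traceFamily T q 1) (2 * m)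
    push_cast at h
    simp only [κ]
    rw [h, sub_eq_zero, traceFamily_congr T (p := 0) (q := 2 * m)]
    have := intCast_add_period (m := m) 0
    push_cast at this ⊢
    rw [← this, zero_add])
  refine ⟨G, hγ.isPalindromic hc0 hc hG fun q => ?_, (hasIntegralFormula_iff hγ hG).2 ?_⟩
  · rw [hres, hres]
    simp only [κ]
    rw [sub_add_cancel, ← traceFamily_one_neg hT (q + 1), ← traceFamily_one_neg hT q,
      neg_add, ← sub_eq_add_neg, neg_sub]
  · refine family_ext (NeZero.ne (2 * m))
      (fun q => traceFamily_congr T (intCast_add_period q))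
      (fun q => moment_congr hγ hG (intCast_add_period q))
      (shift_of_lin_shift hc0 fun q R => hT.shift hc0 q R) fun q f => ?_
    rw [moment_shift, hres]

/-! ### Values on the conjugacy classes of `h` and `g h` -/

/-- The class function with value `s` at even and `t` at odd residues modulo `n`. -/
def classValue (m : ℕ) (s t : ℂ) (j : ZMod (2 * m)) : ℂ :=
  if ZMod.castHom (Dvd.intro m rfl : 2 ∣ 2 * m) (ZMod 2) j = 0 then s else t

theorem classValue_neg (s t : ℂ) (j : ZMod (2 * m)) :
    classValue m s t (-j) = classValue m s t j := by
  simp only [classValue, map_neg, neg_eq_zero]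

theorem classValue_add_two (s t : ℂ) (j : ZMod (2 * m)) :
    classValue m s t (j + 2) = classValue m s t j := by
  rw [classValue, map_add, map_ofNat, show (OfNat.ofNat 2 : ZMod 2) = 0 from rfl, add_zero,
    classValue]

theorem hasClassValues_iff {s t : ℂ} : HasClassValues c s t T ↔
    ∀ j : ZMod (2 * m), T (grp c (.a j) * grp c (hGen m)) = classValue m s t j := by
  constructor
  · rintro ⟨h0, h1⟩ j
    obtain ⟨k, rfl⟩ := ZMod.intCast_surjective j
    rw [← map_mul, ← gGen_zpow]
    rcases Int.even_or_odd' k with ⟨i, rfl | rfl⟩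
    · rw [h0, classValue, if_pos]
      rw [map_intCast, ZMod.intCast_zmod_eq_zero_iff_dvd]
      exact ⟨i, by push_cast; rfl⟩
    · rw [h1, classValue, if_neg]
      rw [map_intCast, ZMod.intCast_zmod_eq_zero_iff_dvd]
      rintro ⟨l, hl⟩
      push_cast at hl
      omega
  · intro h
    constructor <;> intro i <;> rw [map_mul, gGen_zpow, h, classValue, map_intCast]
    · rw [if_pos]
      rw [ZMod.intCast_zmod_eq_zero_iff_dvd]
      exact ⟨i, by push_cast; rfl⟩
    · rw [if_neg]
      rw [ZMod.intCast_zmod_eq_zero_iff_dvd]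
      rintro ⟨l, hl⟩
      push_cast at hl
      omega

/-- Conjugating `h` and `g h` by `g^i` gives `g^{2i} h` and `g^{2i+1} h`. -/
theorem IsTrace.hasClassValues (hT : IsTrace c T) :
    HasClassValues c (T (grp c (hGen m))) (T (grp c (gGen m * hGen m))) T := by
  constructor <;> intro i <;> refine Eq.trans ?_ (isTrace_inv hT (gGen m ^ i) _) <;>
    rw [← map_mul, ← map_mul, gGen_zpow, gGen_zpow, a_inv] <;> congr 2
  · simp only [hGen, QuaternionGroup.a_mul_xa, QuaternionGroup.xa_mul_a]
    congr 1
    push_cast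
    ring
  · simp only [hGen, gGen, QuaternionGroup.a_mul_xa, QuaternionGroup.xa_mul_a]
    congr 1
    push_cast
    ring

/-- The value at `e_q h` of a functional with class values `s` and `t`. -/
def idempotentValue (m : ℕ) [NeZero m] (s t : ℂ) (q : ZMod (2 * m)) : ℂ :=
  ∑ j : ZMod (2 * m), 1 / ((2 * m : ℕ) : ℂ) * ZMod.stdAddChar (j * q) * classValue m s t j

theorem HasClassValues.e_h {s t : ℂ} (h : HasClassValues c s t T) (q : ℤ) :
    T (eH c q * grp c (hGen m)) = idempotentValue m s t q := by
  rw [eH_eq, cyc, Finset.sum_mul, map_sum, idempotentValue]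
  refine Finset.sum_congr rfl fun j _ => ?_
  rw [smul_mul_assoc, map_smul, hasClassValues_iff.1 h, smul_eq_mul]

theorem idempotentValue_neg (s t : ℂ) (q : ZMod (2 * m)) :
    idempotentValue m s t (-q) = idempotentValue m s t q := by
  rw [idempotentValue, idempotentValue, ← Equiv.sum_comp (Equiv.neg (ZMod (2 * m)))]
  refine Finset.sum_congr rfl fun j _ => ?_
  rw [Equiv.neg_apply, neg_mul_neg, classValue_neg]

/-- The class function has period two, so translating the summation variable by two multiplies its
Fourier coefficient at `q` by `ε^{2q}`, which is not `1`. -/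
theorem idempotentValue_eq_zero (s t : ℂ) (q : ZMod (2 * m)) (hq : 2 * q ≠ 0) :
    idempotentValue m s t q = 0 := by
  have h : idempotentValue m s t q = ZMod.stdAddChar (2 * q) * idempotentValue m s t q := by
    conv_lhs => rw [idempotentValue, ← Equiv.sum_comp (Equiv.addRight (2 : ZMod (2 * m)))]
    rw [idempotentValue, Finset.mul_sum]
    refine Finset.sum_congr rfl fun j _ => ?_
    rw [Equiv.coe_addRight, classValue_add_two, add_mul, AddChar.map_add_eq_mul]
    ring
  have h1 := stdAddChar_ne_one hq
  have h2 : (ZMod.stdAddChar (2 * q) - 1 : ℂ) * idempotentValue m s t q = 0 := by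
    linear_combination -h
  exact (mul_eq_zero.1 h2).resolve_left (sub_ne_zero.2 h1)

/-- Fourier inversion on `ℤ/n`. -/
theorem hasClassValues_of_e_h {s t : ℂ}
    (h : ∀ q : ℤ, T (eH c q * grp c (hGen m)) = idempotentValue m s t q) :
    HasClassValues c s t T := by
  refine hasClassValues_iff.2 fun j => ?_
  have hn : ((2 * m : ℕ) : ℂ) ≠ 0 := Nat.cast_ne_zero.2 (NeZero.ne _)
  have e : ∀ q : ZMod (2 * m), ((q.val : ℤ) : ZMod (2 * m)) = q := fun q => by simp
  calc T (grp c (.a j) * grp c (hGen m))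
      = ∑ q : ZMod (2 * m), ZMod.stdAddChar (-(j * q)) * idempotentValue m s t q := by
        rw [← mul_one (grp c (.a j)), ← sum_e, Finset.mul_sum, Finset.sum_mul, map_sum]
        refine Finset.sum_congr rfl fun q _ => ?_
        rw [a_mul_e, smul_mul_assoc, map_smul, h, e, smul_eq_mul]
    _ = ∑ i : ZMod (2 * m), 1 / ((2 * m : ℕ) : ℂ) * classValue m s t i *
          ∑ q : ZMod (2 * m), (ZMod.stdAddChar (q * (i - j)) : ℂ) := by
        simp only [idempotentValue, Finset.mul_sum]
        rw [Finset.sum_comm]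
        refine Finset.sum_congr rfl fun i _ => Finset.sum_congr rfl fun q _ => ?_
        rw [show q * (i - j) = -(j * q) + i * q by ring, AddChar.map_add_eq_mul]
        ring
    _ = classValue m s t j := by
        simp only [sum_stdAddChar_mul, sub_eq_zero, mul_ite, mul_zero, Finset.sum_ite_eq',
          Finset.mem_univ, if_true]
        field_simp

/-! ### Traces from integrals -/

theorem HasIntegralFormula.lin_shift (hγ : IsGoodContour (alpha c) γ) {G : ℂ[X]}
    (hG : G.natDegree ≤ 2 * m - 2) (h : HasIntegralFormula c γ G T) (q : ℤ) (R : ℂ[X]) :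
    T (kp c (lin c q * R) * eH c q) =
      T (kp c (taylor (-1) (lin c q * R)) * eH c (q + 1)) := by
  have := lin_shift_of_shift (moment_shift hγ hG) q R
  rwa [← (hasIntegralFormula_iff hγ hG).1 h] at this

theorem exists_isTrace (hc0 : c 0 ≠ 0) (hc : ∀ i, c (-i) = c i)
    (hγ : IsGoodContour (alpha c) γ) {G : ℂ[X]} (hG : IsPalindromic m G) (s t : ℂ) :
    ∃ T : H c →ₗ[ℂ] ℂ, IsTrace c T ∧ HasIntegralFormula c γ G T ∧ HasClassValues c s t T := by
  -- `exists_trace` takes families indexed by residues modulo `n`; periodicity allows passing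
  -- through the representative `val`.
  have e : ∀ q : ℤ, moment hγ hG.1 (((q : ZMod (2 * m)).val : ℤ)) = moment hγ hG.1 q := fun q =>
    moment_congr hγ hG.1 (by simp)
  obtain ⟨T, hT, h1, h2⟩ := exists_trace (J := fun q => moment hγ hG.1 (q.val : ℤ))
    (E := idempotentValue m s t) hc0 hc (idempotentValue_neg s t) (idempotentValue_eq_zero s t)
    (fun q R => by
      have h3 := LinearMap.congr_fun (congrFun (moment_reflect hc0 hc hγ hG) (q.val : ℤ)) R
      rw [reflectFamily_apply] at h3
      rw [← h3]
      congr 1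
      exact moment_congr hγ hG.1 (by simp))
    (fun q R => by
      simp only [e]
      exact lin_shift_of_shift (moment_shift hγ hG.1) q R)
  exact ⟨T, hT, fun q R => (h1 q R).trans (LinearMap.congr_fun (e q) R), hasClassValues_of_e_h h2⟩

theorem IsTrace.eq_of_data (hc0 : c 0 ≠ 0) (hc : ∀ i, c (-i) = c i) {T' : H c →ₗ[ℂ] ℂ}
    (hT : IsTrace c T) (hT' : IsTrace c T') {G : ℂ[X]} {s t : ℂ}
    (h : HasIntegralFormula c γ G T) (h' : HasIntegralFormula c γ G T')
    (hs : HasClassValues c s t T) (hs' : HasClassValues c s t T') : T = T' :=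
  ((hT.isExtended hc0 hc).rules hc0).ext hc0 hc ((hT'.isExtended hc0 hc).rules hc0)
    (fun R q => (h q R).trans (h' q R).symm) fun q => (hs.e_h q).trans (hs'.e_h q).symm

end Moments

end DicyclicTrace

end

theorem mainTheorem6 (m : ℕ) [NeZero m] (c : ZMod (2 * m) → ℂ) (hc0 : c 0 ≠ 0)
    (hc : ∀ i, c (-i) = c i) (γ : ℝ → ℂ)
    (hγ : DicyclicTrace.IsGoodContour (DicyclicTrace.alpha c) γ) :
    -- the contour integrals converge absolutely
    (∀ G : Polynomial ℂ, DicyclicTrace.IsPalindromic m G → ∀ (q : ℤ) (R : Polynomial ℂ),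
      MeasureTheory.Integrable
        (DicyclicTrace.pullback γ fun z => R.eval z * DicyclicTrace.wq c G q z)) ∧
    -- every trace comes from a unique polynomial `G` and a unique pair of class values
    (∀ T : DicyclicTrace.H c →ₗ[ℂ] ℂ, DicyclicTrace.IsTrace c T →
      ∃! p : Polynomial ℂ × ℂ × ℂ, DicyclicTrace.IsPalindromic m p.1 ∧
        DicyclicTrace.HasIntegralFormula c γ p.1 T ∧
        DicyclicTrace.HasClassValues c p.2.1 p.2.2 T) ∧
    -- all such data occur, each for exactly one trace
    (∀ (G : Polynomial ℂ) (s t : ℂ), DicyclicTrace.IsPalindromic m G →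
      ∃! T : DicyclicTrace.H c →ₗ[ℂ] ℂ, DicyclicTrace.IsTrace c T ∧
        DicyclicTrace.HasIntegralFormula c γ G T ∧ DicyclicTrace.HasClassValues c s t T) ∧
    -- this trace is the extension of the data by the explicit rules
    (∀ (G : Polynomial ℂ) (s t : ℂ), DicyclicTrace.IsPalindromic m G →
      ∀ T : DicyclicTrace.H c →ₗ[ℂ] ℂ, DicyclicTrace.HasIntegralFormula c γ G T →
        DicyclicTrace.HasClassValues c s t T →
        (DicyclicTrace.IsTrace c T ↔ DicyclicTrace.IsExtended c T)) := by
  refine ⟨fun G hG q R => hγ.integrable_wq hG.1 q R, fun T hT => ?_, fun G s t hG => ?_,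
    fun G s t hG T hI hV => ⟨fun hT => hT.isExtended hc0 hc, fun hT => ?_⟩⟩
  · obtain ⟨G, hG, hI⟩ := hT.exists_integralFormula hc0 hc hγ
    refine ⟨(G, _, _), ⟨hG, hI, hT.hasClassValues⟩, ?_⟩
    rintro ⟨G', s, t⟩ ⟨hG', hI', hV⟩
    refine Prod.ext (hγ.ext_of_residue hG'.1 hG.1 fun q => ?_) (Prod.ext ?_ ?_)
    · rw [hI'.residue_eq hγ hG'.1, hI.residue_eq hγ hG.1]
    · simpa using (hV.1 0).symm
    · simpa using (hV.2 0).symm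
  · obtain ⟨T, hT, hI, hV⟩ := DicyclicTrace.exists_isTrace hc0 hc hγ hG s t
    exact ⟨T, ⟨hT, hI, hV⟩, fun T' h => h.1.eq_of_data hc0 hc hT h.2.1 hI h.2.2 hV⟩
  -- The integral formula supplies the shift identity, the one condition not contained in the
  -- extension rules.
  · exact (hT.rules hc0).isTrace hc0 hc (hI.lin_shift hγ hG.1)
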